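/- **Conventions.** Let $G$ be a locally compact Hausdorff groupoid with object space $G^0$, arrow space $G^1$, range and source maps $r,s\colon G^1\to G^0$, and space $G^2=\{(g,h): s(g)=r(h)\}$ of composable pairs. Let $\alpha=(\alpha^x)_{x\in G^0}$ be a left Haar system: a continuous family of Radon measures $\alpha^x$ with full support on the fibres $r^{-1}(x)$ that is left invariant, $\int \xi(k)\,d\alpha^{r(g)}(k)=\int \xi(gh)\,d\alpha^{s(g)}(h)$ for $\xi\in C_c(G^1)$. Let $\tilde\alpha_x$ be the push-forward of $\alpha^x$ under inversion, a continuous family of measures on the fibres of $s$. "Hilbert module" means right Hilbert module over a C*-algebra. A *representation* of a C*-algebra $A$ on a Hilbert $D$-module $F$ is a nondegenerate *-homomorphism from $A$ to the adjointable operators on $F$; then $F$ is also called a C*-correspondence from $A$ to $D$. An *isometry* between Hilbert $D$-modules is a linear map that preserves the $D$-valued inner products (it need not be adjointable); a *unitary* is a surjective isometry. The C*-algebra $C^*(G,\alpha)$ is the completion of $C_c(G^1)$ with the operations $(f_1*f_2)(k)=\int f_1(g)f_2(g^{-1}k)\,d\alpha^{r(k)}(g)$ and $f^*(g)=\overline{f(g^{-1})}$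 in the norm $\|f\|=\sup_L\|L(f)\|$, where $L$ runs through the nondegenerate *-representations of this *-algebra on Hilbert spaces with $\|L(f)\|\le\|f\|_I:=\max\{\sup_x\int|f|\,d\alpha^x,\ \sup_x\int|f|\,d\tilde\alpha_x\}$ for all $f$. If $\lambda=(\lambda_y)_{y\in Y}$ is a continuous family of measures along a continuous map $f\colon X\to Y$ of locally compact Hausdorff spaces, also write $\lambda\colon C_c(X)\to C_c(Y)$, $(\lambda\xi)(y)=\int\xi\,d\lambda_y$, and let $\mathcal L^2(X,f,\lambda)$ be the Hilbert $C_0(Y)$-module completion of $C_c(X)$ for $\langle\xi,\eta\rangle=\lambda(\overline\xi\eta)$ and $(\xi\cdot\psi)(x)=\xi(x)\psi(f(x))$; $C_0(X)$ acts on it by pointwise multiplication. If $\mu$ is a continuous family of measures along $g\colon Y\to Z$ and $\varphi$ is a representation of $C_0(Z)$ on $F$, then $\xi\otimes(\eta\otimes x)\mapsto \xi\cdot(\eta\circ f)\otimes x$ for $\xi\in C_c(X)$, $\eta\in C_c(Y)$, $x\in F$ defines a canonical unitary $$\mathcal L^2(X,f,\lambda)\otimes_{C_0(Y)}\bigl(\mathcal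 L^2(Y,g,\mu)\otimes_\varphi F\bigr)\cong \mathcal L^2(X,g\circ f,\mu\circ\lambda)\otimes_\varphi F .$$ Define $d_0,d_1,d_2\colon G^2\to G^1$ by $d_0(g,h)=h$, $d_1(g,h)=gh$, $d_2(g,h)=g$, with the continuous families of measures $$(\lambda_0f)(h)=\int f(g,h)\,d\tilde\alpha_{r(h)}(g),\quad (\lambda_1f)(k)=\int f(g,g^{-1}k)\,d\alpha^{r(k)}(g),\quad (\lambda_2f)(g)=\int f(g,h)\,d\alpha^{s(g)}(h).$$ Then $\mu_0:=\alpha\circ\lambda_2=\alpha\circ\lambda_1$, $\mu_1:=\alpha\circ\lambda_0=\tilde\alpha\circ\lambda_2$ and $\mu_2:=\tilde\alpha\circ\lambda_0=\tilde\alpha\circ\lambda_1$ are continuous families of measures along $v_0(g,h)=r(g)$, $v_1(g,h)=s(g)=r(h)$ and $v_2(g,h)=s(h)$. A *representation of $(G,\alpha)$* on a Hilbert $D$-module $F$ is a pair $(\varphi,U)$ of a representation $\varphi$ of $C_0(G^0)$ on $F$ and a unitary $$U\colon \mathcal L^2(G^1,s,\tilde\alpha)\otimes_\varphi F\to\mathcal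 L^2(G^1,r,\alpha)\otimes_\varphi F$$ that intertwines the left actions of $C_0(G^1)$ and satisfies $d_1^*(U)=d_2^*(U)\circ d_0^*(U)$ as unitaries $\mathcal L^2(G^2,v_2,\mu_2)\otimes_\varphi F\to\mathcal L^2(G^2,v_0,\mu_0)\otimes_\varphi F$. Here $d_i^*(U)$ is the unitary that corresponds, under the canonical unitaries above, to $1\otimes U$ on $\mathcal L^2(G^2,d_i,\lambda_i)\otimes_{C_0(G^1)}-$. **Theorem.** There are bijections, one for each C*-algebra $D$ and each Hilbert $D$-module $F$, between the representations of $C^*(G,\alpha)$ on $F$ and the representations of $(G,\alpha)$ on $F$, that are natural in the following two ways. 1. Let $V\colon F_1\to F_2$ be an isometry of Hilbert $D$-modules, and let $\pi_1,\pi_2$ be representations of $C^*(G,\alpha)$ on $F_1,F_2$, corresponding to $(\varphi_1,U_1)$, $(\varphi_2,U_2)$. Then $V\pi_1(b)=\pi_2(b)V$ for all $b\in C^*(G,\alpha)$ if and only if $V\varphi_1(f)=\varphi_2(f)V$ for all $f\in C_0(G^0)$ and $(1\otimes V)U_1=U_2(1\otimes V)$. 2. Let $E$ be a C*-correspondence from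 $D$ to $D'$. If a representation $\pi$ of $C^*(G,\alpha)$ on $F$ corresponds to $(\varphi,U)$, then the induced representation $\pi\otimes1$ on $F\otimes_D E$ corresponds to the induced representation $(\varphi\otimes 1,U\otimes1)$ of $(G,\alpha)$, where $U\otimes 1$ is transported along the associativity isomorphisms $(\mathcal L^2\otimes_\varphi F)\otimes_D E\cong\mathcal L^2\otimes_{\varphi\otimes 1}(F\otimes_D E)$. This universal property characterises $C^*(G,\alpha)$ uniquely up to canonical isomorphism: if $B$ is a C*-algebra with bijections between representations of $B$ and representations of $(G,\alpha)$ on all Hilbert modules over all C*-algebras that satisfy 1 and 2 (with $B$ in place of $C^*(G,\alpha)$), then there is a unique *-isomorphism $e\colon B\to C^*(G,\alpha)$ such that for every representation $\pi$ of $C^*(G,\alpha)$, the representations $\pi$ of $C^*(G,\alpha)$ and $\pi\circ e$ of $B$ correspond to the same representation of $(G,\alpha)$. -/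

import Mathlib

universe u

namespace GroupoidRep

open scoped TensorProduct

/-! ## Right Hilbert modules -/

/-- A `D`-valued semi-inner product on a complex vector space `V` with a right action of the
C*-algebra `D`: conjugate-linear in the first and linear in the second variable.  An element of `D`
is positive if it is of the form `star c * c`.  (Additivity of the action follows up to vectors of
norm zero.) -/
structure PreHilbertModule (D : Type u) [NonUnitalCStarAlgebra D] (V : Type u)
    [AddCommGroup V] [Module ℂ V] where
  /-- the inner product -/
  inner : V → V → D
  /-- the right action -/
  act : V → D → V
  inner_add_right : ∀ x y z, inner x (y + z) = inner x y + inner x z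
  inner_smul_right : ∀ (c : ℂ) x y, inner x (c • y) = c • inner x y
  star_inner : ∀ x y, star (inner x y) = inner y x
  inner_self_pos : ∀ x, ∃ c : D, inner x x = star c * c
  inner_act_right : ∀ x y d, inner x (act y d) = inner x y * d

namespace PreHilbertModule

section

variable {D : Type u} [NonUnitalCStarAlgebra D] {V : Type u} [AddCommGroup V] [Module ℂ V]
  (P : PreHilbertModule D V)

lemma inner_add_left (x y z : V) : P.inner (x + y) z = P.inner x z + P.inner y z := by
  rw [← P.star_inner, P.inner_add_right, star_add, P.star_inner, P.star_inner]

lemma inner_smul_left (c : ℂ) (x y : V) : P.inner (c • x) y = star c • P.inner x y := by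
  rw [← P.star_inner, P.inner_smul_right, star_smul, P.star_inner]

lemma inner_act_left (x y : V) (d : D) : P.inner (P.act x d) y = star d * P.inner x y := by
  rw [← P.star_inner, P.inner_act_right, star_mul, P.star_inner]

/-- The inner product as a sesquilinear map. -/
def innerₛₗ : V →ₗ⋆[ℂ] V →ₗ[ℂ] D :=
  LinearMap.mk₂'ₛₗ (starRingEnd ℂ) (RingHom.id ℂ) P.inner P.inner_add_left P.inner_smul_left
    P.inner_add_right P.inner_smul_right

@[simp] lemma innerₛₗ_apply (x y : V) : P.innerₛₗ x y = P.inner x y := rfl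

lemma inner_sub_right (x y z : V) : P.inner x (y - z) = P.inner x y - P.inner x z :=
  (P.innerₛₗ x).map_sub y z

lemma inner_sub_left (x y z : V) : P.inner (x - y) z = P.inner x z - P.inner y z := by
  rw [← P.star_inner, P.inner_sub_right, star_sub, P.star_inner, P.star_inner]

lemma inner_zero_right (x : V) : P.inner x 0 = 0 := (P.innerₛₗ x).map_zero

lemma inner_zero_left (x : V) : P.inner 0 x = 0 := by
  rw [← P.star_inner, P.inner_zero_right, star_zero]

lemma inner_sum_right {ι : Type*} (s : Finset ι) (x : V) (f : ι → V) :
    P.inner x (∑ i ∈ s, f i) = ∑ i ∈ s, P.inner x (f i) := map_sum (P.innerₛₗ x) f s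

lemma inner_sum_left {ι : Type*} (s : Finset ι) (x : V) (f : ι → V) :
    P.inner (∑ i ∈ s, f i) x = ∑ i ∈ s, P.inner (f i) x := by
  rw [← P.star_inner, P.inner_sum_right, star_sum]
  simp only [P.star_inner]

lemma norm_inner_sq_le (x y : V) :
    ‖P.inner x y‖ ^ 2 ≤ ‖P.inner x x‖ * ‖P.inner y y‖ := by
  let _ := CStarAlgebra.spectralOrder D
  have := CStarAlgebra.spectralOrderedRing D
  have pos : ∀ v, 0 ≤ P.inner v v := fun v => by
    obtain ⟨c, hc⟩ := P.inner_self_pos v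
    rw [hc]; exact star_mul_self_nonneg c
  set p := ‖P.inner x x‖ with hp
  have key : ∀ t : ℝ, p < t → ‖P.inner x y‖ ^ 2 ≤ t * ‖P.inner y y‖ := by
    intro t ht
    have hp0 : 0 ≤ p := norm_nonneg _
    have ht0 : 0 < t := lt_of_le_of_lt hp0 ht
    set a := P.inner x y with ha
    have ha' : P.inner y x = star a := (P.star_inner x y).symm
    have h1 := pos (P.act x a - (t : ℂ) • y)
    have h2 : P.inner (P.act x a - (t : ℂ) • y) (P.act x a - (t : ℂ) • y)
        = star a * P.inner x x * a - (2 * t) • (star a * a) + t ^ 2 • P.inner y y := by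
      simp only [inner_sub_left, inner_sub_right, inner_smul_left, inner_act_left,
        P.inner_smul_right, P.inner_act_right, ha', ← ha]
      simp only [RCLike.star_def, Complex.conj_ofReal, ← Complex.coe_smul, mul_assoc, sub_mul,
        smul_mul_assoc]
      push_cast
      module
    have h3 : star a * P.inner x x * a ≤ p • (star a * a) :=
      CStarAlgebra.star_left_conjugate_le_norm_smul (hb := by
        rw [IsSelfAdjoint, P.star_inner])
    have h4 : t • (star a * a) ≤ t ^ 2 • P.inner y y := by
      have h5 : (0 : D) ≤ (t - p) • (star a * a) :=
        smul_nonneg (by linarith) (star_mul_self_nonneg a)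
      rw [h2] at h1
      rw [← sub_nonneg] at h3 ⊢
      have := add_nonneg (add_nonneg h1 h3) h5
      convert this using 1
      module
    have h6 : star a * a ≤ t • P.inner y y := by
      have := smul_le_smul_of_nonneg_left h4 (inv_nonneg.2 ht0.le)
      rw [smul_smul, smul_smul, inv_mul_cancel₀ ht0.ne', one_smul] at this
      convert this using 2
      field_simp
    have h7 := CStarAlgebra.norm_le_norm_of_nonneg_of_le (star_mul_self_nonneg a) h6
    rw [CStarRing.norm_star_mul_self, norm_smul, Real.norm_of_nonneg ht0.le] at h7
    nlinarith
  by_cases hy : ‖P.inner y y‖ = 0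
  · have := key (p + 1) (by linarith)
    rw [hy] at this ⊢
    simpa using this
  · have hy' : 0 < ‖P.inner y y‖ := lt_of_le_of_ne (norm_nonneg _) (Ne.symm hy)
    rw [← div_le_iff₀ hy']
    refine le_of_forall_gt_imp_ge_of_dense fun t ht => ?_
    rw [div_le_iff₀ hy']
    exact key t ht

lemma norm_inner_le (x y : V) :
    ‖P.inner x y‖ ≤ √‖P.inner x x‖ * √‖P.inner y y‖ := by
  rw [← Real.sqrt_mul (norm_nonneg _)]
  exact Real.le_sqrt_of_sq_le (P.norm_inner_sq_le x y)

/-- The vector space `V`, to be equipped with the seminorm `√‖⟨x, x⟩‖`. -/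
@[nolint unusedArguments]
def Space (_P : PreHilbertModule D V) : Type u := V

noncomputable instance : AddCommGroup P.Space := inferInstanceAs (AddCommGroup V)
noncomputable instance : Module ℂ P.Space := inferInstanceAs (Module ℂ V)

/-- The semi-inner product, seen on the type `P.Space`. -/
def onSpace : PreHilbertModule D P.Space := P

/-- The identity map. -/
def toSpace : V →ₗ[ℂ] P.Space where
  toFun x := x
  map_add' _ _ := rfl
  map_smul' _ _ := rfl

lemma inner_toSpace (x y : V) :
    P.onSpace.inner (P.toSpace x) (P.toSpace y) = P.inner x y := rfl

lemma surjective_toSpace : Function.Surjective P.toSpace := fun x => ⟨x, rfl⟩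

noncomputable instance : Norm P.Space := ⟨fun x => √‖P.onSpace.inner x x‖⟩

lemma norm_def (x : P.Space) : ‖x‖ = √‖P.onSpace.inner x x‖ := rfl

lemma norm_sq (x : P.Space) : ‖x‖ ^ 2 = ‖P.onSpace.inner x x‖ := Real.sq_sqrt (norm_nonneg _)

lemma seminormCore : SeminormedSpace.Core ℂ P.Space where
  norm_nonneg _ := Real.sqrt_nonneg _
  norm_smul c x := by
    have : P.onSpace.inner (c • x) (c • x) = (star c * c) • P.onSpace.inner x x := by
      rw [P.onSpace.inner_smul_right, P.onSpace.inner_smul_left, smul_smul, mul_comm]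
    rw [norm_def, norm_def, this, norm_smul, norm_mul, norm_star, Real.sqrt_mul (by positivity),
      Real.sqrt_mul_self (norm_nonneg c)]
  norm_triangle x y := by
    have h0 : 0 ≤ ‖x‖ := Real.sqrt_nonneg _
    have h0' : 0 ≤ ‖y‖ := Real.sqrt_nonneg _
    refine Real.sqrt_le_iff.2 ⟨add_nonneg h0 h0', ?_⟩
    have h : P.onSpace.inner (x + y) (x + y)
        = P.onSpace.inner x x + P.onSpace.inner x y
          + (P.onSpace.inner y x + P.onSpace.inner y y) := by
      rw [P.onSpace.inner_add_left, P.onSpace.inner_add_right, P.onSpace.inner_add_right]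
    have h1 : ‖P.onSpace.inner x y‖ ≤ ‖x‖ * ‖y‖ := P.onSpace.norm_inner_le x y
    have h2 : ‖P.onSpace.inner y x‖ ≤ ‖y‖ * ‖x‖ := P.onSpace.norm_inner_le y x
    have h3 := P.norm_sq x
    have h4 := P.norm_sq y
    calc ‖P.onSpace.inner (x + y) (x + y)‖
        ≤ ‖P.onSpace.inner x x‖ + ‖P.onSpace.inner x y‖
          + (‖P.onSpace.inner y x‖ + ‖P.onSpace.inner y y‖) := by
          rw [h]
          exact (norm_add_le _ _).trans (add_le_add (norm_add_le _ _) (norm_add_le _ _))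
      _ ≤ (‖x‖ + ‖y‖) ^ 2 := by rw [← h3, ← h4]; nlinarith

noncomputable instance : SeminormedAddCommGroup P.Space :=
  SeminormedAddCommGroup.ofCore P.seminormCore

noncomputable instance : NormedSpace ℂ P.Space where
  norm_smul_le c x := (P.seminormCore.norm_smul c x).le

lemma norm_act_sub_le (x y : P.Space) (d : D) :
    ‖P.onSpace.act x d - P.onSpace.act y d‖ ≤ ‖x - y‖ * ‖d‖ := by
  have h : P.onSpace.inner (P.onSpace.act x d - P.onSpace.act y d)
      (P.onSpace.act x d - P.onSpace.act y d)
      = star d * P.onSpace.inner (x - y) (x - y) * d := by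
    simp only [inner_sub_left, inner_sub_right, inner_act_left, inner_act_right]
    noncomm_ring
  refine Real.sqrt_le_iff.2 ⟨by positivity, ?_⟩
  calc ‖P.onSpace.inner (P.onSpace.act x d - P.onSpace.act y d)
        (P.onSpace.act x d - P.onSpace.act y d)‖
      ≤ ‖d‖ * ‖P.onSpace.inner (x - y) (x - y)‖ * ‖d‖ := by
        rw [h]
        refine (norm_mul_le _ _).trans ?_
        gcongr
        refine (norm_mul_le _ _).trans ?_
        rw [norm_star]
    _ = (‖x - y‖ * ‖d‖) ^ 2 := by
        rw [← P.norm_sq]; ring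

lemma uniformContinuous_act (d : D) :
    UniformContinuous (fun x : P.Space => P.onSpace.act x d) :=
  (LipschitzWith.of_dist_le_mul (K := ‖d‖₊) fun x y => by
    rw [dist_eq_norm, dist_eq_norm, mul_comm]
    exact P.norm_act_sub_le x y d).uniformContinuous

lemma continuous_inner : Continuous fun p : P.Space × P.Space => P.onSpace.inner p.1 p.2 := by
  let B : P.Space →L⋆[ℂ] P.Space →L[ℂ] D :=
    LinearMap.mkContinuous₂ P.onSpace.innerₛₗ 1 fun x y => by
      rw [one_mul]; exact P.onSpace.norm_inner_le x y
  have : (fun p : P.Space × P.Space => P.onSpace.inner p.1 p.2) = fun p => B p.1 p.2 := rfl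
  rw [this]
  fun_prop

end

end PreHilbertModule

/-- A (right) Hilbert module over the C*-algebra `D`: a right `D`-module with a `D`-valued inner
product, complete for the norm `√‖⟨x, x⟩‖`. -/
structure HilbertModule (D : Type u) [NonUnitalCStarAlgebra D] where
  /-- the underlying type -/
  carrier : Type u
  [instGroup : NormedAddCommGroup carrier]
  [instSpace : NormedSpace ℂ carrier]
  [instComplete : CompleteSpace carrier]
  /-- the inner product and the right action -/
  pre : PreHilbertModule D carrier
  norm_eq : ∀ x : carrier, ‖x‖ = √‖pre.inner x x‖

namespace HilbertModule

variable {D : Type u} [NonUnitalCStarAlgebra D]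

instance : CoeSort (HilbertModule D) (Type u) := ⟨HilbertModule.carrier⟩

attribute [instance] HilbertModule.instGroup HilbertModule.instSpace HilbertModule.instComplete

/-- The `D`-valued inner product. -/
def inner (F : HilbertModule D) (x y : F) : D := F.pre.inner x y

/-- The right action of `D`. -/
def act (F : HilbertModule D) (x : F) (d : D) : F := F.pre.act x d

lemma norm_sq (F : HilbertModule D) (x : F) : ‖x‖ ^ 2 = ‖F.inner x x‖ := by
  rw [F.norm_eq]; exact Real.sq_sqrt (norm_nonneg _)

lemma norm_inner_le (F : HilbertModule D) (x y : F) : ‖F.inner x y‖ ≤ ‖x‖ * ‖y‖ := by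
  rw [F.norm_eq, F.norm_eq]; exact F.pre.norm_inner_le x y

lemma continuous_inner (F : HilbertModule D) :
    Continuous fun p : F × F => F.inner p.1 p.2 := by
  let B : F →L⋆[ℂ] F →L[ℂ] D :=
    LinearMap.mkContinuous₂ F.pre.innerₛₗ 1 fun x y => by
      rw [one_mul]; exact F.norm_inner_le x y
  have : (fun p : F × F => F.inner p.1 p.2) = fun p => B p.1 p.2 := rfl
  rw [this]
  fun_prop

lemma ext_inner (F : HilbertModule D) {x y : F} (h : ∀ z, F.inner z x = F.inner z y) :
    x = y := by
  have : ‖x - y‖ ^ 2 = 0 := by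
    rw [F.norm_sq, inner, F.pre.inner_sub_right]
    rw [show F.pre.inner (x - y) x = F.pre.inner (x - y) y from h _, sub_self, norm_zero]
  exact sub_eq_zero.1 (norm_eq_zero.1 (pow_eq_zero_iff two_ne_zero |>.1 this))

end HilbertModule

/-! ## Hausdorff completion -/

namespace PreHilbertModule

open UniformSpace

variable {D : Type u} [NonUnitalCStarAlgebra D] {V : Type u} [AddCommGroup V] [Module ℂ V]
  (P : PreHilbertModule D V)

/-- The extension of the inner product to the completion. -/
noncomputable def complInner : Completion P.Space → Completion P.Space → D :=
  Function.curry <| (Completion.isDenseInducing_coe.prodMap Completion.isDenseInducing_coe).extend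
    (fun p : P.Space × P.Space => P.onSpace.inner p.1 p.2)

lemma complInner_coe (x y : P.Space) : P.complInner (x : Completion P.Space) y = P.onSpace.inner x y :=
  (Completion.isDenseInducing_coe.prodMap Completion.isDenseInducing_coe).extend_eq
    P.continuous_inner (x, y)

lemma continuous_complInner :
    Continuous fun p : Completion P.Space × Completion P.Space => P.complInner p.1 p.2 := by
  let inner' : P.Space →+ P.Space →+ D :=
    { toFun := fun x => (P.onSpace.innerₛₗ x).toAddMonoidHom
      map_zero' := by ext x; exact P.onSpace.inner_zero_left _
      map_add' := fun x y => by ext z; exact P.onSpace.inner_add_left _ _ _ }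
  have : Continuous fun p : P.Space × P.Space => inner' p.1 p.2 := P.continuous_inner
  exact (Completion.isDenseInducing_toCompl P.Space).extend_Z_bilin
    (Completion.isDenseInducing_toCompl P.Space) this

lemma continuous_complInner' {α : Type*} [TopologicalSpace α] {f g : α → Completion P.Space}
    (hf : Continuous f) (hg : Continuous g) : Continuous fun a => P.complInner (f a) (g a) :=
  P.continuous_complInner.comp (hf.prodMk hg)

/-- The extension of the right action to the completion. -/
noncomputable def complAct (x : Completion P.Space) (d : D) : Completion P.Space :=
  Completion.map (fun y : P.Space => P.onSpace.act y d) x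

lemma complAct_coe (x : P.Space) (d : D) :
    P.complAct (x : Completion P.Space) d = (P.onSpace.act x d : P.Space) :=
  Completion.map_coe (P.uniformContinuous_act d) x

lemma continuous_complAct (d : D) : Continuous fun x => P.complAct x d :=
  Completion.continuous_map

lemma isClosed_pos : IsClosed {d : D | ∃ c : D, d = star c * c} := by
  let _ := CStarAlgebra.spectralOrder D
  have := CStarAlgebra.spectralOrderedRing D
  have : {d : D | ∃ c : D, d = star c * c} = {d : D | 0 ≤ d} := by
    ext d; exact CStarAlgebra.nonneg_iff_eq_star_mul_self.symm
  rw [this]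
  exact CStarAlgebra.isClosed_nonneg

lemma complInner_add_right (x y z : Completion P.Space) :
    P.complInner x (y + z) = P.complInner x y + P.complInner x z := by
  refine Completion.induction_on₃ x y z (isClosed_eq ?_ ?_) fun a b c => ?_
  · exact P.continuous_complInner' continuous_fst
      (continuous_snd.fst.add continuous_snd.snd)
  · exact (P.continuous_complInner' continuous_fst continuous_snd.fst).add
      (P.continuous_complInner' continuous_fst continuous_snd.snd)
  · rw [← Completion.coe_add, complInner_coe, complInner_coe, complInner_coe]
    exact P.onSpace.inner_add_right a b c

lemma complInner_smul_right (c : ℂ) (x y : Completion P.Space) :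
    P.complInner x (c • y) = c • P.complInner x y := by
  refine Completion.induction_on₂ x y (isClosed_eq ?_ ?_) fun a b => ?_
  · exact P.continuous_complInner' continuous_fst (continuous_snd.const_smul c)
  · exact (P.continuous_complInner' continuous_fst continuous_snd).const_smul c
  · rw [← Completion.coe_smul, complInner_coe, complInner_coe]
    exact P.onSpace.inner_smul_right c a b

lemma star_complInner (x y : Completion P.Space) :
    star (P.complInner x y) = P.complInner y x := by
  refine Completion.induction_on₂ x y (isClosed_eq ?_ ?_) fun a b => ?_
  · exact (P.continuous_complInner' continuous_fst continuous_snd).star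
  · exact P.continuous_complInner' continuous_snd continuous_fst
  · rw [complInner_coe, complInner_coe]
    exact P.onSpace.star_inner a b

lemma complInner_self_pos (x : Completion P.Space) :
    ∃ c : D, P.complInner x x = star c * c := by
  refine Completion.induction_on x ((isClosed_pos (D := D)).preimage
    (P.continuous_complInner' continuous_id continuous_id)) fun a => ?_
  rw [complInner_coe]
  exact P.onSpace.inner_self_pos a

lemma complInner_act_right (x y : Completion P.Space) (d : D) :
    P.complInner x (P.complAct y d) = P.complInner x y * d := by
  refine Completion.induction_on₂ x y (isClosed_eq ?_ ?_) fun a b => ?_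
  · exact P.continuous_complInner' continuous_fst ((P.continuous_complAct d).comp continuous_snd)
  · exact (P.continuous_complInner' continuous_fst continuous_snd).mul continuous_const
  · rw [complAct_coe, complInner_coe, complInner_coe]
    exact P.onSpace.inner_act_right a b d

/-- The Hausdorff completion of a pre-Hilbert module is a Hilbert module. -/
noncomputable def completion : HilbertModule D where
  carrier := Completion P.Space
  pre :=
    { inner := P.complInner
      act := P.complAct
      inner_add_right := P.complInner_add_right
      inner_smul_right := P.complInner_smul_right
      star_inner := P.star_complInner
      inner_self_pos := P.complInner_self_pos
      inner_act_right := P.complInner_act_right }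
  norm_eq x := by
    refine Completion.induction_on x (isClosed_eq continuous_norm ?_) fun a => ?_
    · exact (P.continuous_complInner' continuous_id continuous_id).norm.sqrt
    · simp only [complInner_coe, Completion.norm_coe]
      exact P.norm_def a

/-- The canonical map with dense range from a pre-Hilbert module to its completion. -/
noncomputable def toCompletion : V →ₗ[ℂ] P.completion :=
  (Completion.toComplₗᵢ (𝕜 := ℂ) (E := P.Space)).toLinearMap ∘ₗ P.toSpace

lemma inner_toCompletion (x y : V) :
    P.completion.inner (P.toCompletion x) (P.toCompletion y) = P.inner x y :=
  P.complInner_coe (P.toSpace x) (P.toSpace y)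

lemma dense_toCompletion : DenseRange P.toCompletion :=
  (Completion.denseRange_coe (α := P.Space)).comp P.surjective_toSpace.denseRange
    (Completion.continuous_coe P.Space)

lemma norm_toCompletion (x : V) : ‖P.toCompletion x‖ = √‖P.inner x x‖ := by
  rw [P.completion.norm_eq]
  exact congrArg (fun d => √‖d‖) (P.inner_toCompletion x x)

end PreHilbertModule

end GroupoidRep

namespace GroupoidRep

open scoped TensorProduct

/-! ## Representations and isometries -/

section Basic

variable {D : Type u} [NonUnitalCStarAlgebra D]

/-- A *-homomorphism from the C*-algebra `A` to the adjointable operators on the Hilbert module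
`F`. -/
structure StarRep (A : Type u) [NonUnitalCStarAlgebra A] (F : HilbertModule D) where
  /-- the underlying homomorphism -/
  toHom : A →ₙₐ[ℂ] (F →L[ℂ] F)
  adjoint : ∀ a x y, F.inner (toHom (star a) x) y = F.inner x (toHom a y)

instance (A : Type u) [NonUnitalCStarAlgebra A] (F : HilbertModule D) :
    CoeFun (StarRep A F) (fun _ => A → F →L[ℂ] F) := ⟨fun π => π.toHom⟩

/-- A representation of the C*-algebra `A` on the Hilbert `D`-module `F`: a nondegenerate
*-homomorphism to the adjointable operators.  It turns `F` into a C*-correspondence from `A`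
to `D`. -/
structure Rep (A : Type u) [NonUnitalCStarAlgebra A] (F : HilbertModule D)
    extends StarRep A F where
  nondegenerate : Dense (Submodule.span ℂ {y : F | ∃ a x, toHom a x = y} : Set F)

instance (A : Type u) [NonUnitalCStarAlgebra A] (F : HilbertModule D) :
    CoeFun (Rep A F) (fun _ => A → F →L[ℂ] F) := ⟨fun π => π.toHom⟩

/-- The representation `π ∘ e`, for an isomorphism `e`. -/
def Rep.comp {A B : Type u} [NonUnitalCStarAlgebra A] [NonUnitalCStarAlgebra B]
    {F : HilbertModule D} (π : Rep A F) (e : B ≃⋆ₐ[ℂ] A) : Rep B F where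
  toHom :=
    { toFun := fun b => π (e b)
      map_smul' := fun c b => by simp
      map_zero' := by simp
      map_add' := fun a b => by simp
      map_mul' := fun a b => by simp }
  adjoint a x y := by
    have := π.adjoint (e a) x y
    rwa [← map_star] at this
  nondegenerate := by
    convert π.nondegenerate using 5 with y
    constructor
    · rintro ⟨b, x, h⟩
      exact ⟨e b, x, h⟩
    · rintro ⟨a, x, h⟩
      exact ⟨e.symm a, x, by simpa using h⟩

/-- An isometry between Hilbert modules: a linear map that preserves the inner products.  It need
not be adjointable, and it is automatically `D`-linear. -/
structure Isometry (E F : HilbertModule D) where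
  /-- the underlying linear map -/
  toLin : E →ₗ[ℂ] F
  inner_map : ∀ x y, F.inner (toLin x) (toLin y) = E.inner x y

instance (E F : HilbertModule D) : CoeFun (Isometry E F) (fun _ => E → F) := ⟨fun V => V.toLin⟩

lemma Isometry.norm_map {E F : HilbertModule D} (V : Isometry E F) (x : E) : ‖V x‖ = ‖x‖ := by
  rw [F.norm_eq, E.norm_eq]
  exact congrArg (fun d => √‖d‖) (V.inner_map x x)

/-- The isometry, as a linear isometry of normed spaces. -/
def Isometry.toLI {E F : HilbertModule D} (V : Isometry E F) : E →ₗᵢ[ℂ] F where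
  toLinearMap := V.toLin
  norm_map' := V.norm_map

lemma Isometry.continuous {E F : HilbertModule D} (V : Isometry E F) : Continuous V :=
  V.toLI.continuous

/-- A unitary between Hilbert modules: a surjective isometry. -/
structure Unitary (E F : HilbertModule D) extends Isometry E F where
  surjective : Function.Surjective toLin

instance (E F : HilbertModule D) : CoeFun (Unitary E F) (fun _ => E → F) := ⟨fun V => V.toLin⟩

/-- The inverse (which is also the adjoint) of a unitary. -/
noncomputable def Unitary.symm {E F : HilbertModule D} (V : Unitary E F) : Unitary F E where
  toLin := (LinearEquiv.ofBijective V.toLin ⟨V.toLI.injective, V.surjective⟩).symm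
  inner_map x y := by
    obtain ⟨x, rfl⟩ := V.surjective x
    obtain ⟨y, rfl⟩ := V.surjective y
    have h : ∀ z, (LinearEquiv.ofBijective V.toLin ⟨V.toLI.injective, V.surjective⟩).symm
        (V.toLin z) = z := fun z =>
      (LinearEquiv.ofBijective V.toLin ⟨V.toLI.injective, V.surjective⟩).symm_apply_apply z
    rw [V.inner_map]
    exact congrArg₂ E.inner (h x) (h y)
  surjective := LinearEquiv.surjective _

lemma Unitary.symm_apply_apply {E F : HilbertModule D} (V : Unitary E F) (x : E) :
    V.symm (V x) = x :=
  (LinearEquiv.ofBijective V.toLin ⟨V.toLI.injective, V.surjective⟩).symm_apply_apply x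

/-- The composite of two unitaries. -/
def Unitary.trans {E F H : HilbertModule D} (V : Unitary E F) (W : Unitary F H) :
    Unitary E H where
  toLin := W.toLin ∘ₗ V.toLin
  inner_map x y := (W.inner_map _ _).trans (V.inner_map x y)
  surjective := W.surjective.comp V.surjective

/-- An isometry is determined by inner-product-preserving values on a generating family. -/
lemma exists_isometry {E F : HilbertModule D} {ι : Type*} (a : ι → E) (b : ι → F)
    (h : ∀ i j, F.inner (b i) (b j) = E.inner (a i) (a j))
    (ha : Dense (Submodule.span ℂ (Set.range a) : Set E)) :
    ∃ V : Isometry E F, ∀ i, V (a i) = b i := by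
  let La : (ι →₀ ℂ) →ₗ[ℂ] E := Finsupp.linearCombination ℂ a
  let Lb : (ι →₀ ℂ) →ₗ[ℂ] F := Finsupp.linearCombination ℂ b
  have hin : ∀ s t, F.inner (Lb s) (Lb t) = E.inner (La s) (La t) := by
    intro s t
    have h1 : (F.pre.innerₛₗ.comp Lb).flip.comp Lb = (E.pre.innerₛₗ.comp La).flip.comp La := by
      ext i j
      simpa [La, Lb, HilbertModule.inner] using h j i
    exact congrArg (fun f => f t s) h1
  have hd : DenseRange La := by
    have : (LinearMap.range La : Set E) = Submodule.span ℂ (Set.range a) := by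
      rw [Finsupp.range_linearCombination]
    rw [DenseRange, ← LinearMap.coe_range, this]
    exact ha
  have hn : ∀ s, ‖Lb s‖ ≤ 1 * ‖La s‖ := fun s => by
    rw [one_mul, F.norm_eq, E.norm_eq]
    exact (congrArg (fun d => √‖d‖) (hin s s)).le
  let T : E →L[ℂ] F := Lb.extendOfNorm La
  have hT : ∀ s, T (La s) = Lb s := fun s => LinearMap.extendOfNorm_eq hd ⟨1, hn⟩ s
  refine ⟨⟨T.toLinearMap, fun x y => ?_⟩, fun i => ?_⟩
  · refine hd.induction_on₂ (p := fun x y => F.inner (T x) (T y) = E.inner x y) ?_ ?_ x y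
    · exact isClosed_eq (F.continuous_inner.comp (by fun_prop : Continuous fun q : E × E =>
        (T q.1, T q.2))) E.continuous_inner
    · intro s t
      rw [hT, hT, hin]
  · have := hT (Finsupp.single i 1)
    simpa [La, Lb] using this

lemma exists_unitary {E F : HilbertModule D} {ι : Type*} (a : ι → E) (b : ι → F)
    (h : ∀ i j, F.inner (b i) (b j) = E.inner (a i) (a j))
    (ha : Dense (Submodule.span ℂ (Set.range a) : Set E))
    (hb : Dense (Submodule.span ℂ (Set.range b) : Set F)) :
    ∃ V : Unitary E F, ∀ i, V (a i) = b i := by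
  obtain ⟨V, hV⟩ := exists_isometry a b h ha
  refine ⟨⟨V, ?_⟩, hV⟩
  have hcl : IsClosed (Set.range V.toLin) := V.toLI.isometry.isClosedEmbedding.isClosed_range
  have hsub : (Submodule.span ℂ (Set.range b) : Set F) ⊆ Set.range V.toLin := by
    rw [← LinearMap.coe_range]
    refine SetLike.coe_subset_coe.2 (Submodule.span_le.2 ?_)
    rintro _ ⟨i, rfl⟩
    exact ⟨a i, hV i⟩
  rw [← Set.range_eq_univ]
  exact (hb.mono hsub).closure_eq ▸ hcl.closure_eq.symm

/-- The isometry that extends `a i ↦ b i`. -/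
noncomputable def Isometry.ofGenerators {E F : HilbertModule D} {ι : Type*} (a : ι → E) (b : ι → F)
    (h : ∀ i j, F.inner (b i) (b j) = E.inner (a i) (a j))
    (ha : Dense (Submodule.span ℂ (Set.range a) : Set E)) : Isometry E F :=
  (exists_isometry a b h ha).choose

lemma Isometry.ofGenerators_apply {E F : HilbertModule D} {ι : Type*} (a : ι → E) (b : ι → F)
    (h : ∀ i j, F.inner (b i) (b j) = E.inner (a i) (a j))
    (ha : Dense (Submodule.span ℂ (Set.range a) : Set E)) (i : ι) :
    Isometry.ofGenerators a b h ha (a i) = b i :=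
  (exists_isometry a b h ha).choose_spec i

/-- The unitary that extends `a i ↦ b i`. -/
noncomputable def Unitary.ofGenerators {E F : HilbertModule D} {ι : Type*} (a : ι → E) (b : ι → F)
    (h : ∀ i j, F.inner (b i) (b j) = E.inner (a i) (a j))
    (ha : Dense (Submodule.span ℂ (Set.range a) : Set E))
    (hb : Dense (Submodule.span ℂ (Set.range b) : Set F)) : Unitary E F :=
  (exists_unitary a b h ha hb).choose

lemma Unitary.ofGenerators_apply {E F : HilbertModule D} {ι : Type*} (a : ι → E) (b : ι → F)
    (h : ∀ i j, F.inner (b i) (b j) = E.inner (a i) (a j))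
    (ha : Dense (Submodule.span ℂ (Set.range a) : Set E))
    (hb : Dense (Submodule.span ℂ (Set.range b) : Set F)) (i : ι) :
    Unitary.ofGenerators a b h ha hb (a i) = b i :=
  (exists_unitary a b h ha hb).choose_spec i

/-- The right action of `d`, as a linear map. -/
def HilbertModule.actL (F : HilbertModule D) (d : D) : F →ₗ[ℂ] F where
  toFun x := F.act x d
  map_add' x y := F.ext_inner fun z => by
    simp only [HilbertModule.inner, HilbertModule.act, F.pre.inner_act_right,
      F.pre.inner_add_right, add_mul]
  map_smul' c x := F.ext_inner fun z => by
    simp only [HilbertModule.inner, HilbertModule.act, F.pre.inner_act_right,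
      F.pre.inner_smul_right, smul_mul_assoc, RingHom.id_apply]

end Basic

/-! ## Extension of actions to completions -/

section Extension

variable {D : Type u} [NonUnitalCStarAlgebra D] {A : Type u} [NonUnitalCStarAlgebra A]

lemma exists_defect (a : A) (ha : ‖a‖ ≤ 1) :
    ∃ b : A, star b = b ∧ star a * a = b + b - b * b := by
  let f : ℝ → ℝ := fun x => 1 - √(1 - x)
  have hsa : IsSelfAdjoint (star a * a) := IsSelfAdjoint.star_mul_self a
  have hf : Continuous f := by fun_prop
  have hf0 : f 0 = 0 := by simp [f]
  refine ⟨cfcₙ f (star a * a), (cfcₙ_predicate f (star a * a) : IsSelfAdjoint _).star_eq, ?_⟩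
  rw [← cfcₙ_add f f _ hf.continuousOn hf0 hf.continuousOn hf0,
    ← cfcₙ_mul f f _ hf.continuousOn hf0 hf.continuousOn hf0,
    ← cfcₙ_sub (fun x => f x + f x) (fun x => f x * f x) _ (by fun_prop) (by simp [hf0])
      (by fun_prop) (by simp [hf0])]
  conv_lhs => rw [← cfcₙ_id ℝ (star a * a) hsa]
  refine cfcₙ_congr fun x hx => ?_
  have hx1 : x ≤ 1 := by
    have h1 : ‖x‖ ≤ ‖star a * a‖ := by
      have := NonUnitalIsometricContinuousFunctionalCalculus.norm_quasispectrum_le (𝕜 := ℝ)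
        (star a * a) hx hsa
      exact this
    rw [CStarRing.norm_star_mul_self] at h1
    have h2 : ‖a‖ * ‖a‖ ≤ 1 := by nlinarith [norm_nonneg a]
    exact (le_abs_self x).trans (h1.trans h2)
  have h3 := Real.sq_sqrt (sub_nonneg.2 hx1)
  simp only [f, id]
  nlinarith

/-- An action of a C*-algebra by adjointable maps on a pre-Hilbert module is contractive. -/
lemma norm_inner_action_le {V : Type u} [AddCommGroup V] [Module ℂ V] (P : PreHilbertModule D V)
    (ρ : A →ₙₐ[ℂ] Module.End ℂ V)
    (h : ∀ a x y, P.inner (ρ (star a) x) y = P.inner x (ρ a y)) (a : A) (x : V) :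
    √‖P.inner (ρ a x) (ρ a x)‖ ≤ ‖a‖ * √‖P.inner x x‖ := by
  have key : ∀ a : A, ‖a‖ ≤ 1 → ∀ x, ‖P.inner (ρ a x) (ρ a x)‖ ≤ ‖P.inner x x‖ := by
    intro a ha x
    let _ := CStarAlgebra.spectralOrder D
    have := CStarAlgebra.spectralOrderedRing D
    have pos : ∀ v, 0 ≤ P.inner v v := fun v => by
      obtain ⟨c, hc⟩ := P.inner_self_pos v
      rw [hc]; exact star_mul_self_nonneg c
    obtain ⟨b, hb, hab⟩ := exists_defect a ha
    have hb' : ∀ x y, P.inner (ρ b x) y = P.inner x (ρ b y) := fun x y => by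
      rw [← h b, hb]
    have h1 : P.inner (ρ a x) (ρ a x) = P.inner x (ρ b x) + P.inner x (ρ b x)
        - P.inner x (ρ (b * b) x) := by
      rw [← h a, ← Module.End.mul_apply, ← map_mul, hab, map_sub, map_add, LinearMap.sub_apply,
        LinearMap.add_apply, P.inner_sub_left, P.inner_add_left, hb', map_mul,
        Module.End.mul_apply, hb', hb']
    have h2 := pos (x - ρ b x)
    have h3 : P.inner (x - ρ b x) (x - ρ b x) = P.inner x x - P.inner (ρ a x) (ρ a x) := by
      rw [h1, P.inner_sub_left, P.inner_sub_right, P.inner_sub_right, hb', hb', map_mul,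
        Module.End.mul_apply]
      abel
    rw [h3] at h2
    exact CStarAlgebra.norm_le_norm_of_nonneg_of_le (pos _) (sub_nonneg.1 h2)
  by_cases ha : ‖a‖ = 0
  · rw [norm_eq_zero.1 ha]
    simp [P.inner_zero_left]
  have hpos : 0 < ‖a‖ := lt_of_le_of_ne (norm_nonneg a) (Ne.symm ha)
  set c : ℂ := ((‖a‖⁻¹ : ℝ) : ℂ) with hc
  have hnc : ‖c‖ = ‖a‖⁻¹ := by rw [hc, Complex.norm_real, norm_inv, norm_norm]
  have h1 := key (c • a) (by rw [norm_smul, hnc, inv_mul_cancel₀ ha]) x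
  rw [map_smul, LinearMap.smul_apply, P.inner_smul_left, P.inner_smul_right, norm_smul, norm_smul,
    norm_star, hnc] at h1
  rw [← Real.sqrt_sq hpos.le, ← Real.sqrt_mul (by positivity)]
  refine Real.sqrt_le_sqrt ?_
  have h2 : ‖P.inner (ρ a x) (ρ a x)‖ =
      ‖a‖ ^ 2 * (‖a‖⁻¹ * (‖a‖⁻¹ * ‖P.inner (ρ a x) (ρ a x)‖)) := by
    field_simp
  rw [h2]
  gcongr

variable {V : Type u} [AddCommGroup V] [Module ℂ V] (P : PreHilbertModule D V)
  (ρ : A →ₙₐ[ℂ] Module.End ℂ V)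

lemma norm_toCompletion_action_le
    (h : ∀ a x y, P.inner (ρ (star a) x) y = P.inner x (ρ a y)) (a : A) (x : V) :
    ‖(P.toCompletion ∘ₗ ρ a) x‖ ≤ ‖a‖ * ‖P.toCompletion x‖ := by
  rw [LinearMap.comp_apply, P.norm_toCompletion, P.norm_toCompletion]
  exact norm_inner_action_le P ρ h a x

/-- The operator on the completion induced by the action of `a` on a pre-Hilbert module. -/
noncomputable def extendAction (a : A) : P.completion →L[ℂ] P.completion :=
  (P.toCompletion ∘ₗ ρ a).extendOfNorm P.toCompletion

lemma extendAction_toCompletion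
    (h : ∀ a x y, P.inner (ρ (star a) x) y = P.inner x (ρ a y)) (a : A) (x : V) :
    extendAction P ρ a (P.toCompletion x) = P.toCompletion (ρ a x) :=
  LinearMap.extendOfNorm_eq P.dense_toCompletion ⟨‖a‖, norm_toCompletion_action_le P ρ h a⟩ x

lemma ext_completion {T S : P.completion →L[ℂ] P.completion}
    (hTS : ∀ x, T (P.toCompletion x) = S (P.toCompletion x)) : T = S :=
  DFunLike.coe_injective (P.dense_toCompletion.equalizer T.continuous S.continuous (funext hTS))

/-- The extension to the completion of an action of a C*-algebra by adjointable maps on a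
pre-Hilbert module. -/
noncomputable def StarRep.ofPre
    (h : ∀ a x y, P.inner (ρ (star a) x) y = P.inner x (ρ a y)) : StarRep A P.completion where
  toHom :=
    { toFun := extendAction P ρ
      map_smul' := fun c a => by
        refine ext_completion P fun x => ?_
        simp [extendAction_toCompletion P ρ h]
      map_zero' := by
        refine ext_completion P fun x => ?_
        simp [extendAction_toCompletion P ρ h]
      map_add' := fun a b => by
        refine ext_completion P fun x => ?_
        simp [extendAction_toCompletion P ρ h]
      map_mul' := fun a b => by
        refine ext_completion P fun x => ?_
        simp [extendAction_toCompletion P ρ h] }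
  adjoint a x y := by
    refine P.dense_toCompletion.induction_on₂ (p := fun x y =>
      P.completion.inner (extendAction P ρ (star a) x) y
        = P.completion.inner x (extendAction P ρ a y)) ?_ ?_ x y
    · refine isClosed_eq (P.completion.continuous_inner.comp
        (((extendAction P ρ (star a)).continuous.comp continuous_fst).prodMk continuous_snd))
        (P.completion.continuous_inner.comp
        (continuous_fst.prodMk ((extendAction P ρ a).continuous.comp continuous_snd)))
    · intro x y
      rw [extendAction_toCompletion P ρ h, extendAction_toCompletion P ρ h, P.inner_toCompletion,
        P.inner_toCompletion, h]

lemma StarRep.ofPre_apply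
    (h : ∀ a x y, P.inner (ρ (star a) x) y = P.inner x (ρ a y)) (a : A) (x : V) :
    StarRep.ofPre P ρ h a (P.toCompletion x) = P.toCompletion (ρ a x) :=
  extendAction_toCompletion P ρ h a x

end Extension

end GroupoidRep

namespace GroupoidRep

open scoped TensorProduct

/-! ## The interior tensor product -/

section Gram

variable {B : Type u} [NonUnitalCStarAlgebra B]

lemma exists_negPart {R : Type u} [NonUnitalCStarAlgebra R] (M : R) (hsa : star M = M) :
    ∃ N C : R, star N = N ∧ N = star C * C ∧ N * M * N = -(star (C * N) * (C * N)) ∧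
      (N = 0 → ∃ Y, M = star Y * Y) := by
  let _ := CStarAlgebra.spectralOrder R
  have := CStarAlgebra.spectralOrderedRing R
  have hN0 : 0 ≤ M⁻ := CFC.negPart_nonneg M
  have hNsa : star M⁻ = M⁻ := (IsSelfAdjoint.of_nonneg hN0).star_eq
  obtain ⟨C, hC⟩ := CStarAlgebra.nonneg_iff_eq_star_mul_self.1 hN0
  have h1 : M = M⁺ - M⁻ := (CFC.posPart_sub_negPart M hsa).symm
  have h2 : M⁺ * M⁻ = 0 := CFC.posPart_mul_negPart M
  refine ⟨M⁻, C, hNsa, hC, ?_, fun h => ?_⟩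
  · calc M⁻ * M * M⁻ = M⁻ * (M * M⁻) := mul_assoc _ _ _
      _ = M⁻ * ((M⁺ - M⁻) * M⁻) := by rw [← h1]
      _ = -(M⁻ * (M⁻ * M⁻)) := by rw [sub_mul, h2, zero_sub, mul_neg]
      _ = -(star (C * M⁻) * (C * M⁻)) := by
        rw [star_mul, hNsa, mul_assoc M⁻, ← mul_assoc (star C), ← hC]
  · rw [h, sub_zero] at h1
    exact CStarAlgebra.nonneg_iff_eq_star_mul_self.1 (h1 ▸ CFC.posPart_nonneg M)

/-- Gram matrices of vectors in a Hilbert module are positive. -/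
lemma exists_gram (E : HilbertModule B) {ι : Type u} [Fintype ι] (x : ι → E) :
    ∃ Y : ι → ι → B, ∀ i j, E.inner (x i) (x j) = ∑ k, star (Y k i) * Y k j := by
  classical
  let _ := CStarAlgebra.spectralOrder B
  have := CStarAlgebra.spectralOrderedRing B
  let M : CStarMatrix ι ι B := CStarMatrix.ofMatrix (Matrix.of fun i j => E.inner (x i) (x j))
  have hM : ∀ i j, M i j = E.inner (x i) (x j) := fun i j => rfl
  have hsa : star M = M := by
    ext i j
    rw [CStarMatrix.star_apply, hM, hM]
    exact E.pre.star_inner _ _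
  obtain ⟨N, C, hNsa, hC, hMN, hY⟩ := exists_negPart M hsa
  have hdiag : ∀ k, ∃ c : B, (N * M * N) k k = star c * c := by
    intro k
    let v : E := ∑ i, E.act (x i) (N i k)
    obtain ⟨c, hc⟩ := E.pre.inner_self_pos v
    refine ⟨c, hc ▸ ?_⟩
    have hNs : ∀ i, star (N i k) = N k i := fun i => by
      conv_rhs => rw [← hNsa]
      rw [CStarMatrix.star_apply]
    simp only [v]
    rw [E.pre.inner_sum_right]
    simp only [E.pre.inner_sum_left, CStarMatrix.mul_apply]
    refine Finset.sum_congr rfl fun j _ => ?_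
    rw [Finset.sum_mul]
    refine Finset.sum_congr rfl fun i _ => ?_
    rw [hM]
    simp only [HilbertModule.act, HilbertModule.inner]
    rw [E.pre.inner_act_right, E.pre.inner_act_left, hNs]
  have hW : C * N = 0 := by
    ext i k
    have h1 : (star (C * N) * (C * N)) k k = ∑ l, star ((C * N) l k) * (C * N) l k := by
      rw [CStarMatrix.mul_apply]
      rfl
    obtain ⟨c, hc⟩ := hdiag k
    rw [hMN, CStarMatrix.neg_apply, h1] at hc
    have h2 : ∑ l, star ((C * N) l k) * (C * N) l k = 0 := by
      refine le_antisymm ?_ (Finset.sum_nonneg fun l _ => star_mul_self_nonneg _)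
      rw [← neg_nonneg, hc]
      exact star_mul_self_nonneg c
    have h3 := (Finset.sum_eq_zero_iff_of_nonneg fun l _ => star_mul_self_nonneg _).1 h2 i
      (Finset.mem_univ i)
    exact CStarRing.star_mul_self_eq_zero_iff _ |>.1 h3
  have hNN : N = 0 := by
    have : star N * N = 0 := by
      rw [hNsa]
      conv_lhs => rw [hC]
      rw [mul_assoc, ← hC, hW, mul_zero]
    exact CStarRing.star_mul_self_eq_zero_iff _ |>.1 this
  obtain ⟨Y, hY⟩ := hY hNN
  refine ⟨fun k i => Y k i, fun i j => ?_⟩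
  rw [← hM, hY, CStarMatrix.mul_apply]
  rfl

end Gram

section Tensor

variable {B D : Type u} [NonUnitalCStarAlgebra B] [NonUnitalCStarAlgebra D]
  (E : HilbertModule B) (F : HilbertModule D) (φ : StarRep B F)

lemma HilbertModule.inner_add_right (x y z : F) :
    F.inner x (y + z) = F.inner x y + F.inner x z := F.pre.inner_add_right x y z

lemma HilbertModule.inner_add_left (x y z : F) :
    F.inner (x + y) z = F.inner x z + F.inner y z := F.pre.inner_add_left x y z

lemma HilbertModule.inner_smul_right (c : ℂ) (x y : F) :
    F.inner x (c • y) = c • F.inner x y := F.pre.inner_smul_right c x y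

lemma HilbertModule.inner_smul_left (c : ℂ) (x y : F) :
    F.inner (c • x) y = star c • F.inner x y := F.pre.inner_smul_left c x y

lemma HilbertModule.star_inner (x y : F) : star (F.inner x y) = F.inner y x :=
  F.pre.star_inner x y

lemma HilbertModule.inner_act_right (x y : F) (d : D) :
    F.inner x (F.act y d) = F.inner x y * d := F.pre.inner_act_right x y d

variable {E F}

/-- The linear map `x₂ ⊗ y₂ ↦ ⟨y₁, φ(⟨x₁, x₂⟩) y₂⟩`. -/
noncomputable def tensorInnerAux (x₁ : E) (y₁ : F) : E ⊗[ℂ] F →ₗ[ℂ] D :=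
  TensorProduct.lift (LinearMap.mk₂ ℂ (fun x₂ y₂ => F.inner y₁ (φ (E.inner x₁ x₂) y₂))
    (fun a b y => by
      rw [E.inner_add_right, map_add, _root_.add_apply, F.inner_add_right])
    (fun c a y => by
      rw [E.inner_smul_right, map_smul, _root_.smul_apply, F.inner_smul_right])
    (fun a y z => by rw [map_add, F.inner_add_right])
    (fun c a y => by rw [map_smul, F.inner_smul_right]))

/-- The sesquilinear map `⟨x₁ ⊗ y₁, x₂ ⊗ y₂⟩ = ⟨y₁, φ(⟨x₁, x₂⟩) y₂⟩`. -/
noncomputable def tensorSesq : E ⊗[ℂ] F →ₗ⋆[ℂ] E ⊗[ℂ] F →ₗ[ℂ] D :=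
  TensorProduct.lift (LinearMap.mk₂'ₛₗ (starRingEnd ℂ) (starRingEnd ℂ) (tensorInnerAux φ)
    (fun a b y => TensorProduct.ext' fun x₂ y₂ => by
      simp [tensorInnerAux, E.inner_add_left, F.inner_add_right])
    (fun c a y => TensorProduct.ext' fun x₂ y₂ => by
      simp [tensorInnerAux, E.inner_smul_left, F.inner_smul_right])
    (fun a y z => TensorProduct.ext' fun x₂ y₂ => by
      simp [tensorInnerAux, F.inner_add_left])
    (fun c a y => TensorProduct.ext' fun x₂ y₂ => by
      simp [tensorInnerAux, F.inner_smul_left]))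

lemma tensorSesq_tmul (x₁ x₂ : E) (y₁ y₂ : F) :
    tensorSesq φ (x₁ ⊗ₜ y₁) (x₂ ⊗ₜ y₂) = F.inner y₁ (φ (E.inner x₁ x₂) y₂) := rfl

lemma star_tensorSesq (s t : E ⊗[ℂ] F) : star (tensorSesq φ s t) = tensorSesq φ t s := by
  induction s with
  | zero => simp
  | add a b ha hb => simp [ha, hb]
  | tmul x₁ y₁ =>
    induction t with
    | zero => simp
    | add a b ha hb => simp [ha, hb]
    | tmul x₂ y₂ =>
      rw [tensorSesq_tmul, tensorSesq_tmul, F.star_inner, ← E.star_inner, φ.adjoint]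

lemma tensorSesq_self (t : E ⊗[ℂ] F) : ∃ c : D, tensorSesq φ t t = star c * c := by
  let _ := CStarAlgebra.spectralOrder D
  have := CStarAlgebra.spectralOrderedRing D
  rw [← CStarAlgebra.nonneg_iff_eq_star_mul_self]
  obtain ⟨S, hS⟩ := TensorProduct.exists_finset t
  obtain ⟨Y, hY⟩ := exists_gram E (fun i : S => (i : E × F).1)
  have ht : t = ∑ i : S, (i : E × F).1 ⊗ₜ[ℂ] (i : E × F).2 := by
    rw [hS, ← Finset.sum_attach]
    rfl
  have h : tensorSesq φ t t = ∑ k : S,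
      F.inner (∑ i : S, φ (Y k i) (i : E × F).2) (∑ j : S, φ (Y k j) (j : E × F).2) := by
    have h1 : tensorSesq φ t t = ∑ i : S, ∑ j : S, ∑ k : S,
        F.inner (φ (Y k i) (i : E × F).2) (φ (Y k j) (j : E × F).2) := by
      rw [ht]
      simp only [map_sum, LinearMap.sum_apply, tensorSesq_tmul]
      rw [Finset.sum_comm]
      refine Finset.sum_congr rfl fun i _ => Finset.sum_congr rfl fun j _ => ?_
      rw [hY i j, map_sum, _root_.sum_apply]
      simp only [HilbertModule.inner]
      rw [F.pre.inner_sum_right]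
      refine Finset.sum_congr rfl fun k _ => ?_
      have := φ.adjoint (star (Y k i)) (i : E × F).2 (φ (Y k j) (j : E × F).2)
      rw [star_star] at this
      rw [map_mul]
      exact this.symm
    rw [h1]
    simp only [HilbertModule.inner, F.pre.inner_sum_left, F.pre.inner_sum_right]
    calc _ = ∑ i : S, ∑ k : S, ∑ j : S,
          F.pre.inner (φ (Y k i) (i : E × F).2) (φ (Y k j) (j : E × F).2) :=
        Finset.sum_congr rfl fun i _ => Finset.sum_comm
      _ = _ := by
        rw [Finset.sum_comm]
  rw [h]
  refine Finset.sum_nonneg fun k _ => ?_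
  obtain ⟨c, hc⟩ := F.pre.inner_self_pos (∑ i : S, φ (Y k i) (i : E × F).2)
  rw [HilbertModule.inner, hc]
  exact star_mul_self_nonneg c

variable (E)

/-- The algebraic tensor product over `ℂ` with the semi-inner product
`⟨x₁ ⊗ y₁, x₂ ⊗ y₂⟩ = ⟨y₁, φ(⟨x₁, x₂⟩) y₂⟩`; the balancing relations `x b ⊗ y = x ⊗ φ(b) y` hold up
to vectors of norm zero. -/
noncomputable def preTensor : PreHilbertModule D (E ⊗[ℂ] F) where
  inner s t := tensorSesq φ s t
  act t d := (F.actL d).lTensor E t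
  inner_add_right x y z := map_add _ _ _
  inner_smul_right c x y := map_smul _ _ _
  star_inner := star_tensorSesq φ
  inner_self_pos := tensorSesq_self φ
  inner_act_right s t d := by
    induction s with
    | zero => simp
    | add a b ha hb => simp [ha, hb, add_mul]
    | tmul x₁ y₁ =>
      induction t with
      | zero => simp
      | add a b ha hb => simp only [map_add, ha, hb, add_mul]
      | tmul x₂ y₂ =>
        rw [LinearMap.lTensor_tmul, tensorSesq_tmul, tensorSesq_tmul]
        have h := φ.adjoint (star (E.inner x₁ x₂)) y₁
        rw [star_star] at h
        have h' := φ.adjoint (star (E.inner x₁ x₂))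
        rw [← F.star_inner, ← F.star_inner (φ (E.inner x₁ x₂) y₂)] 
        rw [star_star] at h'
        rw [h', h']
        change star (F.inner (F.act y₂ d) _) = _
        rw [F.star_inner, F.inner_act_right, ← F.star_inner]

/-- The interior tensor product `E ⊗_φ F`, a Hilbert `D`-module. -/
noncomputable def tensor : HilbertModule D := (preTensor E φ).completion

variable {E}

/-- The canonical map from the algebraic tensor product to `E ⊗_φ F`. -/
noncomputable def tensorMk : E ⊗[ℂ] F →ₗ[ℂ] tensor E φ := (preTensor E φ).toCompletion

/-- The elementary tensor `x ⊗ y` in `E ⊗_φ F`. -/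
noncomputable def tmul (x : E) (y : F) : tensor E φ := tensorMk φ (x ⊗ₜ y)

lemma inner_tmul (x₁ x₂ : E) (y₁ y₂ : F) :
    (tensor E φ).inner (tmul φ x₁ y₁) (tmul φ x₂ y₂) = F.inner y₁ (φ (E.inner x₁ x₂) y₂) :=
  (preTensor E φ).inner_toCompletion _ _

lemma tmul_add_right (x : E) (y z : F) : tmul φ x (y + z) = tmul φ x y + tmul φ x z := by
  rw [tmul, TensorProduct.tmul_add, map_add]; rfl

lemma tmul_add_left (x y : E) (z : F) : tmul φ (x + y) z = tmul φ x z + tmul φ y z := by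
  rw [tmul, TensorProduct.add_tmul, map_add]; rfl

lemma tmul_smul_right (c : ℂ) (x : E) (y : F) : tmul φ x (c • y) = c • tmul φ x y := by
  rw [tmul, TensorProduct.tmul_smul, map_smul]; rfl

lemma tmul_smul_left (c : ℂ) (x : E) (y : F) : tmul φ (c • x) y = c • tmul φ x y := by
  rw [tmul, ← TensorProduct.smul_tmul', map_smul]; rfl

/-- `y ↦ x ⊗ y` as a linear map. -/
noncomputable def tmulR (x : E) : F →ₗ[ℂ] tensor E φ where
  toFun := tmul φ x
  map_add' := tmul_add_right φ x
  map_smul' c y := tmul_smul_right φ c x y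

/-- `x ↦ x ⊗ y` as a linear map. -/
noncomputable def tmulL (y : F) : E →ₗ[ℂ] tensor E φ where
  toFun x := tmul φ x y
  map_add' x z := tmul_add_left φ x z y
  map_smul' c x := tmul_smul_left φ c x y

lemma norm_rep_le (b : B) (y : F) : ‖φ b y‖ ≤ ‖b‖ * ‖y‖ := by
  have := norm_inner_action_le F.pre
    { toFun := fun b => (φ b : F →ₗ[ℂ] F)
      map_smul' := fun c b => by ext; simp
      map_zero' := by ext; simp
      map_add' := fun a b => by ext; simp
      map_mul' := fun a b => by ext; simp } φ.adjoint b y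
  rw [F.norm_eq, F.norm_eq]
  exact this

lemma norm_tmul_le' (x : E) (y : F) : ‖tmul φ x y‖ ≤ ‖x‖ * ‖y‖ := by
  refine le_of_sq_le_sq ?_ (by positivity)
  rw [HilbertModule.norm_sq, inner_tmul]
  calc _ ≤ ‖y‖ * ‖φ (E.inner x x) y‖ := F.norm_inner_le _ _
    _ ≤ ‖y‖ * (‖E.inner x x‖ * ‖y‖) := by
      gcongr; exact norm_rep_le φ _ _
    _ = _ := by rw [← E.norm_sq]; ring

lemma continuous_tmul_right (x : E) : Continuous (fun y : F => tmul φ x y) :=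
  ((tmulR φ x).mkContinuous ‖x‖ fun y => norm_tmul_le' φ x y).continuous

lemma continuous_tmul_left (y : F) : Continuous (fun x : E => tmul φ x y) :=
  ((tmulL φ y).mkContinuous ‖y‖ fun x => by
    rw [mul_comm]; exact norm_tmul_le' φ x y).continuous

lemma dense_tmul : Dense (Submodule.span ℂ (Set.range fun p : E × F => tmul φ p.1 p.2) :
    Set (tensor E φ)) := by
  refine (preTensor E φ).dense_toCompletion.mono ?_
  rintro _ ⟨t, rfl⟩
  change tensorMk φ t ∈ _
  induction t with
  | zero => rw [map_zero]; exact Submodule.zero_mem _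
  | add a b ha hb => rw [map_add]; exact Submodule.add_mem _ ha hb
  | tmul x y => exact Submodule.subset_span ⟨(x, y), rfl⟩

/-- Elementary tensors of total families form a total family. -/
lemma dense_tmul_of_dense {ι κ : Type*} (a : ι → E) (b : κ → F)
    (ha : Dense (Submodule.span ℂ (Set.range a) : Set E))
    (hb : Dense (Submodule.span ℂ (Set.range b) : Set F)) :
    Dense (Submodule.span ℂ (Set.range fun p : ι × κ => tmul φ (a p.1) (b p.2)) :
      Set (tensor E φ)) := by
  set S := (Submodule.span ℂ (Set.range fun p : ι × κ => tmul φ (a p.1) (b p.2))) with hS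
  have h1 : ∀ i y, tmul φ (a i) y ∈ S.topologicalClosure := by
    intro i y
    have hle : Submodule.span ℂ (Set.range b) ≤ S.topologicalClosure.comap (tmulR φ (a i)) := by
      rw [Submodule.span_le]
      rintro _ ⟨j, rfl⟩
      exact S.le_topologicalClosure (Submodule.subset_span ⟨(i, j), rfl⟩)
    have hcl : IsClosed ((fun y => tmul φ (a i) y) ⁻¹' (S.topologicalClosure : Set (tensor E φ))) :=
      S.isClosed_topologicalClosure.preimage (continuous_tmul_right φ (a i))
    exact (hcl.closure_subset_iff.2 hle) (hb y)
  have h2 : ∀ x y, tmul φ x y ∈ S.topologicalClosure := by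
    intro x y
    have hle : Submodule.span ℂ (Set.range a) ≤ S.topologicalClosure.comap (tmulL φ y) := by
      rw [Submodule.span_le]
      rintro _ ⟨i, rfl⟩
      exact h1 i y
    have hcl : IsClosed ((fun x => tmul φ x y) ⁻¹' (S.topologicalClosure : Set (tensor E φ))) :=
      S.isClosed_topologicalClosure.preimage (continuous_tmul_left φ y)
    exact (hcl.closure_subset_iff.2 hle) (ha x)
  have h3 : Submodule.span ℂ (Set.range fun p : E × F => tmul φ p.1 p.2)
      ≤ S.topologicalClosure := by
    rw [Submodule.span_le]
    rintro _ ⟨p, rfl⟩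
    exact h2 p.1 p.2
  have h4 : Dense (S.topologicalClosure : Set (tensor E φ)) := (dense_tmul φ).mono h3
  rw [Submodule.topologicalClosure_coe] at h4
  exact dense_closure.1 h4

/-- The left action `ρ ⊗ 1` on `E ⊗_φ F` induced by a left action on `E`. -/
noncomputable def StarRep.tensor {A : Type u} [NonUnitalCStarAlgebra A] (ρ : StarRep A E)
    (φ : StarRep B F) : StarRep A (tensor E φ) :=
  StarRep.ofPre (preTensor E φ)
    { toFun := fun a => (ρ a : E →ₗ[ℂ] E).rTensor F
      map_smul' := fun c a => TensorProduct.ext' fun x y => by simp [TensorProduct.smul_tmul']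
      map_zero' := TensorProduct.ext' fun x y => by simp
      map_add' := fun a b => TensorProduct.ext' fun x y => by simp
      map_mul' := fun a b => TensorProduct.ext' fun x y => by simp }
    (fun a s t => by
      change tensorSesq φ ((ρ (star a) : E →ₗ[ℂ] E).rTensor F s) t
        = tensorSesq φ s ((ρ a : E →ₗ[ℂ] E).rTensor F t)
      induction s with
      | zero => simp
      | add a b ha hb => simp only [map_add, LinearMap.add_apply, ha, hb]
      | tmul x₁ y₁ =>
        induction t with
        | zero => simp
        | add a b ha hb => simp only [map_add, ha, hb]
        | tmul x₂ y₂ =>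
          rw [LinearMap.rTensor_tmul, LinearMap.rTensor_tmul, tensorSesq_tmul, tensorSesq_tmul]
          exact congrArg (fun b => F.inner y₁ (φ b y₂)) (ρ.adjoint a x₁ x₂))

lemma StarRep.tensor_tmul {A : Type u} [NonUnitalCStarAlgebra A] (ρ : StarRep A E)
    (φ : StarRep B F) (a : A) (x : E) (y : F) :
    ρ.tensor φ a (tmul φ x y) = tmul φ (ρ a x) y :=
  StarRep.ofPre_apply _ _ _ a _

/-- The induced representation `π ⊗ 1` on `E ⊗_φ F`. -/
noncomputable def Rep.tensor {A : Type u} [NonUnitalCStarAlgebra A] (π : Rep A E)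
    (φ : StarRep B F) : Rep A (tensor E φ) where
  toStarRep := π.toStarRep.tensor φ
  nondegenerate := by
    have h := dense_tmul_of_dense φ (fun p : A × E => π p.1 p.2) (id : F → F) (by
      convert π.nondegenerate using 4
      ext y
      simp) (by simp)
    refine h.mono (SetLike.coe_subset_coe.2 (Submodule.span_mono ?_))
    rintro _ ⟨⟨⟨a, x⟩, y⟩, rfl⟩
    exact ⟨a, tmul φ x y, StarRep.tensor_tmul π.toStarRep φ a x y⟩

end Tensor

/-! ## Functoriality of the interior tensor product -/

section Functorial

variable {A B D : Type u} [NonUnitalCStarAlgebra A] [NonUnitalCStarAlgebra B]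
  [NonUnitalCStarAlgebra D]

/-- The isometry `1 ⊗ V : E ⊗_{φ₁} F₁ → E ⊗_{φ₂} F₂`, for an isometry `V` that intertwines `φ₁`
and `φ₂`. -/
noncomputable def Isometry.lTensor (E : HilbertModule B) {F₁ F₂ : HilbertModule D}
    (φ₁ : StarRep B F₁) (φ₂ : StarRep B F₂) (V : Isometry F₁ F₂)
    (hV : ∀ b x, V (φ₁ b x) = φ₂ b (V x)) : Isometry (tensor E φ₁) (tensor E φ₂) :=
  Isometry.ofGenerators (fun p : E × F₁ => tmul φ₁ p.1 p.2) (fun p => tmul φ₂ p.1 (V p.2))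
    (fun p q => by rw [inner_tmul, inner_tmul, ← hV, V.inner_map]) (dense_tmul φ₁)

/-- The unitary `1 ⊗ V : E ⊗_{φ₁} F₁ → E ⊗_{φ₂} F₂`, for a unitary `V` that intertwines `φ₁`
and `φ₂`. -/
noncomputable def Unitary.lTensor (E : HilbertModule B) {F₁ F₂ : HilbertModule D}
    (φ₁ : StarRep B F₁) (φ₂ : StarRep B F₂) (V : Unitary F₁ F₂)
    (hV : ∀ b x, V (φ₁ b x) = φ₂ b (V x)) : Unitary (tensor E φ₁) (tensor E φ₂) :=
  Unitary.ofGenerators (fun p : E × F₁ => tmul φ₁ p.1 p.2) (fun p => tmul φ₂ p.1 (V p.2))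
    (fun p q => by rw [inner_tmul, inner_tmul, ← hV, V.inner_map]) (dense_tmul φ₁)
    ((dense_tmul φ₂).mono (SetLike.coe_subset_coe.2 (Submodule.span_mono (by
      rintro _ ⟨⟨x, y⟩, rfl⟩
      obtain ⟨z, rfl⟩ := V.surjective y
      exact ⟨(x, z), rfl⟩))))

/-- The unitary `V ⊗ 1 : E₁ ⊗_φ F → E₂ ⊗_φ F`. -/
noncomputable def Unitary.rTensor {E₁ E₂ : HilbertModule B} {F : HilbertModule D}
    (V : Unitary E₁ E₂) (φ : StarRep B F) : Unitary (tensor E₁ φ) (tensor E₂ φ) :=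
  Unitary.ofGenerators (fun p : E₁ × F => tmul φ p.1 p.2) (fun p => tmul φ (V p.1) p.2)
    (fun p q => by rw [inner_tmul, inner_tmul, V.inner_map]) (dense_tmul φ)
    ((dense_tmul φ).mono (SetLike.coe_subset_coe.2 (Submodule.span_mono (by
      rintro _ ⟨⟨x, y⟩, rfl⟩
      obtain ⟨z, rfl⟩ := V.surjective x
      exact ⟨(z, y), rfl⟩))))

lemma Unitary.rTensor_tmul {E₁ E₂ : HilbertModule B} {F : HilbertModule D}
    (V : Unitary E₁ E₂) (φ : StarRep B F) (x : E₁) (y : F) :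
    V.rTensor φ (tmul φ x y) = tmul φ (V x) y :=
  Unitary.ofGenerators_apply (fun p : E₁ × F => tmul φ p.1 p.2) _ _ _ _ (x, y)

/-- The associativity isomorphism `(M ⊗_φ F) ⊗_ψ E ≅ M ⊗_{φ ⊗ 1} (F ⊗_ψ E)`. -/
noncomputable def tensorAssoc (M : HilbertModule A) {F : HilbertModule B} {E : HilbertModule D}
    (φ : StarRep A F) (ψ : StarRep B E) :
    Unitary (tensor (tensor M φ) ψ) (tensor M (φ.tensor ψ)) :=
  Unitary.ofGenerators
    (fun p : (M × F) × E => tmul ψ (tmul φ p.1.1 p.1.2) p.2)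
    (fun p => tmul (φ.tensor ψ) p.1.1 (tmul ψ p.1.2 p.2))
    (fun p q => by
      rw [inner_tmul, inner_tmul, inner_tmul, StarRep.tensor_tmul, inner_tmul])
    (dense_tmul_of_dense ψ (fun p : M × F => tmul φ p.1 p.2) (id : E → E) (dense_tmul φ)
      (by simp))
    ((dense_tmul_of_dense (φ.tensor ψ) (id : M → M) (fun p : F × E => tmul ψ p.1 p.2)
      (by simp) (dense_tmul ψ)).mono (SetLike.coe_subset_coe.2 (Submodule.span_mono (by
        rintro _ ⟨⟨x, y, z⟩, rfl⟩
        exact ⟨((x, y), z), rfl⟩))))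

lemma tensorAssoc_tmul (M : HilbertModule A) {F : HilbertModule B} {E : HilbertModule D}
    (φ : StarRep A F) (ψ : StarRep B E) (x : M) (y : F) (z : E) :
    tensorAssoc M φ ψ (tmul ψ (tmul φ x y) z) = tmul (φ.tensor ψ) x (tmul ψ y z) :=
  Unitary.ofGenerators_apply (fun p : (M × F) × E => tmul ψ (tmul φ p.1.1 p.1.2) p.2)
    _ _ _ _ ((x, y), z)

end Functorial

end GroupoidRep

namespace GroupoidRep

open scoped TensorProduct CompactlySupported ZeroAtInfty

/-! ## Continuous families of measures and their Hilbert modules -/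

section Functions

variable {X Y : Type u} [TopologicalSpace X] [TopologicalSpace Y]

/-- The inclusion of `C_c(X)` into `C₀(X)`. -/
noncomputable def toC₀ : C_c(X, ℂ) →ₗ[ℂ] C₀(X, ℂ) where
  toFun ξ := ⟨ξ.toContinuousMap, ξ.hasCompactSupport'.is_zero_at_infty⟩
  map_add' _ _ := rfl
  map_smul' _ _ := rfl

@[simp] lemma toC₀_apply (ξ : C_c(X, ℂ)) (x : X) : toC₀ ξ x = ξ x := rfl

lemma exists_sqrt (ξ : C_c(X, ℂ)) (h : ∀ x, ∃ t : ℝ, 0 ≤ t ∧ ξ x = t) :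
    ∃ η : C_c(X, ℂ), ξ = star η * η := by
  have hc : Continuous fun x => ((√(ξ x).re : ℝ) : ℂ) := by
    have := ξ.continuous
    fun_prop
  refine ⟨⟨⟨fun x => ((√(ξ x).re : ℝ) : ℂ), hc⟩, ?_⟩, ?_⟩
  · refine ξ.hasCompactSupport'.mono fun x hx => ?_
    contrapose! hx
    simp at hx
    simp [hx]
  · ext x
    obtain ⟨t, ht, hx⟩ := h x
    simp only [CompactlySupportedContinuousMap.mul_apply,
      CompactlySupportedContinuousMap.star_apply, CompactlySupportedContinuousMap.coe_mk,
      ContinuousMap.coe_mk, hx, Complex.ofReal_re, RCLike.star_def, Complex.conj_ofReal]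
    rw [← Complex.ofReal_mul, Real.mul_self_sqrt ht]

lemma exists_bump [T2Space X] [LocallyCompactSpace X] {K : Set X} (hK : IsCompact K) :
    ∃ χ : C_c(X, ℂ), ∀ x ∈ K, χ x = 1 := by
  obtain ⟨g, hg1, -, hg, -⟩ := exists_continuous_one_zero_of_isCompact (s := K) (t := ∅)
    hK isClosed_empty (Set.disjoint_empty _)
  refine ⟨⟨⟨fun x => (g x : ℂ), by fun_prop⟩, hg.comp_left Complex.ofReal_zero⟩, fun x hx => ?_⟩
  have := hg1 hx
  simp_all

lemma exists_unit_comp [T2Space Y] [LocallyCompactSpace Y] (f : C(X, Y)) (ξ : C_c(X, ℂ)) :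
    ∃ η : C_c(Y, ℂ), (η.toContinuousMap.comp f) • ξ = ξ := by
  obtain ⟨η, hη⟩ := exists_bump (ξ.hasCompactSupport'.isCompact.image f.continuous)
  refine ⟨η, ?_⟩
  ext x
  by_cases hx : x ∈ tsupport ξ
  · have := hη (f x) ⟨x, hx, rfl⟩
    simp [this]
  · simp [image_eq_zero_of_notMem_tsupport hx]

end Functions

/-- The map `C_c(X) → C_c(Y)`, `ξ ↦ (y ↦ ∫ ξ dλ_y)`, of a continuous family of measures `λ_y` on the
fibres of `f : X → Y`: a positive linear map that commutes with multiplication by functions on `Y`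
(by the Riesz--Markov theorem, these are the same thing for locally compact Hausdorff spaces). -/
structure IntegrationMap {X Y : Type u} [TopologicalSpace X] [TopologicalSpace Y]
    (f : C(X, Y)) where
  /-- the linear map -/
  toLin : C_c(X, ℂ) →ₗ[ℂ] C_c(Y, ℂ)
  map_star : ∀ ξ, toLin (star ξ) = star (toLin ξ)
  nonneg : ∀ ξ y, ∃ t : ℝ, 0 ≤ t ∧ toLin (star ξ * ξ) y = t
  map_smul_comp : ∀ (g : C(Y, ℂ)) ξ, toLin ((g.comp f) • ξ) = g • toLin ξ

namespace IntegrationMap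

section

variable {X Y Z : Type u} [TopologicalSpace X] [TopologicalSpace Y] [TopologicalSpace Z]
  {f : C(X, Y)}

noncomputable instance : CoeFun (IntegrationMap f) (fun _ => C_c(X, ℂ) → C_c(Y, ℂ)) := ⟨fun I => I.toLin⟩

/-- The composite of families of measures: integration first along `f`, then along `g`. -/
noncomputable def comp {g : C(Y, Z)} (J : IntegrationMap g) (I : IntegrationMap f) :
    IntegrationMap (g.comp f) where
  toLin := J.toLin ∘ₗ I.toLin
  map_star ξ := by simp [I.map_star, J.map_star]
  nonneg ξ z := by
    obtain ⟨η, hη⟩ := exists_sqrt _ (I.nonneg ξ)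
    rw [LinearMap.comp_apply, hη]
    exact J.nonneg η z
  map_smul_comp k ξ := by
    rw [LinearMap.comp_apply, LinearMap.comp_apply, ← J.map_smul_comp, ← I.map_smul_comp]
    rfl

variable (I : IntegrationMap f)

/-- `C_c(X)` with the `C₀(Y)`-valued inner product `⟨ξ, η⟩(y) = ∫ conj ξ · η dλ_y` and the right
action `(ξ · ψ)(x) = ξ(x) ψ(f(x))`. -/
noncomputable def preL2 : PreHilbertModule C₀(Y, ℂ) C_c(X, ℂ) where
  inner ξ η := toC₀ (I (star ξ * η))
  act ξ ψ := ((ψ : C(Y, ℂ)).comp f) • ξ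
  inner_add_right ξ η ζ := by rw [mul_add, map_add, map_add]
  inner_smul_right c ξ η := by rw [mul_smul_comm, map_smul, map_smul]
  star_inner ξ η := by
    ext y
    change star (I (star ξ * η) y) = I (star η * ξ) y
    rw [← CompactlySupportedContinuousMap.star_apply, ← I.map_star, star_mul', star_star, mul_comm]
  inner_self_pos ξ := by
    obtain ⟨η, hη⟩ := exists_sqrt _ (I.nonneg ξ)
    refine ⟨toC₀ η, ?_⟩
    rw [hη]
    rfl
  inner_act_right ξ η ψ := by
    have : star ξ * (((ψ : C(Y, ℂ)).comp f) • η) = ((ψ : C(Y, ℂ)).comp f) • (star ξ * η) := by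
      ext x
      simp
      ring
    ext y
    rw [this, I.map_smul_comp]
    simp
    ring

/-- The Hilbert `C₀(Y)`-module `L²(X, f, λ)`. -/
noncomputable def L2 : HilbertModule C₀(Y, ℂ) := I.preL2.completion

/-- The class of a compactly supported function in `L²(X, f, λ)`. -/
noncomputable def cls : C_c(X, ℂ) →ₗ[ℂ] I.L2 := I.preL2.toCompletion

lemma inner_cls (ξ η : C_c(X, ℂ)) : I.L2.inner (I.cls ξ) (I.cls η) = toC₀ (I (star ξ * η)) :=
  I.preL2.inner_toCompletion ξ η

lemma dense_cls : Dense (Submodule.span ℂ (Set.range I.cls) : Set I.L2) :=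
  I.preL2.dense_toCompletion.mono Submodule.subset_span

/-- The action of `C₀(X)` on `L²(X, f, λ)` by pointwise multiplication. -/
noncomputable def mulRep : StarRep C₀(X, ℂ) I.L2 :=
  StarRep.ofPre I.preL2
    { toFun := fun a =>
        { toFun := fun ξ => a • ξ
          map_add' := fun ξ η => by ext x; simp [mul_add]
          map_smul' := fun c ξ => by ext x; simp; ring }
      map_smul' := fun c a => by ext ξ x; simp; ring
      map_zero' := by ext ξ x; simp
      map_add' := fun a b => by ext ξ x; simp [add_mul]
      map_mul' := fun a b => by ext ξ x; simp [mul_assoc] }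
    (fun a ξ η => by
      change toC₀ (I (star (star a • ξ) * η)) = toC₀ (I (star ξ * (a • η)))
      congr 2
      ext x
      simp
      ring)

lemma mulRep_cls (a : C₀(X, ℂ)) (ξ : C_c(X, ℂ)) : I.mulRep a (I.cls ξ) = I.cls (a • ξ) :=
  StarRep.ofPre_apply _ _ _ a ξ

end

section Canonical

variable {X Y Z : Type u} [TopologicalSpace X] [TopologicalSpace Y] [TopologicalSpace Z]
  [T2Space Y] [LocallyCompactSpace Y]
  {f : C(X, Y)} {g : C(Y, Z)} {h : C(X, Z)}
  {D : Type u} [NonUnitalCStarAlgebra D] {F : HilbertModule D}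

/-- The canonical isomorphism
`L²(X, f, I) ⊗_{C₀(Y)} (L²(Y, g, J) ⊗_φ F) ≅ L²(X, g ∘ f, K) ⊗_φ F`,
`ξ ⊗ (η ⊗ x) ↦ (ξ · (η ∘ f)) ⊗ x`, for `K = J ∘ I`. -/
noncomputable def canon (I : IntegrationMap f) (J : IntegrationMap g) (K : IntegrationMap h)
    (hK : ∀ ξ, K ξ = J (I ξ)) (φ : StarRep C₀(Z, ℂ) F) :
    Unitary (tensor I.L2 (J.mulRep.tensor φ)) (tensor K.L2 φ) :=
  Unitary.ofGenerators
    (fun p : C_c(X, ℂ) × C_c(Y, ℂ) × F =>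
      tmul (J.mulRep.tensor φ) (I.cls p.1) (tmul φ (J.cls p.2.1) p.2.2))
    (fun p => tmul φ (K.cls ((p.2.1.toContinuousMap.comp f) • p.1)) p.2.2)
    (fun p q => by
      rw [inner_tmul, inner_tmul, StarRep.tensor_tmul, inner_tmul, I.inner_cls, J.mulRep_cls,
        J.inner_cls, K.inner_cls, hK]
      have : star ((p.2.1.toContinuousMap.comp f) • p.1) * ((q.2.1.toContinuousMap.comp f) • q.1)
          = (((star p.2.1 * q.2.1).toContinuousMap).comp f) • (star p.1 * q.1) := by
        ext x
        simp
        ring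
      rw [this, I.map_smul_comp]
      have h2 : (star p.2.1 * q.2.1).toContinuousMap • I (star p.1 * q.1)
          = star p.2.1 * (toC₀ (I (star p.1 * q.1)) • q.2.1) := by
        ext y
        simp
        ring
      rw [h2])
    ((dense_tmul_of_dense (J.mulRep.tensor φ) (fun ξ => I.cls ξ)
      (fun p : C_c(Y, ℂ) × F => tmul φ (J.cls p.1) p.2) I.dense_cls
      (dense_tmul_of_dense φ (fun ξ => J.cls ξ) (id : F → F) J.dense_cls (by simp))))
    ((dense_tmul_of_dense φ (fun ξ => K.cls ξ) (id : F → F) K.dense_cls (by simp)).mono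
      (SetLike.coe_subset_coe.2 (Submodule.span_mono (by
        rintro _ ⟨⟨ξ, x⟩, rfl⟩
        obtain ⟨η, hη⟩ := exists_unit_comp f ξ
        refine ⟨(ξ, η, x), ?_⟩
        simp only [hη, id]))))

end Canonical

end IntegrationMap

end GroupoidRep

namespace GroupoidRep

open scoped CompactlySupported ZeroAtInfty
open MeasureTheory Topology Filter

/-! ## Extension and pull-back of functions -/

section Extend

variable {X Z : Type u} [TopologicalSpace X] [TopologicalSpace Z]

/-- A compactly supported function on a closed subspace extends to a compactly supported function. -/
lemma exists_extension [T2Space X] [LocallyCompactSpace X] {e : Z → X} (he : IsClosedEmbedding e)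
    (f : C_c(Z, ℂ)) : ∃ F : C_c(X, ℂ), ∀ z, F (e z) = f z := by
  have hZ : T2Space Z := he.isEmbedding.t2Space
  have hZ' : LocallyCompactSpace Z := he.locallyCompactSpace
  have h0 : Tendsto f (coclosedCompact Z) (𝓝 0) := by
    rw [coclosedCompact_eq_cocompact]
    exact f.hasCompactSupport'.is_zero_at_infty
  let f' : C(OnePoint Z, ℂ) := OnePoint.continuousMapMk f.toContinuousMap 0 h0
  have hmap : Continuous (OnePoint.map e) := OnePoint.continuous_map he.continuous (by
    rw [coclosedCompact_eq_cocompact, coclosedCompact_eq_cocompact]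
    exact he.tendsto_cocompact)
  have hinj : Function.Injective (OnePoint.map e) := Option.map_injective he.injective
  obtain ⟨F', hF'⟩ := ContinuousMap.exists_extension (hmap.isClosedEmbedding hinj) f'
  obtain ⟨χ, hχ⟩ := exists_bump (f.hasCompactSupport'.isCompact.image he.continuous)
  let F₁ : C(X, ℂ) := F'.comp ⟨_, OnePoint.continuous_coe⟩
  have hF₁ : ∀ z, F₁ (e z) = f z := fun z => by
    have := DFunLike.congr_fun hF' (z : OnePoint Z)
    exact this
  refine ⟨F₁ • χ, fun z => ?_⟩
  rw [CompactlySupportedContinuousMap.smulc_apply, hF₁]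
  by_cases hz : z ∈ tsupport f
  · rw [hχ _ ⟨z, hz, rfl⟩, smul_eq_mul, mul_one]
  · rw [image_eq_zero_of_notMem_tsupport hz, zero_smul]

/-- The restriction of a compactly supported function to a closed subspace. -/
noncomputable def restrict {e : Z → X} (he : IsClosedEmbedding e) (F : C_c(X, ℂ)) : C_c(Z, ℂ) where
  toFun z := F (e z)
  continuous_toFun := F.continuous.comp he.continuous
  hasCompactSupport' := F.hasCompactSupport'.comp_isClosedEmbedding he

end Extend

/-- The fibre product `W ×_Y X`. -/
abbrev FiberProduct {W X Y : Type u} [TopologicalSpace W] [TopologicalSpace X] [TopologicalSpace Y]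
    (b : C(W, Y)) (p : C(X, Y)) : Type u :=
  {q : W × X // b q.1 = p q.2}

lemma isClosedEmbedding_fiberProduct {W X Y : Type u} [TopologicalSpace W] [TopologicalSpace X]
    [TopologicalSpace Y] [T2Space Y] (b : C(W, Y)) (p : C(X, Y)) :
    IsClosedEmbedding (Subtype.val : FiberProduct b p → W × X) :=
  (isClosed_eq (by fun_prop) (by fun_prop)).isClosedEmbedding_subtypeVal

/-- The extension by zero to `W × X` of a function on `W ×_Y X`. -/
noncomputable def extendZero {W X Y : Type u} [TopologicalSpace W] [TopologicalSpace X]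
    [TopologicalSpace Y] {b : C(W, Y)} {p : C(X, Y)} (f : FiberProduct b p → ℂ) (w : W) (x : X) :
    ℂ :=
  open Classical in if h : b w = p x then f ⟨(w, x), h⟩ else 0

/-- A continuous family of Radon measures on the fibres of `p : X → Y`. -/
structure FiberMeasures {X Y : Type u} [TopologicalSpace X] [TopologicalSpace Y]
    [MeasurableSpace X] [BorelSpace X] (p : C(X, Y)) where
  /-- the measure on the fibre of `y` -/
  meas : Y → Measure X
  regular : ∀ y, (meas y).Regular
  meas_compl : ∀ y, meas y (p ⁻¹' {y})ᶜ = 0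
  continuous_integral : ∀ ξ : C_c(X, ℂ), Continuous fun y => ∫ x, ξ x ∂meas y

namespace FiberMeasures

section

variable {W X Y : Type u} [TopologicalSpace W] [TopologicalSpace X] [TopologicalSpace Y]
  [MeasurableSpace X] [BorelSpace X] {p : C(X, Y)} (m : FiberMeasures p)

attribute [instance] FiberMeasures.regular

lemma ae_mem (y : Y) : ∀ᵐ x ∂m.meas y, p x = y := m.meas_compl y

lemma integral_congr {y : Y} {f g : X → ℂ} (h : ∀ x, p x = y → f x = g x) :
    ∫ x, f x ∂m.meas y = ∫ x, g x ∂m.meas y :=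
  integral_congr_ae ((m.ae_mem y).mono h)

lemma integrable (ξ : C_c(X, ℂ)) (y : Y) : Integrable ξ (m.meas y) :=
  ξ.continuous.integrable_of_hasCompactSupport ξ.hasCompactSupport'

/-- The integration map of a continuous family of measures. -/
noncomputable def toIntegrationMap [T2Space Y] : IntegrationMap p where
  toLin :=
    { toFun := fun ξ =>
        { toFun := fun y => ∫ x, ξ x ∂m.meas y
          continuous_toFun := m.continuous_integral ξ
          hasCompactSupport' := by
            refine HasCompactSupport.intro (ξ.hasCompactSupport'.isCompact.image p.continuous)
              fun y hy => ?_
            rw [m.integral_congr (g := fun _ => 0), integral_zero]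
            intro x hx
            refine image_eq_zero_of_notMem_tsupport fun hx' => hy ⟨x, hx', hx⟩ }
      map_add' := fun ξ η => by
        ext y
        exact integral_add (m.integrable ξ y) (m.integrable η y)
      map_smul' := fun c ξ => by
        ext y
        exact integral_const_mul c _ }
  map_star ξ := by
    ext y
    exact integral_conj
  nonneg ξ y := by
    refine ⟨∫ x, ‖ξ x‖ ^ 2 ∂m.meas y, integral_nonneg fun x => by positivity, ?_⟩
    change ∫ x, (star ξ * ξ) x ∂m.meas y = _
    rw [← integral_complex_ofReal]
    congr 1
    ext x
    simp [Complex.conj_mul']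
  map_smul_comp g ξ := by
    ext y
    change ∫ x, g (p x) * ξ x ∂m.meas y = g y * ∫ x, ξ x ∂m.meas y
    rw [← integral_const_mul]
    exact m.integral_congr fun x hx => by rw [hx]

lemma toIntegrationMap_apply [T2Space Y] (ξ : C_c(X, ℂ)) (y : Y) :
    m.toIntegrationMap ξ y = ∫ x, ξ x ∂m.meas y := rfl

/-- The slice of a compactly supported function of two variables. -/
noncomputable def slice [T2Space X] (F : C_c(W × X, ℂ)) (w : W) : C_c(X, ℂ) where
  toFun x := F (w, x)
  continuous_toFun := F.continuous.comp (by fun_prop)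
  hasCompactSupport' := by
    refine HasCompactSupport.intro (F.hasCompactSupport'.isCompact.image continuous_snd)
      fun x hx => ?_
    exact image_eq_zero_of_notMem_tsupport fun h => hx ⟨_, h, rfl⟩

lemma continuous_integral_slice [T2Space X] [LocallyCompactSpace X] (b : C(W, Y))
    (F : C_c(W × X, ℂ)) : Continuous fun w => ∫ x, F (w, x) ∂m.meas (b w) := by
  set K := Prod.snd '' tsupport F with hKdef
  have hK : IsCompact K := F.hasCompactSupport'.isCompact.image continuous_snd
  obtain ⟨χ, hχ⟩ := exists_bump hK
  have hF0 : ∀ w x, x ∉ K → F (w, x) = 0 := fun w x hx =>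
    image_eq_zero_of_notMem_tsupport fun h => hx ⟨_, h, rfl⟩
  have hB : Continuous fun w => (∫ x, (star χ * χ) x ∂m.meas (b w)).re :=
    Complex.continuous_re.comp ((m.continuous_integral _).comp b.continuous)
  have hχi : ∀ y, Integrable (fun x => ‖χ x‖ ^ 2) (m.meas y) := fun y =>
    (by have := χ.continuous; fun_prop : Continuous fun x => ‖χ x‖ ^ 2).integrable_of_hasCompactSupport
      (χ.hasCompactSupport'.comp_left (g := fun z : ℂ => ‖z‖ ^ 2) (by simp))
  have hBeq : ∀ y, (∫ x, (star χ * χ) x ∂m.meas y).re = ∫ x, ‖χ x‖ ^ 2 ∂m.meas y := fun y => by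
    have : (fun x => (star χ * χ) x) = fun x => ((‖χ x‖ ^ 2 : ℝ) : ℂ) := by
      ext x; simp [Complex.conj_mul']
    rw [this, integral_complex_ofReal, Complex.ofReal_re]
  rw [continuous_iff_continuousAt]
  intro w₀
  have h1 : Tendsto (fun w => ∫ x, F (w₀, x) ∂m.meas (b w)) (𝓝 w₀)
      (𝓝 (∫ x, F (w₀, x) ∂m.meas (b w₀))) :=
    ((m.continuous_integral (slice F w₀)).comp b.continuous).tendsto w₀
  have h2 : Tendsto (fun w => ∫ x, (F (w, x) - F (w₀, x)) ∂m.meas (b w)) (𝓝 w₀) (𝓝 0) := by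
    rw [Metric.tendsto_nhds]
    intro ε hε
    set C := (∫ x, (star χ * χ) x ∂m.meas (b w₀)).re with hC
    have hC0 : 0 ≤ C := by
      rw [hC, hBeq]; exact integral_nonneg fun x => by positivity
    have e1 : ∀ᶠ w in 𝓝 w₀, (∫ x, (star χ * χ) x ∂m.meas (b w)).re < C + 1 :=
      hB.continuousAt.eventually_lt_const (by linarith)
    have e2 : ∀ᶠ w in 𝓝 w₀, ∀ x ∈ K, ‖F (w, x) - F (w₀, x)‖ < ε / (C + 1) / 2 := by
      refine hK.eventually_forall_of_forall_eventually fun x _ => ?_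
      have hc : Continuous fun z : W × X => ‖F z - F (w₀, z.2)‖ := by
        have := F.continuous
        fun_prop
      refine hc.continuousAt.eventually_lt_const ?_
      simp only [sub_self, norm_zero]
      positivity
    filter_upwards [e1, e2] with w hw1 hw2
    rw [dist_zero_right]
    calc ‖∫ x, (F (w, x) - F (w₀, x)) ∂m.meas (b w)‖
        ≤ ∫ x, ε / (C + 1) / 2 * ‖χ x‖ ^ 2 ∂m.meas (b w) := by
          refine norm_integral_le_of_norm_le ((hχi _).const_mul _) (ae_of_all _ fun x => ?_)
          by_cases hx : x ∈ K
          · rw [hχ x hx, norm_one, one_pow, mul_one]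
            exact (hw2 x hx).le
          · rw [hF0 w x hx, hF0 w₀ x hx, sub_self, norm_zero]
            positivity
      _ = ε / (C + 1) / 2 * (∫ x, (star χ * χ) x ∂m.meas (b w)).re := by
          rw [integral_const_mul, hBeq]
      _ ≤ ε / (C + 1) / 2 * (C + 1) := by gcongr
      _ < ε := by
          have : ε / (C + 1) / 2 * (C + 1) = ε / 2 := by field_simp
          linarith
  have h3 := h2.add h1
  rw [zero_add] at h3
  refine h3.congr fun w => ?_
  rw [← integral_add, ]
  · simp
  · exact (m.integrable (slice F w) _).sub (m.integrable (slice F w₀) _)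
  · exact m.integrable (slice F w₀) _

lemma integral_extendZero_eq {b : C(W, Y)} {f : FiberProduct b p → ℂ} {F : W × X → ℂ}
    (hF : ∀ q : FiberProduct b p, F q.1 = f q) (w : W) :
    ∫ x, extendZero f w x ∂m.meas (b w) = ∫ x, F (w, x) ∂m.meas (b w) :=
  m.integral_congr fun x hx => by
    rw [extendZero, dif_pos hx.symm, ← hF]

/-- The pull-back along `b : W → Y` of a continuous family of measures along `p : X → Y`, a
continuous family of measures along the projection `W ×_Y X → W`: integration over `x` for fixed
`w`. -/
noncomputable def pull [T2Space W] [LocallyCompactSpace W] [T2Space X] [LocallyCompactSpace X]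
    [T2Space Y] (b : C(W, Y)) :
    IntegrationMap (⟨fun q => q.1.1, by fun_prop⟩ : C(FiberProduct b p, W)) where
  toLin :=
    { toFun := fun f =>
        { toFun := fun w => ∫ x, extendZero f w x ∂m.meas (b w)
          continuous_toFun := by
            obtain ⟨F, hF⟩ := exists_extension (isClosedEmbedding_fiberProduct b p) f
            simp only [m.integral_extendZero_eq hF]
            exact m.continuous_integral_slice b F
          hasCompactSupport' := by
            refine HasCompactSupport.intro (f.hasCompactSupport'.isCompact.image
              (by fun_prop : Continuous fun q : FiberProduct b p => q.1.1)) fun w hw => ?_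
            have : ∀ x, extendZero f w x = 0 := fun x => by
              rw [extendZero]
              split_ifs with h
              · exact image_eq_zero_of_notMem_tsupport fun h' => hw ⟨_, h', rfl⟩
              · rfl
            simp [this] }
      map_add' := fun f g => by
        ext w
        obtain ⟨F, hF⟩ := exists_extension (isClosedEmbedding_fiberProduct b p) f
        obtain ⟨G, hG⟩ := exists_extension (isClosedEmbedding_fiberProduct b p) g
        have hFG : ∀ q : FiberProduct b p, (F + G) q.1 = (f + g) q := fun q => by
          simp [hF, hG]
        change ∫ x, extendZero (f + g : C_c(_, ℂ)) w x ∂m.meas (b w) =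
          ∫ x, extendZero f w x ∂m.meas (b w) + ∫ x, extendZero g w x ∂m.meas (b w)
        rw [m.integral_extendZero_eq hF, m.integral_extendZero_eq hG,
          m.integral_extendZero_eq hFG]
        exact integral_add (m.integrable (slice F w) _) (m.integrable (slice G w) _)
      map_smul' := fun c f => by
        ext w
        change ∫ x, extendZero (c • f : C_c(_, ℂ)) w x ∂m.meas (b w) =
          c * ∫ x, extendZero f w x ∂m.meas (b w)
        rw [← integral_const_mul]
        refine m.integral_congr fun x hx => ?_
        rw [extendZero, dif_pos hx.symm, extendZero, dif_pos hx.symm]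
        rfl }
  map_star f := by
    ext w
    change ∫ x, extendZero (star f : C_c(_, ℂ)) w x ∂m.meas (b w) =
      (starRingEnd ℂ) (∫ x, extendZero f w x ∂m.meas (b w))
    rw [← integral_conj]
    refine m.integral_congr fun x hx => ?_
    rw [extendZero, dif_pos hx.symm, extendZero, dif_pos hx.symm]
    rfl
  nonneg f w := by
    refine ⟨∫ x, ‖extendZero f w x‖ ^ 2 ∂m.meas (b w), integral_nonneg fun x => by positivity, ?_⟩
    change ∫ x, extendZero (star f * f : C_c(_, ℂ)) w x ∂m.meas (b w) = _
    rw [← integral_complex_ofReal]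
    refine m.integral_congr fun x hx => ?_
    rw [extendZero, dif_pos hx.symm, extendZero, dif_pos hx.symm]
    simp [Complex.conj_mul']
  map_smul_comp g f := by
    ext w
    change ∫ x, extendZero (_ : C_c(_, ℂ)) w x ∂m.meas (b w) =
      g w * ∫ x, extendZero f w x ∂m.meas (b w)
    rw [← integral_const_mul]
    refine m.integral_congr fun x hx => ?_
    rw [extendZero, dif_pos hx.symm, extendZero, dif_pos hx.symm]
    rfl

lemma pull_apply [T2Space W] [LocallyCompactSpace W] [T2Space X] [LocallyCompactSpace X]
    [T2Space Y] (b : C(W, Y)) (f : C_c(FiberProduct b p, ℂ)) (w : W) :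
    m.pull b f w = ∫ x, extendZero f w x ∂m.meas (b w) := rfl

end

end FiberMeasures

/-- The composite of a compactly supported function with a homeomorphism. -/
noncomputable def compHomeo {X X' : Type u} [TopologicalSpace X] [TopologicalSpace X']
    (e : X ≃ₜ X') : C_c(X', ℂ) →ₗ[ℂ] C_c(X, ℂ) where
  toFun ξ := ⟨⟨fun x => ξ (e x), ξ.continuous.comp e.continuous⟩,
    ξ.hasCompactSupport'.comp_homeomorph e⟩
  map_add' _ _ := rfl
  map_smul' _ _ := rfl

@[simp] lemma compHomeo_apply {X X' : Type u} [TopologicalSpace X] [TopologicalSpace X']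
    (e : X ≃ₜ X') (ξ : C_c(X', ℂ)) (x : X) : compHomeo e ξ x = ξ (e x) := rfl

/-- The transport of a family of measures along a homeomorphism. -/
noncomputable def IntegrationMap.congr {X X' Y : Type u} [TopologicalSpace X] [TopologicalSpace X']
    [TopologicalSpace Y] {f : C(X, Y)} (I : IntegrationMap f) (e : X' ≃ₜ X) (f' : C(X', Y))
    (hf : ∀ x, f' x = f (e x)) : IntegrationMap f' where
  toLin := I.toLin ∘ₗ compHomeo e.symm
  map_star ξ := I.map_star (compHomeo e.symm ξ)
  nonneg ξ y := I.nonneg (compHomeo e.symm ξ) y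
  map_smul_comp g ξ := by
    rw [LinearMap.comp_apply, LinearMap.comp_apply, ← I.map_smul_comp]
    congr 1
    ext x
    simp [hf]

end GroupoidRep

namespace GroupoidRep

open scoped CompactlySupported ZeroAtInfty
open MeasureTheory Topology Filter

/-! ## Groupoids and Haar systems -/

/-- A topological groupoid with object space `G0` and arrow space `G1`. -/
structure TopGroupoid (G0 G1 : Type u) [TopologicalSpace G0] [TopologicalSpace G1] where
  /-- range -/
  r : C(G1, G0)
  /-- source -/
  s : C(G1, G0)
  /-- units -/
  unit : C(G0, G1)
  /-- inversion -/
  inv : C(G1, G1)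
  /-- the product `g h` of composable arrows -/
  comp : ∀ g h : G1, s g = r h → G1
  continuous_comp : Continuous fun q : FiberProduct s r => comp q.1.1 q.1.2 q.2
  r_unit : ∀ x, r (unit x) = x
  s_unit : ∀ x, s (unit x) = x
  r_comp : ∀ g h (e : s g = r h), r (comp g h e) = r g
  s_comp : ∀ g h (e : s g = r h), s (comp g h e) = s h
  assoc : ∀ g h k (e₁ : s g = r h) (e₂ : s h = r k),
    comp (comp g h e₁) k ((s_comp g h e₁).trans e₂)
      = comp g (comp h k e₂) (e₁.trans (r_comp h k e₂).symm)
  unit_comp : ∀ g, comp (unit (r g)) g (s_unit (r g)) = g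
  comp_unit : ∀ g, comp g (unit (s g)) (r_unit (s g)).symm = g
  r_inv : ∀ g, r (inv g) = s g
  s_inv : ∀ g, s (inv g) = r g
  inv_comp : ∀ g, comp (inv g) g (s_inv g) = unit (s g)
  comp_inv : ∀ g, comp g (inv g) (r_inv g).symm = unit (r g)

namespace TopGroupoid

variable {G0 G1 : Type u} [TopologicalSpace G0] [TopologicalSpace G1] (𝒢 : TopGroupoid G0 G1)

/-- The space `G²` of composable pairs. -/
abbrev Pairs : Type u := FiberProduct 𝒢.s 𝒢.r

/-- The face map `d₀(g, h) = h`. -/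
def d₀ : C(𝒢.Pairs, G1) := ⟨fun q => q.1.2, by fun_prop⟩

/-- The face map `d₁(g, h) = g h`. -/
def d₁ : C(𝒢.Pairs, G1) := ⟨fun q => 𝒢.comp q.1.1 q.1.2 q.2, 𝒢.continuous_comp⟩

/-- The face map `d₂(g, h) = g`. -/
def d₂ : C(𝒢.Pairs, G1) := ⟨fun q => q.1.1, by fun_prop⟩

lemma comp_congr {g g' h h' : G1} (hg : g = g') (hh : h = h') (e : 𝒢.s g = 𝒢.r h)
    (e' : 𝒢.s g' = 𝒢.r h') : 𝒢.comp g h e = 𝒢.comp g' h' e' := by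
  subst hg hh
  rfl

lemma inv_comp_cancel (g h : G1) (e : 𝒢.s g = 𝒢.r h) :
    𝒢.comp (𝒢.inv g) (𝒢.comp g h e) ((𝒢.s_inv g).trans (𝒢.r_comp g h e).symm) = h := by
  rw [← 𝒢.assoc (𝒢.inv g) g h (𝒢.s_inv g) e]
  rw [𝒢.comp_congr ((𝒢.inv_comp g).trans (congrArg 𝒢.unit e)) rfl _ (𝒢.s_unit _), 𝒢.unit_comp]

lemma comp_inv_cancel (g h : G1) (e : 𝒢.s (𝒢.inv g) = 𝒢.r h) :
    𝒢.comp g (𝒢.comp (𝒢.inv g) h e) ((𝒢.r_inv g).symm.trans (𝒢.r_comp _ h e).symm) = h := by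
  rw [← 𝒢.assoc g (𝒢.inv g) h (𝒢.r_inv g).symm e]
  rw [𝒢.comp_congr ((𝒢.comp_inv g).trans (congrArg 𝒢.unit ((𝒢.s_inv g).symm.trans e))) rfl _
    (𝒢.s_unit _), 𝒢.unit_comp]

/-- A right inverse is the inverse. -/
lemma eq_inv_of_comp (g h : G1) (e : 𝒢.s g = 𝒢.r h) (k : 𝒢.comp g h e = 𝒢.unit (𝒢.r g)) :
    h = 𝒢.inv g := by
  rw [← 𝒢.inv_comp_cancel g h e]
  have h1 : 𝒢.r g = 𝒢.s (𝒢.inv g) := (𝒢.s_inv g).symm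
  rw [𝒢.comp_congr rfl (k.trans (congrArg 𝒢.unit h1)) _ (𝒢.r_unit _).symm, 𝒢.comp_unit]

lemma inv_inv (g : G1) : 𝒢.inv (𝒢.inv g) = g :=
  (𝒢.eq_inv_of_comp (𝒢.inv g) g (𝒢.s_inv g) (by rw [𝒢.inv_comp, 𝒢.r_inv])).symm

lemma inv_comp_rev (g h : G1) (e : 𝒢.s g = 𝒢.r h) :
    𝒢.inv (𝒢.comp g h e) = 𝒢.comp (𝒢.inv h) (𝒢.inv g)
      ((𝒢.s_inv h).trans (e.symm.trans (𝒢.r_inv g).symm)) := by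
  have e' : 𝒢.s (𝒢.inv h) = 𝒢.r (𝒢.inv g) := (𝒢.s_inv h).trans (e.symm.trans (𝒢.r_inv g).symm)
  have e2 : 𝒢.s (𝒢.comp g h e) = 𝒢.r (𝒢.comp (𝒢.inv h) (𝒢.inv g) e') := by
    rw [𝒢.s_comp, 𝒢.r_comp, 𝒢.r_inv]
  symm
  refine 𝒢.eq_inv_of_comp _ _ e2 ?_
  rw [𝒢.assoc g h _ e (by rw [𝒢.r_comp, 𝒢.r_inv])]
  rw [𝒢.comp_congr (h' := 𝒢.inv g) rfl ?_ _ (𝒢.r_inv g).symm, 𝒢.comp_inv, 𝒢.r_comp]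
  have := 𝒢.comp_inv_cancel h (𝒢.inv g) e'
  exact this

/-- The homeomorphism `(g, h) ↦ (h, g)` from `G²` to the fibre product of `r` and `s`. -/
def homeo₀ : 𝒢.Pairs ≃ₜ FiberProduct 𝒢.r 𝒢.s where
  toFun q := ⟨(q.1.2, q.1.1), q.2.symm⟩
  invFun q := ⟨(q.1.2, q.1.1), q.2.symm⟩
  left_inv _ := rfl
  right_inv _ := rfl
  continuous_toFun := by fun_prop
  continuous_invFun := by fun_prop

/-- The homeomorphism `(g, h) ↦ (g h, g)` from `G²` to the fibre product of `r` and `r`; its inverse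
is `(k, g) ↦ (g, g⁻¹ k)`. -/
def homeo₁ : 𝒢.Pairs ≃ₜ FiberProduct 𝒢.r 𝒢.r where
  toFun q := ⟨(𝒢.comp q.1.1 q.1.2 q.2, q.1.1), 𝒢.r_comp _ _ _⟩
  invFun q := ⟨(q.1.2, 𝒢.comp (𝒢.inv q.1.2) q.1.1 ((𝒢.s_inv _).trans q.2.symm)), by
    rw [𝒢.r_comp, 𝒢.r_inv]⟩
  left_inv q := Subtype.ext (Prod.ext rfl (𝒢.inv_comp_cancel _ _ _))
  right_inv q := Subtype.ext (Prod.ext (𝒢.comp_inv_cancel _ _ _) rfl)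
  continuous_toFun := by
    have := 𝒢.continuous_comp
    fun_prop
  continuous_invFun := by
    have h : Continuous fun q : FiberProduct 𝒢.r 𝒢.r =>
        (⟨(𝒢.inv q.1.2, q.1.1), (𝒢.s_inv _).trans q.2.symm⟩ : 𝒢.Pairs) := by fun_prop
    have := 𝒢.continuous_comp.comp h
    exact Continuous.subtype_mk (continuous_subtype_val.snd.prodMk this) _

/-- The homeomorphism `(m, n) ↦ (m⁻¹ n, n⁻¹)`. -/
def homeo₃ : FiberProduct 𝒢.r 𝒢.r ≃ₜ 𝒢.Pairs where
  toFun q := ⟨(𝒢.comp (𝒢.inv q.1.1) q.1.2 ((𝒢.s_inv _).trans q.2), 𝒢.inv q.1.2), by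
    rw [𝒢.s_comp, 𝒢.r_inv]⟩
  invFun q := ⟨(𝒢.comp (𝒢.inv q.1.2) (𝒢.inv q.1.1) (by rw [𝒢.s_inv, 𝒢.r_inv, q.2]),
    𝒢.inv q.1.2), by rw [𝒢.r_comp]⟩
  left_inv q := by
    refine Subtype.ext (Prod.ext ?_ (𝒢.inv_inv _))
    have e1 : 𝒢.inv (𝒢.comp (𝒢.inv q.1.1) q.1.2 ((𝒢.s_inv _).trans q.2))
      = 𝒢.comp (𝒢.inv q.1.2) q.1.1 ((𝒢.s_inv _).trans q.2.symm) := by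
      rw [𝒢.inv_comp_rev]
      exact 𝒢.comp_congr rfl (𝒢.inv_inv _) _ _
    refine (𝒢.comp_congr (𝒢.inv_inv _) e1 _ (by rw [𝒢.r_comp, 𝒢.r_inv])).trans ?_
    exact 𝒢.comp_inv_cancel _ _ _
  right_inv q := by
    refine Subtype.ext (Prod.ext ?_ (𝒢.inv_inv _))
    have e1 : 𝒢.inv (𝒢.comp (𝒢.inv q.1.2) (𝒢.inv q.1.1) (by rw [𝒢.s_inv, 𝒢.r_inv, q.2]))
      = 𝒢.comp q.1.1 q.1.2 q.2 := by
      rw [𝒢.inv_comp_rev]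
      exact 𝒢.comp_congr (𝒢.inv_inv _) (𝒢.inv_inv _) _ _
    refine (𝒢.comp_congr e1 rfl _ (by rw [𝒢.s_comp, 𝒢.r_inv])).trans ?_
    rw [𝒢.assoc _ _ _ q.2 (𝒢.r_inv _).symm]
    rw [𝒢.comp_congr rfl ((𝒢.comp_inv _).trans (congrArg 𝒢.unit q.2.symm)) _ (𝒢.r_unit _).symm,
      𝒢.comp_unit]
  continuous_toFun := by
    have h : Continuous fun q : FiberProduct 𝒢.r 𝒢.r =>
        (⟨(𝒢.inv q.1.1, q.1.2), (𝒢.s_inv _).trans q.2⟩ : 𝒢.Pairs) := by fun_prop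
    have := 𝒢.continuous_comp.comp h
    exact Continuous.subtype_mk (this.prodMk (by fun_prop)) _
  continuous_invFun := by
    have h : Continuous fun q : 𝒢.Pairs =>
        (⟨(𝒢.inv q.1.2, 𝒢.inv q.1.1), by rw [𝒢.s_inv, 𝒢.r_inv, q.2]⟩ : 𝒢.Pairs) := by fun_prop
    have := 𝒢.continuous_comp.comp h
    exact Continuous.subtype_mk (this.prodMk (by fun_prop)) _

/-- Inversion as a homeomorphism. -/
def invHomeo : G1 ≃ₜ G1 where
  toFun := 𝒢.inv
  invFun := 𝒢.inv
  left_inv := 𝒢.inv_inv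
  right_inv := 𝒢.inv_inv

end TopGroupoid

/-- A (left) Haar system on `𝒢`: a continuous family of measures `α^x` with full support on the
fibres of `r` that is left invariant, `∫ ξ(k) dα^{r(g)}(k) = ∫ ξ(g h) dα^{s(g)}(h)`. -/
structure HaarSystem {G0 G1 : Type u} [TopologicalSpace G0] [TopologicalSpace G1]
    [MeasurableSpace G1] [BorelSpace G1] (𝒢 : TopGroupoid G0 G1) extends FiberMeasures 𝒢.r where
  full_support : ∀ (g : G1) (U : Set G1), IsOpen U → g ∈ U → 0 < meas (𝒢.r g) U
  left_invariant : ∀ (g : G1) (ξ : C_c(G1, ℂ)),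
    ∫ k, ξ k ∂meas (𝒢.r g)
      = ∫ h, extendZero (fun q : 𝒢.Pairs => ξ (𝒢.comp q.1.1 q.1.2 q.2)) g h ∂meas (𝒢.s g)

namespace HaarSystem

lemma integral_map_inv {G0 G1 : Type u} [TopologicalSpace G0] [TopologicalSpace G1]
    [MeasurableSpace G1] [BorelSpace G1] (𝒢 : TopGroupoid G0 G1) (μ : Measure G1) (ξ : G1 → ℂ) :
    ∫ g, ξ g ∂μ.map 𝒢.inv = ∫ g, ξ (𝒢.inv g) ∂μ :=
  integral_map_equiv 𝒢.invHomeo.toMeasurableEquiv ξ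

variable {G0 G1 : Type u} [TopologicalSpace G0] [TopologicalSpace G1]
  [T2Space G0] [T2Space G1] [LocallyCompactSpace G1]
  [MeasurableSpace G1] [BorelSpace G1] {𝒢 : TopGroupoid G0 G1} (α : HaarSystem 𝒢)

/-- The right Haar system `α̃`, the push-forward of `α` along inversion. -/
noncomputable def tilde : FiberMeasures 𝒢.s where
  meas x := (α.meas x).map 𝒢.inv
  regular x := Measure.Regular.map 𝒢.invHomeo
  meas_compl x := by
    have h : MeasurableSet (𝒢.s ⁻¹' {x})ᶜ :=
      ((isClosed_singleton.preimage 𝒢.s.continuous).isOpen_compl).measurableSet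
    rw [Measure.map_apply 𝒢.inv.continuous.measurable h, ← α.meas_compl x]
    congr 1
    ext g
    simp [𝒢.s_inv]
  continuous_integral ξ := by
    simp only [integral_map_inv]
    exact α.continuous_integral
      (compHomeo 𝒢.invHomeo ξ)

/-- The integration map `(α f)(x) = ∫ f dα^x` along `r`. -/
noncomputable def int : IntegrationMap 𝒢.r := α.toFiberMeasures.toIntegrationMap

/-- The integration map `(α̃ f)(x) = ∫ f dα̃_x` along `s`. -/
noncomputable def tildeInt : IntegrationMap 𝒢.s := α.tilde.toIntegrationMap

/-- `(λ₀ f)(h) = ∫ f(g, h) dα̃_{r(h)}(g)`, along `d₀`. -/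
noncomputable def lam₀ : IntegrationMap 𝒢.d₀ :=
  (α.tilde.pull 𝒢.r).congr 𝒢.homeo₀ 𝒢.d₀ fun _ => rfl

/-- `(λ₁ f)(k) = ∫ f(g, g⁻¹ k) dα^{r(k)}(g)`, along `d₁`. -/
noncomputable def lam₁ : IntegrationMap 𝒢.d₁ :=
  (α.toFiberMeasures.pull 𝒢.r).congr 𝒢.homeo₁ 𝒢.d₁ fun _ => rfl

/-- `(λ₂ f)(g) = ∫ f(g, h) dα^{s(g)}(h)`, along `d₂`. -/
noncomputable def lam₂ : IntegrationMap 𝒢.d₂ := α.toFiberMeasures.pull 𝒢.s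

lemma lam₀_apply (f : C_c(𝒢.Pairs, ℂ)) (h : G1) :
    α.lam₀ f h = ∫ g, extendZero (fun q => f (𝒢.homeo₀.symm q)) h g ∂α.tilde.meas (𝒢.r h) := rfl

lemma lam₁_apply (f : C_c(𝒢.Pairs, ℂ)) (k : G1) :
    α.lam₁ f k = ∫ g, extendZero (fun q => f (𝒢.homeo₁.symm q)) k g ∂α.meas (𝒢.r k) := rfl

lemma lam₂_apply (f : C_c(𝒢.Pairs, ℂ)) (g : G1) :
    α.lam₂ f g = ∫ h, extendZero f g h ∂α.meas (𝒢.s g) := rfl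

/-- `C_c` functions composed with a homeomorphism. -/
lemma exists_ext_comp {W X Z Y : Type u} [TopologicalSpace W] [TopologicalSpace X]
    [TopologicalSpace Y] [TopologicalSpace Z] [T2Space W] [LocallyCompactSpace W] [T2Space X]
    [LocallyCompactSpace X] [T2Space Y] {b : C(W, Y)} {p : C(X, Y)} (e : FiberProduct b p ≃ₜ Z)
    (f : C_c(Z, ℂ)) : ∃ F : C_c(W × X, ℂ), ∀ q, F q.1 = f (e q) :=
  exists_extension (isClosedEmbedding_fiberProduct b p)
    (compHomeo e f)

lemma swap {W X : Type u} [TopologicalSpace W] [TopologicalSpace X] [MeasurableSpace W]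
    [BorelSpace W] [MeasurableSpace X] [BorelSpace X] (F : C_c(W × X, ℂ))
    (μ : Measure W) (ν : Measure X) [IsFiniteMeasureOnCompacts μ] [IsFiniteMeasureOnCompacts ν] :
    ∫ w, ∫ x, F (w, x) ∂ν ∂μ = ∫ x, ∫ w, F (w, x) ∂μ ∂ν :=
  integral_integral_swap_of_hasCompactSupport (f := fun w x => F (w, x)) F.continuous
    F.hasCompactSupport'

/-- `F(·, x)` as a compactly supported function. -/
noncomputable def slice' {W X : Type u} [TopologicalSpace W] [TopologicalSpace X] [T2Space W]
    (F : C_c(W × X, ℂ)) (x : X) : C_c(W, ℂ) where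
  toFun w := F (w, x)
  continuous_toFun := F.continuous.comp (by fun_prop)
  hasCompactSupport' := by
    refine HasCompactSupport.intro (F.hasCompactSupport'.isCompact.image continuous_fst)
      fun x hx => ?_
    exact image_eq_zero_of_notMem_tsupport fun h => hx ⟨_, h, rfl⟩

/-- `α ∘ λ₁ = α ∘ λ₂`. -/
lemma int_lam₁ (f : C_c(𝒢.Pairs, ℂ)) : α.int (α.lam₁ f) = α.int (α.lam₂ f) := by
  obtain ⟨F, hF⟩ := exists_ext_comp 𝒢.homeo₁.symm f
  ext y
  change ∫ k, α.lam₁ f k ∂α.meas y = ∫ g, α.lam₂ f g ∂α.meas y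
  have h1 : ∫ k, α.lam₁ f k ∂α.meas y = ∫ k, ∫ g, F (k, g) ∂α.meas y ∂α.meas y :=
    α.integral_congr fun k hk => by
      rw [lam₁_apply, α.integral_extendZero_eq hF, hk]
  rw [h1, swap]
  refine α.integral_congr fun g hg => ?_
  rw [← hg, lam₂_apply]
  refine (α.left_invariant g (slice' F g)).trans (α.integral_congr fun h hh => ?_)
  rw [extendZero, dif_pos hh.symm, extendZero, dif_pos hh.symm]
  have := hF (𝒢.homeo₁ ⟨(g, h), hh.symm⟩)
  rw [Homeomorph.symm_apply_apply] at this
  exact this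

/-- `α̃ ∘ λ₂ = α ∘ λ₀`. -/
lemma tildeInt_lam₂ (f : C_c(𝒢.Pairs, ℂ)) : α.tildeInt (α.lam₂ f) = α.int (α.lam₀ f) := by
  obtain ⟨F, hF⟩ := exists_extension (isClosedEmbedding_fiberProduct 𝒢.s 𝒢.r) f
  ext y
  change ∫ g, α.lam₂ f g ∂α.tilde.meas y = ∫ h, α.lam₀ f h ∂α.meas y
  have h1 : ∫ g, α.lam₂ f g ∂α.tilde.meas y = ∫ g, ∫ h, F (g, h) ∂α.meas y ∂α.tilde.meas y :=
    α.tilde.integral_congr fun k hk => by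
      rw [lam₂_apply, α.integral_extendZero_eq hF, hk]
  rw [h1, swap]
  refine α.integral_congr fun h hh => ?_
  rw [lam₀_apply, α.tilde.integral_extendZero_eq (F := fun q => F (q.2, q.1)), hh]
  intro q
  exact hF (𝒢.homeo₀.symm q)

/-- `α̃ ∘ λ₁ = α̃ ∘ λ₀`. -/
lemma tildeInt_lam₁ (f : C_c(𝒢.Pairs, ℂ)) : α.tildeInt (α.lam₁ f) = α.tildeInt (α.lam₀ f) := by
  obtain ⟨H, hH⟩ := exists_ext_comp 𝒢.homeo₃ f
  ext y
  change ∫ k, α.lam₁ f k ∂α.tilde.meas y = ∫ h, α.lam₀ f h ∂α.tilde.meas y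
  change ∫ k, α.lam₁ f k ∂(α.meas y).map 𝒢.inv = ∫ h, α.lam₀ f h ∂(α.meas y).map 𝒢.inv
  rw [integral_map_inv, integral_map_inv]
  have h1 : ∫ m, α.lam₁ f (𝒢.inv m) ∂α.meas y = ∫ m, ∫ n, H (m, n) ∂α.meas y ∂α.meas y :=
    α.integral_congr fun m hm => by
      rw [lam₁_apply, 𝒢.r_inv, ← hm]
      refine Eq.trans ?_ (α.left_invariant m (FiberMeasures.slice H m)).symm
      refine α.integral_congr fun g hg => ?_
      have e : 𝒢.r (𝒢.inv m) = 𝒢.r g := (𝒢.r_inv m).trans hg.symm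
      rw [extendZero, dif_pos e, extendZero, dif_pos hg.symm]
      have h2 := hH ⟨(m, 𝒢.comp m g hg.symm), (𝒢.r_comp _ _ _).symm⟩
      refine Eq.trans ?_ h2.symm
      congr 1
      refine Subtype.ext (Prod.ext (𝒢.inv_comp_cancel _ _ _).symm ?_)
      exact (𝒢.inv_comp_rev _ _ _).symm
  have h3 : ∫ n, α.lam₀ f (𝒢.inv n) ∂α.meas y = ∫ n, ∫ m, H (m, n) ∂α.meas y ∂α.meas y :=
    α.integral_congr fun n hn => by
      rw [lam₀_apply, 𝒢.r_inv, ← hn]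
      change ∫ g, _ ∂(α.meas _).map 𝒢.inv = _
      rw [integral_map_inv]
      refine Eq.trans ?_ (α.left_invariant n (slice' H n)).symm
      refine α.integral_congr fun l hl => ?_
      have e : 𝒢.r (𝒢.inv n) = 𝒢.s (𝒢.inv l) := by rw [𝒢.r_inv, 𝒢.s_inv, hl]
      rw [extendZero, dif_pos e, extendZero, dif_pos hl.symm]
      have h2 := hH ⟨(𝒢.comp n l hl.symm, n), 𝒢.r_comp _ _ _⟩
      refine Eq.trans ?_ h2.symm
      congr 1
      refine Subtype.ext (Prod.ext ?_ rfl)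
      have e1 := 𝒢.inv_comp_rev n l hl.symm
      refine Eq.trans ?_ (𝒢.comp_congr e1.symm rfl (by rw [𝒢.s_comp, 𝒢.s_inv]) _)
      rw [𝒢.assoc _ _ _ _ (𝒢.s_inv n)]
      have e2 : 𝒢.unit (𝒢.s n) = 𝒢.unit (𝒢.s (𝒢.inv l)) := by rw [𝒢.s_inv, hl]
      rw [𝒢.comp_congr rfl ((𝒢.inv_comp n).trans e2) _ (𝒢.r_unit _).symm, 𝒢.comp_unit]
      rfl
  rw [h1, h3, swap]

end HaarSystem

end GroupoidRep

namespace GroupoidRep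

open UniformSpace Topology Filter

/-! ## The C*-completion of a *-algebra with a C*-seminorm -/

section Generic

variable (A : Type u) [NonUnitalSeminormedRing A]

/-- The multiplication of the completion of a seminormed algebra. -/
noncomputable def complMul : Completion A → Completion A → Completion A :=
  Function.curry <| ((Completion.isDenseInducing_coe (α := A)).prodMap
    (Completion.isDenseInducing_coe (α := A))).extend
    (fun q : A × A => ((q.1 * q.2 : A) : Completion A))

lemma complMul_coe (a b : A) : complMul A a b = ((a * b : A) : Completion A) :=
  ((Completion.isDenseInducing_coe (α := A)).prodMap
    (Completion.isDenseInducing_coe (α := A))).extend_eq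
    ((Completion.continuous_coe A).comp (continuous_mul (M := A))) (a, b)

lemma continuous_complMul :
    Continuous fun q : Completion A × Completion A => complMul A q.1 q.2 := by
  let m : A →+ A →+ Completion A :=
    (AddMonoidHom.mul : A →+ A →+ A).compr₂ Completion.toCompl
  have : Continuous fun q : A × A => m q.1 q.2 :=
    (Completion.continuous_coe A).comp continuous_mul
  exact (Completion.isDenseInducing_toCompl A).extend_Z_bilin
    (Completion.isDenseInducing_toCompl A) this

/-- The completion of a seminormed algebra. -/
@[reducible] noncomputable def complRing : NonUnitalNormedRing (Completion A) :=
  have hc := continuous_complMul A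
  have hm : ∀ {T : Type u} [TopologicalSpace T] {f g : T → Completion A}, Continuous f →
      Continuous g → Continuous fun t => complMul A (f t) (g t) := fun hf hg =>
    hc.comp (hf.prodMk hg)
  { (inferInstance : NormedAddCommGroup (Completion A)) with
    mul := complMul A
    left_distrib := fun x y z => Completion.induction_on₃ x y z
      (isClosed_eq (hm (by fun_prop) (by fun_prop))
        ((hm (by fun_prop) (by fun_prop)).add (hm (by fun_prop) (by fun_prop)))) fun a b c => by
      change complMul A a (b + c) = complMul A a b + complMul A a c
      rw [← Completion.coe_add, complMul_coe, complMul_coe, complMul_coe, mul_add,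
        Completion.coe_add]
    right_distrib := fun x y z => Completion.induction_on₃ x y z
      (isClosed_eq (hm (by fun_prop) (by fun_prop))
        ((hm (by fun_prop) (by fun_prop)).add (hm (by fun_prop) (by fun_prop)))) fun a b c => by
      change complMul A (a + b) c = complMul A a c + complMul A b c
      rw [← Completion.coe_add, complMul_coe, complMul_coe, complMul_coe, add_mul,
        Completion.coe_add]
    zero_mul := fun x => Completion.induction_on x
      (isClosed_eq (hm (by fun_prop) (by fun_prop)) (by fun_prop)) fun a => by
      change complMul A 0 a = 0
      rw [← Completion.coe_zero, complMul_coe, zero_mul]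
    mul_zero := fun x => Completion.induction_on x
      (isClosed_eq (hm (by fun_prop) (by fun_prop)) (by fun_prop)) fun a => by
      change complMul A a 0 = 0
      rw [← Completion.coe_zero, complMul_coe, mul_zero]
    mul_assoc := fun x y z => Completion.induction_on₃ x y z
      (isClosed_eq (hm (hm (by fun_prop) (by fun_prop)) (by fun_prop))
        (hm (by fun_prop) (hm (by fun_prop) (by fun_prop)))) fun a b c => by
      change complMul A (complMul A a b) c = complMul A a (complMul A b c)
      rw [complMul_coe, complMul_coe, complMul_coe, complMul_coe, mul_assoc]
    norm_mul_le := fun x y => Completion.induction_on₂ x y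
      (isClosed_le (hm (by fun_prop) (by fun_prop)).norm (by fun_prop)) fun a b => by
      change ‖complMul A a b‖ ≤ _
      rw [complMul_coe, Completion.norm_coe, Completion.norm_coe, Completion.norm_coe]
      exact norm_mul_le a b }

variable [StarRing A] [NormedStarGroup A]

/-- The involution of the completion of a seminormed *-algebra. -/
noncomputable def complStar : Completion A → Completion A := Completion.map (star : A → A)

lemma complStar_coe (a : A) : complStar A a = ((star a : A) : Completion A) :=
  Completion.map_coe star_isometry.uniformContinuous a


/-- The completion of a seminormed *-algebra whose seminorm satisfies the C*-identity. -/
@[reducible] noncomputable def complCStar [NormedSpace ℂ A] [IsScalarTower ℂ A A] [SMulCommClass ℂ A A]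
    [StarModule ℂ A] (h : ∀ a : A, ‖a‖ * ‖a‖ ≤ ‖star a * a‖) :
    NonUnitalCStarAlgebra (Completion A) :=
  have hc := continuous_complMul A
  have hs : Continuous (complStar A) := Completion.continuous_map
  have hm : ∀ {T : Type u} [TopologicalSpace T] {f g : T → Completion A}, Continuous f →
      Continuous g → Continuous fun t => complMul A (f t) (g t) := fun hf hg =>
    hc.comp (hf.prodMk hg)
  { complRing A, (inferInstance : NormedSpace ℂ (Completion A)),
    (inferInstance : CompleteSpace (Completion A)) with
    star := complStar A
    star_involutive := fun x => Completion.induction_on x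
      (isClosed_eq (hs.comp hs) continuous_id) fun a => by
      rw [complStar_coe, complStar_coe, star_star]
    star_mul := fun x y => Completion.induction_on₂ x y
      (isClosed_eq (hs.comp hc) (hm (hs.comp continuous_snd) (hs.comp continuous_fst)))
      fun a b => by
      change complStar A (complMul A a b) = complMul A (complStar A b) (complStar A a)
      rw [complStar_coe, complStar_coe, complMul_coe, complStar_coe, complMul_coe, star_mul]
    star_add := fun x y => Completion.induction_on₂ x y
      (isClosed_eq (hs.comp (by fun_prop)) ((hs.comp continuous_fst).add (hs.comp continuous_snd)))
      fun a b => by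
      change complStar A (a + b) = complStar A a + complStar A b
      rw [complStar_coe, complStar_coe, ← Completion.coe_add, complStar_coe, star_add,
        Completion.coe_add]
    norm_mul_self_le := fun x => Completion.induction_on x
      (isClosed_le (by fun_prop) (hm hs continuous_id).norm) fun a => by
      change _ ≤ ‖complMul A (complStar A a) a‖
      rw [complStar_coe, complMul_coe]
      exact (congrArg₂ (· * ·) (Completion.norm_coe a) (Completion.norm_coe a)).trans_le
        ((h a).trans_eq (Completion.norm_coe _).symm)
    smul_assoc := fun c x y => Completion.induction_on₂ x y
      (isClosed_eq (hm (continuous_fst.const_smul c) continuous_snd)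
        (hc.const_smul c)) fun a b => by
      change complMul A (c • (a : Completion A)) b = c • complMul A a b
      rw [← Completion.coe_smul, complMul_coe, complMul_coe, ← Completion.coe_smul, smul_mul_assoc]
    smul_comm := fun c x y => Completion.induction_on₂ x y
      (isClosed_eq (hc.const_smul c) (hm continuous_fst (continuous_snd.const_smul c)))
        fun a b => by
      change c • complMul A a b = complMul A a (c • (b : Completion A))
      rw [← Completion.coe_smul, complMul_coe, complMul_coe, ← Completion.coe_smul, mul_smul_comm]
    star_smul := fun c x => Completion.induction_on x
      (isClosed_eq (hs.comp (continuous_id.const_smul c)) ((continuous_const_smul (star c)).comp hs :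
        Continuous fun x => star c • complStar A x)) fun a => by
      change complStar A (c • (a : Completion A)) = star c • complStar A a
      rw [← Completion.coe_smul, complStar_coe, complStar_coe, ← Completion.coe_smul, star_smul] }

end Generic

/-- A C*-seminorm on a complex *-algebra. -/
structure CStarSeminorm (A : Type u) [NonUnitalRing A] [StarRing A] [Module ℂ A] where
  /-- the seminorm -/
  toFun : A → ℝ
  nonneg : ∀ a, 0 ≤ toFun a
  add_le : ∀ a b, toFun (a + b) ≤ toFun a + toFun b
  smul_eq : ∀ (c : ℂ) a, toFun (c • a) = ‖c‖ * toFun a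
  mul_le : ∀ a b, toFun (a * b) ≤ toFun a * toFun b
  star_eq : ∀ a, toFun (star a) = toFun a
  sq_le : ∀ a, toFun a * toFun a ≤ toFun (star a * a)

namespace CStarSeminorm

variable {A : Type u} [NonUnitalRing A] [StarRing A] [Module ℂ A] (p : CStarSeminorm A)

/-- The algebra `A`, to be equipped with the seminorm `p`. -/
@[nolint unusedArguments]
def Alg (_p : CStarSeminorm A) : Type u := A

instance : NonUnitalRing p.Alg := inferInstanceAs (NonUnitalRing A)
instance : StarRing p.Alg := inferInstanceAs (StarRing A)
instance : Module ℂ p.Alg := inferInstanceAs (Module ℂ A)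
instance [IsScalarTower ℂ A A] : IsScalarTower ℂ p.Alg p.Alg :=
  inferInstanceAs (IsScalarTower ℂ A A)
instance [SMulCommClass ℂ A A] : SMulCommClass ℂ p.Alg p.Alg :=
  inferInstanceAs (SMulCommClass ℂ A A)
instance [StarModule ℂ A] : StarModule ℂ p.Alg := inferInstanceAs (StarModule ℂ A)

instance : Norm p.Alg := ⟨p.toFun⟩

lemma core : SeminormedSpace.Core ℂ p.Alg where
  norm_nonneg := p.nonneg
  norm_smul := p.smul_eq
  norm_triangle := p.add_le

noncomputable instance : SeminormedAddCommGroup p.Alg := SeminormedAddCommGroup.ofCore p.core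

noncomputable instance : NormedSpace ℂ p.Alg where
  norm_smul_le c x := (p.smul_eq c x).le

noncomputable instance : NonUnitalSeminormedRing p.Alg where
  __ := (inferInstance : NonUnitalRing p.Alg)
  __ := (inferInstance : SeminormedAddCommGroup p.Alg)
  norm_mul_le := p.mul_le

instance : NormedStarGroup p.Alg := ⟨fun a => (p.star_eq a).le⟩

/-- The completion of `A` in the C*-seminorm `p` (which divides out the null space of `p`). -/
def Compl : Type u := Completion p.Alg

noncomputable instance [IsScalarTower ℂ A A] [SMulCommClass ℂ A A] [StarModule ℂ A] :
    NonUnitalCStarAlgebra p.Compl := complCStar p.Alg p.sq_le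

/-- The canonical map to the completion. -/
noncomputable def toCompl (a : A) : p.Compl := ((show p.Alg from a : p.Alg) : Completion p.Alg)

end CStarSeminorm

end GroupoidRep

namespace GroupoidRep

open scoped CompactlySupported ZeroAtInfty
open MeasureTheory Topology Filter

/-! ## The groupoid C*-algebra -/

section Functions

variable {G0 G1 : Type u} [TopologicalSpace G0] [TopologicalSpace G1] {𝒢 : TopGroupoid G0 G1}

/-- The involution `f*(g) = conj f(g⁻¹)`. -/
noncomputable def involution (𝒢 : TopGroupoid G0 G1) (f : C_c(G1, ℂ)) : C_c(G1, ℂ) :=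
  star (compHomeo 𝒢.invHomeo f)

lemma involution_apply (f : C_c(G1, ℂ)) (g : G1) : involution 𝒢 f g = star (f (𝒢.inv g)) := rfl

variable [T2Space G0] [T2Space G1]

/-- The function `(g, h) ↦ f₁(g) f₂(h)` on `G²`. -/
noncomputable def boxTimes (𝒢 : TopGroupoid G0 G1) (f₁ f₂ : C_c(G1, ℂ)) : C_c(𝒢.Pairs, ℂ) where
  toFun q := f₁ q.1.1 * f₂ q.1.2
  continuous_toFun := by
    have := f₁.continuous
    have := f₂.continuous
    fun_prop
  hasCompactSupport' := by
    have hK := (f₁.hasCompactSupport'.isCompact.prod f₂.hasCompactSupport'.isCompact)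
    refine HasCompactSupport.intro
      ((isClosedEmbedding_fiberProduct 𝒢.s 𝒢.r).isCompact_preimage hK) fun q hq => ?_
    by_contra h
    refine hq ⟨?_, ?_⟩
    · exact subset_tsupport _ fun h' => h (by rw [show f₁ q.1.1 = 0 from h', zero_mul])
    · exact subset_tsupport _ fun h' => h (by rw [show f₂ q.1.2 = 0 from h', mul_zero])

lemma boxTimes_add_left (f g h : C_c(G1, ℂ)) :
    boxTimes 𝒢 (f + g) h = boxTimes 𝒢 f h + boxTimes 𝒢 g h := by
  ext q; exact add_mul _ _ _

lemma boxTimes_add_right (f g h : C_c(G1, ℂ)) :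
    boxTimes 𝒢 f (g + h) = boxTimes 𝒢 f g + boxTimes 𝒢 f h := by
  ext q; exact mul_add _ _ _

lemma boxTimes_smul_left (c : ℂ) (f g : C_c(G1, ℂ)) :
    boxTimes 𝒢 (c • f) g = c • boxTimes 𝒢 f g := by
  ext q; exact mul_assoc _ _ _

lemma boxTimes_smul_right (c : ℂ) (f g : C_c(G1, ℂ)) :
    boxTimes 𝒢 f (c • g) = c • boxTimes 𝒢 f g := by
  ext q; exact mul_left_comm _ _ _

end Functions

section Conv

variable {G0 G1 : Type u} [TopologicalSpace G0] [TopologicalSpace G1]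
  [T2Space G0] [T2Space G1] [LocallyCompactSpace G1]
  [MeasurableSpace G1] [BorelSpace G1] {𝒢 : TopGroupoid G0 G1}

/-- The convolution `(f₁ * f₂)(k) = ∫ f₁(g) f₂(g⁻¹ k) dα^{r(k)}(g)`. -/
noncomputable def convolution (α : HaarSystem 𝒢) (f₁ f₂ : C_c(G1, ℂ)) : C_c(G1, ℂ) :=
  α.lam₁ (boxTimes 𝒢 f₁ f₂)

lemma convolution_apply (α : HaarSystem 𝒢) (f₁ f₂ : C_c(G1, ℂ)) (k : G1) :
    convolution α f₁ f₂ k = ∫ g, extendZero (fun q : FiberProduct 𝒢.r 𝒢.r =>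
      f₁ q.1.2 * f₂ (𝒢.comp (𝒢.inv q.1.2) q.1.1 ((𝒢.s_inv _).trans q.2.symm))) k g
      ∂α.meas (𝒢.r k) := rfl

lemma convolution_involution (α : HaarSystem 𝒢) (f₁ f₂ : C_c(G1, ℂ)) :
    involution 𝒢 (convolution α f₁ f₂)
      = convolution α (involution 𝒢 f₂) (involution 𝒢 f₁) := by
  ext k
  rw [involution_apply, convolution_apply, convolution_apply, 𝒢.r_inv]
  obtain ⟨F, hF⟩ := HaarSystem.exists_ext_comp 𝒢.homeo₁.symm
    (boxTimes 𝒢 (involution 𝒢 f₂) (involution 𝒢 f₁))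
  refine Eq.trans ?_ (α.integral_extendZero_eq (b := 𝒢.r) (p := 𝒢.r) hF k).symm
  refine Eq.trans ?_ (α.left_invariant k (FiberMeasures.slice F k)).symm
  rw [RCLike.star_def, ← integral_conj]
  refine α.integral_congr fun g hg => ?_
  have e : 𝒢.r (𝒢.inv k) = 𝒢.r g := (𝒢.r_inv k).trans hg.symm
  rw [extendZero, dif_pos e, extendZero, dif_pos hg.symm]
  have h2 := hF ⟨(k, 𝒢.comp k g hg.symm), (𝒢.r_comp _ _ _).symm⟩
  refine Eq.trans ?_ h2.symm
  change star _ = star (f₂ (𝒢.inv (𝒢.comp k g hg.symm)))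
    * star (f₁ (𝒢.inv (𝒢.comp (𝒢.inv (𝒢.comp k g hg.symm)) k _)))
  rw [← star_mul']
  congr 1
  rw [mul_comm]
  have e1 : 𝒢.inv (𝒢.comp k g hg.symm) = 𝒢.comp (𝒢.inv g) (𝒢.inv k) (by rw [𝒢.s_inv, e]) :=
    𝒢.inv_comp_rev k g hg.symm
  congr 2
  · exact e1.symm
  · rw [𝒢.inv_comp_rev]
    rw [𝒢.comp_congr rfl (𝒢.inv_inv _) _ (by rw [𝒢.s_inv, 𝒢.r_comp])]
    exact (𝒢.inv_comp_cancel k g hg.symm).symm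

lemma convolution_assoc (α : HaarSystem 𝒢) (f g h : C_c(G1, ℂ)) :
    convolution α (convolution α f g) h = convolution α f (convolution α g h) := by
  ext k
  obtain ⟨A, hA⟩ := HaarSystem.exists_ext_comp 𝒢.homeo₁.symm (boxTimes 𝒢 f g)
  obtain ⟨χ, hχ⟩ := exists_bump (A.hasCompactSupport'.isCompact.image continuous_fst)
  obtain ⟨B, hB⟩ := HaarSystem.exists_ext_comp 𝒢.homeo₁.symm (boxTimes 𝒢 χ h)
  have hA0 : ∀ x, χ x ≠ 1 → ∀ y, A (x, y) = 0 := fun x hx y => by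
    by_contra h0
    exact hx (hχ x ⟨(x, y), subset_tsupport _ h0, rfl⟩)
  -- the common value of both sides is the double integral of `F`
  let F : C_c(G1 × G1, ℂ) := (⟨fun q => B (k, q.1), by fun_prop⟩ : C(G1 × G1, ℂ)) • A
  have hFapp : ∀ x y, F (x, y) = B (k, x) * A (x, y) := fun x y => rfl
  have hAB : ∀ x (e : 𝒢.r x = 𝒢.r k) y,
      F (x, y) = h (𝒢.comp (𝒢.inv x) k ((𝒢.s_inv x).trans e)) * A (x, y) := fun x e y => by
    rw [hFapp]
    by_cases hx : χ x = 1
    · have := hB ⟨(k, x), e.symm⟩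
      rw [show B (k, x) = χ x * h (𝒢.comp (𝒢.inv x) k ((𝒢.s_inv x).trans e)) from this, hx, one_mul]
    · rw [hA0 x hx, mul_zero, mul_zero]
  have h1 : convolution α (convolution α f g) h k
      = ∫ x, ∫ y, F (x, y) ∂α.meas (𝒢.r k) ∂α.meas (𝒢.r k) := by
    rw [convolution_apply]
    refine α.integral_congr fun x hx => ?_
    rw [extendZero, dif_pos hx.symm]
    change convolution α f g x * h (𝒢.comp (𝒢.inv x) k ((𝒢.s_inv x).trans hx)) = _
    simp only [hAB x hx]
    rw [integral_const_mul, mul_comm]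
    congr 1
    exact (α.integral_extendZero_eq (b := 𝒢.r) (p := 𝒢.r) hA x).trans (by rw [hx])
  rw [h1, HaarSystem.swap, convolution_apply]
  refine α.integral_congr fun y hy => ?_
  rw [extendZero, dif_pos hy.symm]
  change _ = f y * convolution α g h (𝒢.comp (𝒢.inv y) k ((𝒢.s_inv y).trans hy))
  have hr : 𝒢.r (𝒢.comp (𝒢.inv y) k ((𝒢.s_inv y).trans hy)) = 𝒢.s y := by
    rw [𝒢.r_comp, 𝒢.r_inv]
  have e1 : α.meas (𝒢.r k) = α.meas (𝒢.r y) := by rw [hy]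
  rw [convolution_apply, ← integral_const_mul, e1, hr]
  refine (α.left_invariant y (HaarSystem.slice' F y)).trans (α.integral_congr fun z hz => ?_)
  rw [extendZero, dif_pos hz.symm, extendZero, dif_pos (hr.trans hz.symm)]
  change F (𝒢.comp y z hz.symm, y) = _
  rw [hAB _ ((𝒢.r_comp _ _ _).trans hy)]
  have hA' := hA (𝒢.homeo₁ ⟨(y, z), hz.symm⟩)
  rw [Homeomorph.symm_apply_apply] at hA'
  rw [show A (𝒢.comp y z hz.symm, y) = f y * g z from hA', mul_comm, mul_assoc]
  congr 3
  rw [𝒢.comp_congr (𝒢.inv_comp_rev y z hz.symm) rfl _ (by rw [𝒢.s_comp, 𝒢.s_inv, hy])]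
  exact 𝒢.assoc _ _ _ _ _

/-- The convolution algebra `C_c(G¹)`. -/
@[nolint unusedArguments]
def Conv (_α : HaarSystem 𝒢) : Type u := C_c(G1, ℂ)

namespace Conv

variable (α : HaarSystem 𝒢)

noncomputable instance : AddCommGroup (Conv α) := inferInstanceAs (AddCommGroup C_c(G1, ℂ))
noncomputable instance : Module ℂ (Conv α) := inferInstanceAs (Module ℂ C_c(G1, ℂ))

/-- The identity map from `C_c(G¹)` to the convolution algebra. -/
noncomputable def of : C_c(G1, ℂ) ≃ₗ[ℂ] Conv α := LinearEquiv.refl ℂ _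

noncomputable instance : NonUnitalRing (Conv α) where
  __ := (inferInstance : AddCommGroup (Conv α))
  mul f g := convolution α f g
  left_distrib f g h := (congrArg α.lam₁ (boxTimes_add_right f g h)).trans (map_add _ _ _)
  right_distrib f g h := (congrArg α.lam₁ (boxTimes_add_left f g h)).trans (map_add _ _ _)
  zero_mul f := by
    have h : boxTimes 𝒢 0 f = 0 := by ext q; exact zero_mul _
    exact (congrArg α.lam₁ h).trans (map_zero _)
  mul_zero f := by
    have h : boxTimes 𝒢 f 0 = 0 := by ext q; exact mul_zero _
    exact (congrArg α.lam₁ h).trans (map_zero _)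
  mul_assoc f g h := convolution_assoc α f g h

noncomputable instance : StarRing (Conv α) where
  star f := involution 𝒢 f
  star_involutive f := by
    refine CompactlySupportedContinuousMap.ext fun g => ?_
    change star (star ((of α).symm f (𝒢.inv (𝒢.inv g)))) = (of α).symm f g
    rw [star_star, 𝒢.inv_inv]
  star_mul f g := convolution_involution α f g
  star_add f g := by
    refine CompactlySupportedContinuousMap.ext fun k => ?_
    exact star_add _ _

instance : IsScalarTower ℂ (Conv α) (Conv α) where
  smul_assoc c f g := (congrArg α.lam₁ (boxTimes_smul_left c f g)).trans (map_smul _ _ _)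

instance : SMulCommClass ℂ (Conv α) (Conv α) where
  smul_comm _ _ _ := ((congrArg α.lam₁ (boxTimes_smul_right _ _ _)).trans (map_smul _ _ _)).symm

instance : StarModule ℂ (Conv α) where
  star_smul _ _ := CompactlySupportedContinuousMap.ext fun _ => star_mul' _ _

end Conv

/-- The `I`-norm `max (sup_x ∫ |f| dα^x) (sup_x ∫ |f| dα̃_x)`. -/
noncomputable def INorm (α : HaarSystem 𝒢) (f : C_c(G1, ℂ)) : ℝ :=
  max (⨆ x, ∫ g, ‖f g‖ ∂α.meas x) (⨆ x, ∫ g, ‖f g‖ ∂α.tilde.meas x)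

/-- A nondegenerate *-representation of the convolution algebra on a Hilbert space that is
contractive for the `I`-norm. -/
structure HilbertRep (α : HaarSystem 𝒢) (H : Type u) [NormedAddCommGroup H]
    [InnerProductSpace ℂ H] [CompleteSpace H] where
  /-- the underlying *-homomorphism -/
  toHom : Conv α →⋆ₙₐ[ℂ] (H →L[ℂ] H)
  nondegenerate : Dense (Submodule.span ℂ {y : H | ∃ f x, toHom f x = y} : Set H)
  norm_le : ∀ f : C_c(G1, ℂ), ‖toHom (Conv.of α f)‖ ≤ INorm α f

/-- The values `‖L(f)‖` for all representations `L` as above. -/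
def normValues (α : HaarSystem 𝒢) (f : Conv α) : Set ℝ :=
  {c | ∃ (H : Type u) (_ : NormedAddCommGroup H) (_ : InnerProductSpace ℂ H)
    (_ : CompleteSpace H) (L : HilbertRep α H), c = ‖L.toHom f‖}

lemma normValues_nonempty (α : HaarSystem 𝒢) (f : Conv α) : (normValues α f).Nonempty := by
  refine ⟨_, PUnit, inferInstance, inferInstance, inferInstance, ⟨0, ?_, fun f => ?_⟩, rfl⟩
  · intro x
    rw [Subsingleton.elim x 0]
    exact subset_closure (Submodule.zero_mem _)
  · have h : ‖(0 : Conv α →⋆ₙₐ[ℂ] (PUnit.{u+1} →L[ℂ] PUnit.{u+1})) (Conv.of α f)‖ = 0 := by simp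
    rw [h]
    exact le_max_of_le_left (Real.iSup_nonneg fun x => integral_nonneg fun g => norm_nonneg _)

lemma bddAbove_normValues (α : HaarSystem 𝒢) (f : Conv α) : BddAbove (normValues α f) := by
  refine ⟨INorm α f, ?_⟩
  rintro _ ⟨H, _, _, _, L, rfl⟩
  exact L.norm_le f

/-- The maximal C*-seminorm `f ↦ sup_L ‖L(f)‖`. -/
noncomputable def maxSeminorm (α : HaarSystem 𝒢) : CStarSeminorm (Conv α) where
  toFun f := sSup (normValues α f)
  nonneg f := Real.sSup_nonneg (by rintro _ ⟨H, _, _, _, L, rfl⟩; exact norm_nonneg _)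
  add_le f g := by
    refine csSup_le (normValues_nonempty α _) ?_
    rintro _ ⟨H, _, _, _, L, rfl⟩
    rw [map_add]
    exact (norm_add_le _ _).trans (add_le_add
      (le_csSup (bddAbove_normValues α f) ⟨H, _, _, _, L, rfl⟩)
      (le_csSup (bddAbove_normValues α g) ⟨H, _, _, _, L, rfl⟩))
  smul_eq c f := by
    rw [← smul_eq_mul, ← Real.sSup_smul_of_nonneg (norm_nonneg c)]
    congr 1
    ext d
    rw [Set.mem_smul_set]
    constructor
    · rintro ⟨H, _, _, _, L, rfl⟩
      exact ⟨_, ⟨H, _, _, _, L, rfl⟩, by rw [map_smul, norm_smul, smul_eq_mul]⟩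
    · rintro ⟨_, ⟨H, _, _, _, L, rfl⟩, rfl⟩
      exact ⟨H, _, _, _, L, by rw [map_smul, norm_smul, smul_eq_mul]⟩
  mul_le f g := by
    refine csSup_le (normValues_nonempty α _) ?_
    rintro _ ⟨H, _, _, _, L, rfl⟩
    rw [map_mul]
    exact (norm_mul_le _ _).trans (mul_le_mul
      (le_csSup (bddAbove_normValues α f) ⟨H, _, _, _, L, rfl⟩)
      (le_csSup (bddAbove_normValues α g) ⟨H, _, _, _, L, rfl⟩) (norm_nonneg _)
      ((norm_nonneg _).trans (le_csSup (bddAbove_normValues α f) ⟨H, _, _, _, L, rfl⟩)))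
  star_eq f := by
    congr 1
    ext c
    constructor <;> rintro ⟨H, _, _, _, L, rfl⟩ <;> refine ⟨H, _, _, _, L, ?_⟩
    · rw [map_star, norm_star]
    · rw [map_star, norm_star]
  sq_le f := by
    have h0 : 0 ≤ sSup (normValues α (star f * f)) :=
      Real.sSup_nonneg (by rintro _ ⟨H, _, _, _, L, rfl⟩; exact norm_nonneg _)
    have h : sSup (normValues α f) ≤ √(sSup (normValues α (star f * f))) := by
      refine csSup_le (normValues_nonempty α _) ?_
      rintro _ ⟨H, _, _, _, L, rfl⟩
      refine Real.le_sqrt_of_sq_le ?_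
      refine le_csSup_of_le (bddAbove_normValues α _) ⟨H, _, _, _, L, rfl⟩ ?_
      rw [map_mul, map_star, CStarRing.norm_star_mul_self, sq]
    have h1 : 0 ≤ sSup (normValues α f) :=
      Real.sSup_nonneg (by rintro _ ⟨H, _, _, _, L, rfl⟩; exact norm_nonneg _)
    calc _ ≤ √(sSup (normValues α (star f * f))) * √(sSup (normValues α (star f * f))) :=
          mul_le_mul h h h1 (Real.sqrt_nonneg _)
      _ = _ := Real.mul_self_sqrt h0

/-- The groupoid C*-algebra `C*(G, α)`. -/
abbrev GroupoidCStar (α : HaarSystem 𝒢) : Type u := (maxSeminorm α).Compl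

end Conv

end GroupoidRep

namespace GroupoidRep

open scoped ZeroAtInfty CompactlySupported

/-! ## Representations of `(G, α)` -/

lemma Isometry.lTensor_tmul {B D : Type u} [NonUnitalCStarAlgebra B] [NonUnitalCStarAlgebra D]
    (E : HilbertModule B) {F₁ F₂ : HilbertModule D}
    (φ₁ : StarRep B F₁) (φ₂ : StarRep B F₂) (V : Isometry F₁ F₂)
    (hV : ∀ b x, V (φ₁ b x) = φ₂ b (V x)) (x : E) (y : F₁) :
    V.lTensor E φ₁ φ₂ hV (tmul φ₁ x y) = tmul φ₂ x (V y) :=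
  Isometry.ofGenerators_apply (fun p : E × F₁ => tmul φ₁ p.1 p.2) _ _ _ (x, y)

lemma Unitary.lTensor_tmul {B D : Type u} [NonUnitalCStarAlgebra B] [NonUnitalCStarAlgebra D]
    (E : HilbertModule B) {F₁ F₂ : HilbertModule D}
    (φ₁ : StarRep B F₁) (φ₂ : StarRep B F₂) (V : Unitary F₁ F₂)
    (hV : ∀ b x, V (φ₁ b x) = φ₂ b (V x)) (x : E) (y : F₁) :
    V.lTensor E φ₁ φ₂ hV (tmul φ₁ x y) = tmul φ₂ x (V y) :=
  Unitary.ofGenerators_apply (fun p : E × F₁ => tmul φ₁ p.1 p.2) _ _ _ _ (x, y)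

/-- Two continuous linear maps that agree on a total family are equal. -/
lemma eq_of_generators {B D : Type u} [NonUnitalCStarAlgebra B] [NonUnitalCStarAlgebra D]
    {E : HilbertModule B} {F : HilbertModule D} {ι : Type*}
    (a : ι → E) (ha : Dense (Submodule.span ℂ (Set.range a) : Set E)) {S T : E →L[ℂ] F}
    (h : ∀ i, S (a i) = T (a i)) (x : E) : S x = T x := by
  have : S = T := ContinuousLinearMap.ext_on ha (by rintro _ ⟨i, rfl⟩; exact h i)
  rw [this]

/-- A unitary as a continuous linear map. -/
noncomputable def Unitary.toCLM {D : Type u} [NonUnitalCStarAlgebra D] {E F : HilbertModule D}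
    (U : Unitary E F) : E →L[ℂ] F := U.toLI.toContinuousLinearMap

section Pullback

variable {X Y Z Z' : Type u} [TopologicalSpace X] [TopologicalSpace Y] [TopologicalSpace Z]
  [TopologicalSpace Z'] [T2Space Y] [LocallyCompactSpace Y]
  {d : C(X, Y)} {g₁ g₂ : C(Y, Z)} {h₁ h₂ : C(X, Z)}
  {D : Type u} [NonUnitalCStarAlgebra D] {F : HilbertModule D}

/-- The pull-back `d*(U) : L²(X, K₁) ⊗_φ F → L²(X, K₂) ⊗_φ F` of a `C₀(Y)`-linear unitary
`U : L²(Y, J₁) ⊗_φ F → L²(Y, J₂) ⊗_φ F` along `d : X → Y` with a family of measures `I`: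
the composite of `1 ⊗ U` on `L²(X, I) ⊗_{C₀(Y)} (L²(Y, Jᵢ) ⊗_φ F)` with the canonical
isomorphisms to `L²(X, Kᵢ) ⊗_φ F`, for `Kᵢ = Jᵢ ∘ I`. -/
noncomputable def pullback (I : IntegrationMap d) (J₁ : IntegrationMap g₁) (J₂ : IntegrationMap g₂)
    (K₁ : IntegrationMap h₁) (K₂ : IntegrationMap h₂)
    (hK₁ : ∀ ξ, K₁ ξ = J₁ (I ξ)) (hK₂ : ∀ ξ, K₂ ξ = J₂ (I ξ)) (φ : StarRep C₀(Z, ℂ) F)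
    (U : Unitary (tensor J₁.L2 φ) (tensor J₂.L2 φ))
    (hU : ∀ a x, U (J₁.mulRep.tensor φ a x) = J₂.mulRep.tensor φ a (U x)) :
    Unitary (tensor K₁.L2 φ) (tensor K₂.L2 φ) :=
  ((IntegrationMap.canon I J₁ K₁ hK₁ φ).symm.trans
    (U.lTensor I.L2 (J₁.mulRep.tensor φ) (J₂.mulRep.tensor φ) hU)).trans
    (IntegrationMap.canon I J₂ K₂ hK₂ φ)

end Pullback

namespace HaarSystem

variable {G0 G1 : Type u} [TopologicalSpace G0] [TopologicalSpace G1]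
  [T2Space G0] [T2Space G1] [LocallyCompactSpace G1]
  [MeasurableSpace G1] [BorelSpace G1] {𝒢 : TopGroupoid G0 G1} (α : HaarSystem 𝒢)

/-- `μ₀ = α ∘ λ₂ = α ∘ λ₁`, along `(g, h) ↦ r(g)`. -/
noncomputable def mu₀ : IntegrationMap (𝒢.r.comp 𝒢.d₂) := α.int.comp α.lam₂

/-- `μ₁ = α ∘ λ₀ = α̃ ∘ λ₂`, along `(g, h) ↦ r(h) = s(g)`. -/
noncomputable def mu₁ : IntegrationMap (𝒢.r.comp 𝒢.d₀) := α.int.comp α.lam₀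

/-- `μ₂ = α̃ ∘ λ₀ = α̃ ∘ λ₁`, along `(g, h) ↦ s(h)`. -/
noncomputable def mu₂ : IntegrationMap (𝒢.s.comp 𝒢.d₀) := α.tildeInt.comp α.lam₀

end HaarSystem

section Representation

variable {G0 G1 : Type u} [TopologicalSpace G0] [TopologicalSpace G1]
  [T2Space G0] [T2Space G1] [LocallyCompactSpace G1]
  [MeasurableSpace G1] [BorelSpace G1] {𝒢 : TopGroupoid G0 G1}

/-- A representation of `(G, α)` on the Hilbert `D`-module `F`: a nondegenerate representation `φ` of
`C₀(G⁰)` on `F` and a `C₀(G¹)`-linear unitary `U : L²(G¹, s, α̃) ⊗_φ F → L²(G¹, r, α) ⊗_φ F` with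
`d₁*(U) = d₂*(U) ∘ d₀*(U)` as maps `L²(G², v₂, μ₂) ⊗_φ F → L²(G², v₀, μ₀) ⊗_φ F`. -/
structure GroupoidRepr (α : HaarSystem 𝒢) {D : Type u} [NonUnitalCStarAlgebra D]
    (F : HilbertModule D) where
  /-- the representation of `C₀(G⁰)` -/
  φ : Rep C₀(G0, ℂ) F
  /-- the unitary -/
  U : Unitary (tensor α.tildeInt.L2 φ.toStarRep) (tensor α.int.L2 φ.toStarRep)
  intertwines : ∀ (a : C₀(G1, ℂ)) x,
    U (α.tildeInt.mulRep.tensor φ.toStarRep a x) = α.int.mulRep.tensor φ.toStarRep a (U x)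
  cocycle : ∀ x,
    pullback α.lam₁ α.tildeInt α.int α.mu₂ α.mu₀ (fun ξ => (α.tildeInt_lam₁ ξ).symm)
        (fun ξ => (α.int_lam₁ ξ).symm) φ.toStarRep U intertwines x
      = pullback α.lam₂ α.tildeInt α.int α.mu₁ α.mu₀ (fun ξ => (α.tildeInt_lam₂ ξ).symm)
          (fun _ => rfl) φ.toStarRep U intertwines
          (pullback α.lam₀ α.tildeInt α.int α.mu₂ α.mu₁ (fun _ => rfl) (fun _ => rfl)
            φ.toStarRep U intertwines x)

end Representation

end GroupoidRep

namespace GroupoidRep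

open scoped ZeroAtInfty CompactlySupported

/-! ## Induction of representations -/

section Induce

variable {A B C D : Type u} [NonUnitalCStarAlgebra A] [NonUnitalCStarAlgebra B]
  [NonUnitalCStarAlgebra C] [NonUnitalCStarAlgebra D]

lemma Unitary.apply_symm_apply {E F : HilbertModule D} (V : Unitary E F) (y : F) :
    V (V.symm y) = y := by
  obtain ⟨x, rfl⟩ := V.surjective y
  rw [V.symm_apply_apply]

lemma Unitary.trans_apply {E F H : HilbertModule D} (V : Unitary E F) (W : Unitary F H) (x : E) :
    V.trans W x = W (V x) := rfl

lemma tensorAssoc_intertwines {M : HilbertModule A} {F : HilbertModule B} {E : HilbertModule D}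
    (ρ : StarRep C M) (φ : StarRep A F) (ψ : StarRep B E) (c : C) (x : tensor (tensor M φ) ψ) :
    tensorAssoc M φ ψ ((ρ.tensor φ).tensor ψ c x)
      = ρ.tensor (φ.tensor ψ) c (tensorAssoc M φ ψ x) := by
  refine eq_of_generators
    (S := (tensorAssoc M φ ψ).toCLM.comp ((ρ.tensor φ).tensor ψ c))
    (T := (ρ.tensor (φ.tensor ψ) c).comp (tensorAssoc M φ ψ).toCLM)
    (fun p : (M × F) × E => tmul ψ (tmul φ p.1.1 p.1.2) p.2)
    (dense_tmul_of_dense ψ (fun p : M × F => tmul φ p.1 p.2) (id : E → E) (dense_tmul φ)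
      (by simp)) (fun p => ?_) x
  change tensorAssoc M φ ψ ((ρ.tensor φ).tensor ψ c (tmul ψ (tmul φ p.1.1 p.1.2) p.2))
    = ρ.tensor (φ.tensor ψ) c (tensorAssoc M φ ψ (tmul ψ (tmul φ p.1.1 p.1.2) p.2))
  rw [StarRep.tensor_tmul, StarRep.tensor_tmul, tensorAssoc_tmul, tensorAssoc_tmul,
    StarRep.tensor_tmul]

lemma Unitary.rTensor_intertwines {E₁ E₂ : HilbertModule B} {F : HilbertModule D}
    (ρ₁ : StarRep A E₁) (ρ₂ : StarRep A E₂) (V : Unitary E₁ E₂)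
    (hV : ∀ a x, V (ρ₁ a x) = ρ₂ a (V x)) (φ : StarRep B F) (a : A) (x : tensor E₁ φ) :
    V.rTensor φ (ρ₁.tensor φ a x) = ρ₂.tensor φ a (V.rTensor φ x) := by
  refine eq_of_generators (S := (V.rTensor φ).toCLM.comp (ρ₁.tensor φ a))
    (T := (ρ₂.tensor φ a).comp (V.rTensor φ).toCLM)
    (fun p : E₁ × F => tmul φ p.1 p.2) (dense_tmul φ) (fun p => ?_) x
  change V.rTensor φ (ρ₁.tensor φ a (tmul φ p.1 p.2))
    = ρ₂.tensor φ a (V.rTensor φ (tmul φ p.1 p.2))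
  rw [StarRep.tensor_tmul, Unitary.rTensor_tmul, Unitary.rTensor_tmul, StarRep.tensor_tmul, hV]

lemma Unitary.rTensor_comp {E₁ E₂ E₃ : HilbertModule B} {F : HilbertModule D}
    (V₁ : Unitary E₁ E₂) (V₂ : Unitary E₂ E₃) (W : Unitary E₁ E₃) (hW : ∀ x, W x = V₂ (V₁ x))
    (φ : StarRep B F) (x : tensor E₁ φ) :
    W.rTensor φ x = V₂.rTensor φ (V₁.rTensor φ x) := by
  refine eq_of_generators (S := (W.rTensor φ).toCLM)
    (T := (V₂.rTensor φ).toCLM.comp (V₁.rTensor φ).toCLM)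
    (fun p : E₁ × F => tmul φ p.1 p.2) (dense_tmul φ) (fun p => ?_) x
  change W.rTensor φ (tmul φ p.1 p.2) = V₂.rTensor φ (V₁.rTensor φ (tmul φ p.1 p.2))
  rw [Unitary.rTensor_tmul, Unitary.rTensor_tmul, Unitary.rTensor_tmul, hW]

/-- The unitary `U ⊗ 1` between `M₁ ⊗ (F ⊗_ψ E) ≅ (M₁ ⊗ F) ⊗_ψ E` and
`(M₂ ⊗ F) ⊗_ψ E ≅ M₂ ⊗ (F ⊗_ψ E)`. -/
noncomputable def Unitary.induce {M₁ M₂ : HilbertModule A} {F : HilbertModule B}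
    {E : HilbertModule D} (φ : StarRep A F) (U : Unitary (tensor M₁ φ) (tensor M₂ φ))
    (ψ : StarRep B E) : Unitary (tensor M₁ (φ.tensor ψ)) (tensor M₂ (φ.tensor ψ)) :=
  ((tensorAssoc M₁ φ ψ).symm.trans (U.rTensor ψ)).trans (tensorAssoc M₂ φ ψ)

lemma Unitary.induce_assoc {M₁ M₂ : HilbertModule A} {F : HilbertModule B}
    {E : HilbertModule D} (φ : StarRep A F) (U : Unitary (tensor M₁ φ) (tensor M₂ φ))
    (ψ : StarRep B E) (x : tensor (tensor M₁ φ) ψ) :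
    U.induce φ ψ (tensorAssoc M₁ φ ψ x) = tensorAssoc M₂ φ ψ (U.rTensor ψ x) := by
  rw [Unitary.induce, Unitary.trans_apply, Unitary.trans_apply, Unitary.symm_apply_apply]

lemma Unitary.induce_intertwines {M₁ M₂ : HilbertModule A} {F : HilbertModule B}
    {E : HilbertModule D} (φ : StarRep A F) (U : Unitary (tensor M₁ φ) (tensor M₂ φ))
    (ρ₁ : StarRep C M₁) (ρ₂ : StarRep C M₂)
    (hU : ∀ c x, U (ρ₁.tensor φ c x) = ρ₂.tensor φ c (U x)) (ψ : StarRep B E) (c : C)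
    (x : tensor M₁ (φ.tensor ψ)) :
    U.induce φ ψ (ρ₁.tensor (φ.tensor ψ) c x) = ρ₂.tensor (φ.tensor ψ) c (U.induce φ ψ x) := by
  obtain ⟨x, rfl⟩ := (tensorAssoc M₁ φ ψ).surjective x
  rw [← tensorAssoc_intertwines, Unitary.induce_assoc, Unitary.induce_assoc,
    Unitary.rTensor_intertwines _ _ U hU, tensorAssoc_intertwines]

end Induce

section PullbackInduce

variable {X Y Z : Type u} [TopologicalSpace X] [TopologicalSpace Y] [TopologicalSpace Z]
  [T2Space Y] [LocallyCompactSpace Y]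
  {d : C(X, Y)} {g₁ g₂ : C(Y, Z)} {h₁ h₂ : C(X, Z)}
  {D D' : Type u} [NonUnitalCStarAlgebra D] [NonUnitalCStarAlgebra D'] {F : HilbertModule D}
  {E : HilbertModule D'}

lemma canon_tmul (I : IntegrationMap d) (J : IntegrationMap g₁) (K : IntegrationMap h₁)
    (hK : ∀ ξ, K ξ = J (I ξ)) (φ : StarRep C₀(Z, ℂ) F) (ξ : C_c(X, ℂ)) (η : C_c(Y, ℂ)) (x : F) :
    IntegrationMap.canon I J K hK φ (tmul (J.mulRep.tensor φ) (I.cls ξ) (tmul φ (J.cls η) x))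
      = tmul φ (K.cls ((η.toContinuousMap.comp d) • ξ)) x :=
  Unitary.ofGenerators_apply (fun p : C_c(X, ℂ) × C_c(Y, ℂ) × F =>
      tmul (J.mulRep.tensor φ) (I.cls p.1) (tmul φ (J.cls p.2.1) p.2.2)) _ _ _ _ (ξ, η, x)

lemma canon_assoc (I : IntegrationMap d) (J : IntegrationMap g₁) (K : IntegrationMap h₁)
    (hK : ∀ ξ, K ξ = J (I ξ)) (φ : StarRep C₀(Z, ℂ) F) (ψ : StarRep D E) (ξ : C_c(X, ℂ))
    (t : tensor J.L2 φ) (e : E) :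
    IntegrationMap.canon I J K hK (φ.tensor ψ)
        (tmul (J.mulRep.tensor (φ.tensor ψ)) (I.cls ξ) (tensorAssoc J.L2 φ ψ (tmul ψ t e)))
      = tensorAssoc K.L2 φ ψ (tmul ψ
          (IntegrationMap.canon I J K hK φ (tmul (J.mulRep.tensor φ) (I.cls ξ) t)) e) := by
  have hR : ∀ {B D : Type u} [NonUnitalCStarAlgebra B] [NonUnitalCStarAlgebra D]
      {M : HilbertModule B} {N : HilbertModule D} (χ : StarRep B N) (m : M),
      ∃ T : N →L[ℂ] tensor M χ, ∀ n, T n = tmul χ m n := fun χ m =>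
    ⟨⟨tmulR χ m, continuous_tmul_right χ m⟩, fun _ => rfl⟩
  have hL : ∀ {B D : Type u} [NonUnitalCStarAlgebra B] [NonUnitalCStarAlgebra D]
      {M : HilbertModule B} {N : HilbertModule D} (χ : StarRep B N) (n : N),
      ∃ T : M →L[ℂ] tensor M χ, ∀ m, T m = tmul χ m n := fun χ n =>
    ⟨⟨tmulL χ n, continuous_tmul_left χ n⟩, fun _ => rfl⟩
  obtain ⟨T₁, hT₁⟩ := hL (M := tensor J.L2 φ) ψ e
  obtain ⟨T₂, hT₂⟩ := hR (J.mulRep.tensor (φ.tensor ψ)) (I.cls ξ)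
  obtain ⟨T₃, hT₃⟩ := hR (J.mulRep.tensor φ) (I.cls ξ)
  obtain ⟨T₄, hT₄⟩ := hL (M := tensor K.L2 φ) ψ e
  have key := eq_of_generators (E := tensor J.L2 φ) (F := tensor K.L2 (φ.tensor ψ))
    (S := (IntegrationMap.canon I J K hK (φ.tensor ψ)).toCLM.comp
      (T₂.comp ((tensorAssoc J.L2 φ ψ).toCLM.comp T₁)))
    (T := (tensorAssoc K.L2 φ ψ).toCLM.comp
      (T₄.comp ((IntegrationMap.canon I J K hK φ).toCLM.comp T₃)))
    (fun p : C_c(Y, ℂ) × F => tmul φ (J.cls p.1) p.2)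
    (dense_tmul_of_dense φ (fun ξ => J.cls ξ) (id : F → F) J.dense_cls (by simp)) (fun p => by
      change IntegrationMap.canon I J K hK (φ.tensor ψ) (T₂ (tensorAssoc J.L2 φ ψ (T₁ _)))
        = tensorAssoc K.L2 φ ψ (T₄ (IntegrationMap.canon I J K hK φ (T₃ _)))
      rw [hT₁, hT₃, tensorAssoc_tmul, hT₂, canon_tmul, canon_tmul, hT₄, tensorAssoc_tmul]) t
  have h1 : IntegrationMap.canon I J K hK (φ.tensor ψ) (T₂ (tensorAssoc J.L2 φ ψ (T₁ t)))
        = tensorAssoc K.L2 φ ψ (T₄ (IntegrationMap.canon I J K hK φ (T₃ t))) := key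
  rwa [hT₁, hT₂, hT₃, hT₄] at h1

/-- Pull-backs are compatible with induction. -/
lemma pullback_induce (I : IntegrationMap d) (J₁ : IntegrationMap g₁) (J₂ : IntegrationMap g₂)
    (K₁ : IntegrationMap h₁) (K₂ : IntegrationMap h₂)
    (hK₁ : ∀ ξ, K₁ ξ = J₁ (I ξ)) (hK₂ : ∀ ξ, K₂ ξ = J₂ (I ξ)) (φ : StarRep C₀(Z, ℂ) F)
    (U : Unitary (tensor J₁.L2 φ) (tensor J₂.L2 φ))
    (hU : ∀ a x, U (J₁.mulRep.tensor φ a x) = J₂.mulRep.tensor φ a (U x)) (ψ : StarRep D E)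
    (x : tensor K₁.L2 (φ.tensor ψ)) :
    pullback I J₁ J₂ K₁ K₂ hK₁ hK₂ (φ.tensor ψ) (U.induce φ ψ)
        (U.induce_intertwines φ J₁.mulRep J₂.mulRep hU ψ) x
      = (pullback I J₁ J₂ K₁ K₂ hK₁ hK₂ φ U hU).induce φ ψ x := by
  have hU' := U.induce_intertwines φ J₁.mulRep J₂.mulRep hU ψ
  obtain ⟨x, rfl⟩ := (IntegrationMap.canon I J₁ K₁ hK₁ (φ.tensor ψ)).surjective x
  have hd : Dense (Submodule.span ℂ (Set.range fun p : C_c(X, ℂ) × tensor J₁.L2 φ × E =>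
      tmul (J₁.mulRep.tensor (φ.tensor ψ)) (I.cls p.1)
        (tensorAssoc J₁.L2 φ ψ (tmul ψ p.2.1 p.2.2))) :
      Set (tensor I.L2 (J₁.mulRep.tensor (φ.tensor ψ)))) := by
    refine dense_tmul_of_dense (J₁.mulRep.tensor (φ.tensor ψ)) (fun ξ => I.cls ξ)
      (fun p : tensor J₁.L2 φ × E => tensorAssoc J₁.L2 φ ψ (tmul ψ p.1 p.2)) I.dense_cls ?_
    have hd := (dense_tmul ψ (E := tensor J₁.L2 φ) (F := E))
    have h2 := (tensorAssoc J₁.L2 φ ψ).surjective.denseRange.dense_image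
      (tensorAssoc J₁.L2 φ ψ).continuous hd
    refine h2.mono ?_
    rintro _ ⟨y, hy, rfl⟩
    have := Submodule.mem_map_of_mem (f := (tensorAssoc J₁.L2 φ ψ).toLin) hy
    rw [Submodule.map_span] at this
    refine Submodule.span_mono ?_ this
    rintro _ ⟨_, ⟨p, rfl⟩, rfl⟩
    exact ⟨p, rfl⟩
  refine eq_of_generators
    (S := (pullback I J₁ J₂ K₁ K₂ hK₁ hK₂ (φ.tensor ψ) (U.induce φ ψ) hU').toCLM.comp
      (IntegrationMap.canon I J₁ K₁ hK₁ (φ.tensor ψ)).toCLM)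
    (T := ((pullback I J₁ J₂ K₁ K₂ hK₁ hK₂ φ U hU).induce φ ψ).toCLM.comp
      (IntegrationMap.canon I J₁ K₁ hK₁ (φ.tensor ψ)).toCLM) _ hd (fun p => ?_) x
  obtain ⟨ξ, t, e⟩ := p
  change pullback I J₁ J₂ K₁ K₂ hK₁ hK₂ (φ.tensor ψ) (U.induce φ ψ) hU'
      (IntegrationMap.canon I J₁ K₁ hK₁ (φ.tensor ψ)
        (tmul _ (I.cls ξ) (tensorAssoc J₁.L2 φ ψ (tmul ψ t e))))
    = (pullback I J₁ J₂ K₁ K₂ hK₁ hK₂ φ U hU).induce φ ψ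
      (IntegrationMap.canon I J₁ K₁ hK₁ (φ.tensor ψ)
        (tmul _ (I.cls ξ) (tensorAssoc J₁.L2 φ ψ (tmul ψ t e))))
  rw [canon_assoc I J₁ K₁ hK₁ φ ψ, Unitary.induce_assoc, Unitary.rTensor_tmul,
    ← canon_assoc I J₁ K₁ hK₁ φ ψ]
  simp only [pullback, Unitary.trans_apply, Unitary.symm_apply_apply]
  rw [Unitary.lTensor_tmul, Unitary.lTensor_tmul, Unitary.induce_assoc, Unitary.rTensor_tmul,
    canon_assoc I J₂ K₂ hK₂ φ ψ]

end PullbackInduce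

section Main

variable {G0 G1 : Type u} [TopologicalSpace G0] [TopologicalSpace G1]
  [T2Space G0] [T2Space G1] [LocallyCompactSpace G1]
  [MeasurableSpace G1] [BorelSpace G1] {𝒢 : TopGroupoid G0 G1} {α : HaarSystem 𝒢}

/-- The representation `(φ ⊗ 1, U ⊗ 1)` on `F ⊗_D E` induced by the representation `(φ, U)` on `F`
and a correspondence `(E, ψ)` from `D` to `D'`. -/
noncomputable def GroupoidRepr.induce {D D' : Type u} [NonUnitalCStarAlgebra D]
    [NonUnitalCStarAlgebra D'] {F : HilbertModule D} {E : HilbertModule D'}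
    (R : GroupoidRepr α F) (ψ : Rep D E) : GroupoidRepr α (tensor F ψ.toStarRep) where
  φ := R.φ.tensor ψ.toStarRep
  U := R.U.induce R.φ.toStarRep ψ.toStarRep
  intertwines := R.U.induce_intertwines R.φ.toStarRep _ _ R.intertwines ψ.toStarRep
  cocycle x := by
    refine (pullback_induce _ _ _ _ _ _ _ R.φ.toStarRep R.U R.intertwines ψ.toStarRep x).trans ?_
    refine Eq.trans ?_ ((pullback_induce _ _ _ _ _ _ _ R.φ.toStarRep R.U R.intertwines
      ψ.toStarRep _).trans (congrArg _ (pullback_induce _ _ _ _ _ _ _ R.φ.toStarRep R.U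
        R.intertwines ψ.toStarRep x))).symm
    obtain ⟨x, rfl⟩ := (tensorAssoc α.mu₂.L2 R.φ.toStarRep ψ.toStarRep).surjective x
    rw [Unitary.induce_assoc, Unitary.induce_assoc, Unitary.induce_assoc]
    exact congrArg _ (Unitary.rTensor_comp _ _ _ R.cocycle ψ.toStarRep x)

/-- The isometry `V` intertwines the representations `(φ₁, U₁)` and `(φ₂, U₂)` of `(G, α)`:
`V φ₁(f) = φ₂(f) V` and `(1 ⊗ V) U₁ = U₂ (1 ⊗ V)`. -/
def GroupoidRepr.Intertwines {D : Type u} [NonUnitalCStarAlgebra D] {F₁ F₂ : HilbertModule D}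
    (V : Isometry F₁ F₂) (R₁ : GroupoidRepr α F₁) (R₂ : GroupoidRepr α F₂) : Prop :=
  ∃ h : ∀ (f : C₀(G0, ℂ)) x, V (R₁.φ f x) = R₂.φ f (V x),
    ∀ x, V.lTensor α.int.L2 R₁.φ.toStarRep R₂.φ.toStarRep h (R₁.U x)
      = R₂.U (V.lTensor α.tildeInt.L2 R₁.φ.toStarRep R₂.φ.toStarRep h x)

/-- The isometry `V` intertwines the representations `π₁` and `π₂` of the C*-algebra `B`. -/
def Rep.Intertwines {B D : Type u} [NonUnitalCStarAlgebra B] [NonUnitalCStarAlgebra D]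
    {F₁ F₂ : HilbertModule D} (V : Isometry F₁ F₂) (π₁ : Rep B F₁) (π₂ : Rep B F₂) : Prop :=
  ∀ b x, V (π₁ b x) = π₂ b (V x)

/-- A family of bijections, one for each C*-algebra `D` and each Hilbert `D`-module `F`, between the
representations of the C*-algebra `B` on `F` and the representations of `(G, α)` on `F`. -/
abbrev RepBijections (α : HaarSystem 𝒢) (B : Type u) [NonUnitalCStarAlgebra B] : Type (u + 1) :=
  ∀ (D : Type u) [NonUnitalCStarAlgebra D] (F : HilbertModule D), Rep B F ≃ GroupoidRepr α F

/-- Naturality for isometries: an isometry intertwines two representations of `B` if and only if it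
intertwines the corresponding representations of `(G, α)`. -/
def RepBijections.NaturalForIsometries {B : Type u} [NonUnitalCStarAlgebra B]
    (Φ : RepBijections α B) : Prop :=
  ∀ (D : Type u) [NonUnitalCStarAlgebra D] (F₁ F₂ : HilbertModule D) (V : Isometry F₁ F₂)
    (π₁ : Rep B F₁) (π₂ : Rep B F₂),
    Rep.Intertwines V π₁ π₂ ↔ GroupoidRepr.Intertwines V (Φ D F₁ π₁) (Φ D F₂ π₂)

/-- Naturality for induction along C*-correspondences `(E, ψ)` from `D` to `D'`. -/
def RepBijections.CompatibleWithInduction {B : Type u} [NonUnitalCStarAlgebra B]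
    (Φ : RepBijections α B) : Prop :=
  ∀ (D D' : Type u) [NonUnitalCStarAlgebra D] [NonUnitalCStarAlgebra D'] (F : HilbertModule D)
    (E : HilbertModule D') (ψ : Rep D E) (π : Rep B F),
    Φ D' (tensor F ψ.toStarRep) (π.tensor ψ.toStarRep) = (Φ D F π).induce ψ

end Main

end GroupoidRep

open GroupoidRep

/-!
Write `T_ξ x = ξ ⊗ x` for the creation operator of `ξ ∈ C_c(G¹)`; its adjoint is the annihilation
operator `T_ξ* (η ⊗ x) = φ(⟨ξ, η⟩) x`. These operators replace the study of `U` itself by that of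
its matrix coefficients.

*Integrated form.* As `U` is `C₀(G¹)`-linear, `T_η* U T_ξ` depends only on the product `conj η · ξ`,
and linearly so; it is `L(conj η · ξ)` for a linear map `L` from `C_c(G¹)` to operators on `F`
(`exists_coefficient`). The matrix coefficients of `d₁*(U)` are obtained from `L` by integration
along `d₁`, which is convolution, and those of `d₂*(U) d₀*(U)` are products `L(f₁) L(f₂)`, because
`G²` is the fibre product of two copies of `G¹` over `G⁰`. So the cocycle identity for `U` is
equivalent to `L(f₁ * f₂) = L(f₁) L(f₂)` (`cocycle_iff`). The square formed by `d₁` and `d₂` gives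
in the same way `L(f₁)* L(f₂) = L(f₁* * f₂)` (`inner_coefficient`), and then `L(f)* = L(f*)`.
Factoring `f = conj √|f| · (f / √|f|)` shows that `‖L(f)‖` is at most the `I`-norm of `f`. The norm
of `C*(G, α)` only involves Hilbert spaces, but by the Gelfand--Naimark--Segal construction it
dominates every C*-seminorm bounded by the `I`-norm (`le_maxSeminorm`), so `L` extends to a
representation `GroupoidRepr.integrate` of `C*(G, α)`. An isometry intertwines `L₁` and `L₂` if and
only if it intertwines the representations of `(G, α)`: it commutes with creation and annihilation
operators, which generate everything (`GroupoidRepr.intertwines_iff`). The identity isometry gives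
injectivity.

*Surjectivity.* Let `L` be the restriction of a representation of `C*(G, α)` to `C_c(G¹)`. Then
`φ(a) L(f) x = L((a ∘ r) f) x` defines `φ`. The vectors `ξ ⊗ L(f) x` span dense subspaces of both
`L²(G¹, s, α̃) ⊗ F` and `L²(G¹, r, α) ⊗ F`. Viewed as values of vectors `Θ k x`, at
`k = ξ(g) f(h)` in the first case and at `k = ξ(g) f(g h)` in the second, their inner products are
in both cases `⟨x, L(N(k, k')) y⟩` for the same form `N(k, k')(m) = ∫∫ conj k(g, h) k'(g, h m)` on
`C_c(G²)` (`convForm_boxTimes`, `convForm_boxComp`). By approximation `Θ` extends to all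
`k ∈ C_c(G²)` (`exists_vectors_of_form`), and `Θ k x ↦ Θ k x` is a unitary with matrix coefficients
`L` (`ConvRep.exists_U`). It satisfies the cocycle identity by `cocycle_iff`.

*Uniqueness.* Let `A` and `B` have the same representations. Let `ρ` be the representation of `B` on
the Hilbert module `A` that corresponds to left multiplication. As `A ⊗_π F ≅ F` for every
representation `π` of `A` on `F`, naturality shows that `π` corresponds to the representation
`b ↦ (π(a) x ↦ π(ρ(b) a) x)` (`RepEquiv.Natural.apply_leftMul`). Applied to `π = ρ` in the opposite
direction, this shows that `ρ(b)` is left multiplication by an element of `A`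
(`RepEquiv.Natural.exists_leftMul_eq`), which is the image of `b` under the isomorphism `B ≅ A`.
-/

set_option linter.unusedSectionVars false

namespace GroupoidRep

open scoped TensorProduct CompactlySupported ZeroAtInfty
open MeasureTheory Topology Filter

/-! ### Creation and annihilation operators on interior tensor products -/

section Creation

variable {A B D : Type u} [NonUnitalCStarAlgebra A] [NonUnitalCStarAlgebra B]
  [NonUnitalCStarAlgebra D]

/-- Inner products with a total family of vectors separate the vectors of a Hilbert module. -/
lemma HilbertModule.ext_inner_of_dense {E : HilbertModule D} {ι : Type*} (a : ι → E)
    (ha : Dense (Submodule.span ℂ (Set.range a) : Set E)) {x y : E}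
    (h : ∀ i, E.inner (a i) x = E.inner (a i) y) : x = y := by
  refine E.ext_inner fun z => ?_
  have hs : ∀ z ∈ Submodule.span ℂ (Set.range a), E.inner z x = E.inner z y := by
    intro z hz
    induction hz using Submodule.span_induction with
    | mem z hz => obtain ⟨i, rfl⟩ := hz; exact h i
    | zero => exact (E.pre.inner_zero_left x).trans (E.pre.inner_zero_left y).symm
    | add a b _ _ ha hb => rw [E.inner_add_left, E.inner_add_left, ha, hb]
    | smul c a _ ha => rw [E.inner_smul_left, E.inner_smul_left, ha]
  have hcl : IsClosed {z | E.inner z x = E.inner z y} :=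
    isClosed_eq (E.continuous_inner.comp (continuous_id.prodMk continuous_const))
      (E.continuous_inner.comp (continuous_id.prodMk continuous_const))
  exact hcl.closure_subset_iff.2 hs (ha z)

lemma HilbertModule.inner_sub_right (E : HilbertModule D) (x y z : E) :
    E.inner x (y - z) = E.inner x y - E.inner x z := E.pre.inner_sub_right x y z

lemma HilbertModule.inner_sub_left (E : HilbertModule D) (x y z : E) :
    E.inner (x - y) z = E.inner x z - E.inner y z := E.pre.inner_sub_left x y z

lemma HilbertModule.inner_sum_right (E : HilbertModule D) {ι : Type*} (s : Finset ι) (x : E)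
    (f : ι → E) : E.inner x (∑ i ∈ s, f i) = ∑ i ∈ s, E.inner x (f i) :=
  E.pre.inner_sum_right s x f

lemma HilbertModule.inner_sum_left (E : HilbertModule D) {ι : Type*} (s : Finset ι) (x : E)
    (f : ι → E) : E.inner (∑ i ∈ s, f i) x = ∑ i ∈ s, E.inner (f i) x :=
  E.pre.inner_sum_left s x f

lemma HilbertModule.continuous_inner_comp (E : HilbertModule D) {T : Type*} [TopologicalSpace T]
    {f g : T → E} (hf : Continuous f) (hg : Continuous g) :
    Continuous fun t => E.inner (f t) (g t) :=
  E.continuous_inner.comp (hf.prodMk hg)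

/-- The inner product, continuous and conjugate-linear in the first variable and linear in the
second. -/
noncomputable def HilbertModule.innerCLM (E : HilbertModule D) : E →L⋆[ℂ] E →L[ℂ] D :=
  LinearMap.mkContinuous₂ E.pre.innerₛₗ 1 fun x y => by
    rw [one_mul]; exact E.norm_inner_le x y

lemma StarRep.inner_apply {F : HilbertModule D} (φ : StarRep A F) (a : A) (x y : F) :
    F.inner x (φ a y) = F.inner (φ (star a) x) y := (φ.adjoint a x y).symm

lemma StarRep.inner_apply_left {F : HilbertModule D} (φ : StarRep A F) (a : A) (x y : F) :
    F.inner (φ a x) y = F.inner x (φ (star a) y) := by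
  rw [φ.inner_apply, star_star]

lemma Unitary.inner_symm_left {E F : HilbertModule D} (V : Unitary E F) (y : F) (x : E) :
    E.inner (V.symm y) x = F.inner y (V x) := by
  rw [← V.inner_map, V.apply_symm_apply]

/-- Two representations with the same operators are equal. -/
lemma Rep.ext_apply {F : HilbertModule D} {π ρ : Rep A F} (h : ∀ a x, π a x = ρ a x) : π = ρ := by
  rcases π with ⟨⟨f, hf⟩, hn⟩
  rcases ρ with ⟨⟨g, hg⟩, hm⟩
  have : f = g := by
    ext a x
    exact h a x
  subst this
  rfl

variable {E : HilbertModule B} {F : HilbertModule D} (φ : StarRep B F)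

/-- The creation operator `F → E ⊗_φ F`, `y ↦ e ⊗ y`. -/
noncomputable def create (e : E) : F →L[ℂ] tensor E φ :=
  (tmulR φ e).mkContinuous ‖e‖ fun y => norm_tmul_le' φ e y

/-- The interior tensor product is balanced over `B`. -/
lemma tmul_act (e : E) (b : B) (y : F) : tmul φ (E.act e b) y = tmul φ e (φ b y) := by
  refine HilbertModule.ext_inner_of_dense _ (dense_tmul φ) fun p => ?_
  rw [inner_tmul, inner_tmul, E.inner_act_right, map_mul]
  rfl

/-- The algebraic annihilation operator `x ⊗ y ↦ φ(⟨e, x⟩) y`. -/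
noncomputable def annihilateAux (e : E) : E ⊗[ℂ] F →ₗ[ℂ] F :=
  TensorProduct.lift (LinearMap.mk₂ ℂ (fun x y => φ (E.inner e x) y)
    (fun a b y => by rw [E.inner_add_right, map_add, _root_.add_apply])
    (fun c a y => by rw [E.inner_smul_right, map_smul, _root_.smul_apply])
    (fun a y z => by rw [map_add])
    (fun c a y => by rw [map_smul]))

lemma inner_annihilateAux (e : E) (y : F) (t : E ⊗[ℂ] F) :
    F.inner y (annihilateAux φ e t) = (tensor E φ).inner (tmul φ e y) (tensorMk φ t) := by
  induction t with
  | zero =>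
    rw [map_zero, map_zero]
    exact (F.pre.inner_zero_right y).trans ((tensor E φ).pre.inner_zero_right _).symm
  | add a b ha hb =>
    rw [map_add, map_add, F.inner_add_right, (tensor E φ).inner_add_right, ha, hb]
  | tmul x z =>
    exact (inner_tmul φ e x y z).symm

lemma norm_annihilateAux_le (e : E) (t : E ⊗[ℂ] F) :
    ‖annihilateAux φ e t‖ ≤ ‖e‖ * ‖tensorMk φ t‖ := by
  set z := annihilateAux φ e t with hz
  have h1 : ‖z‖ ^ 2 ≤ (‖e‖ * ‖z‖) * ‖tensorMk φ t‖ := by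
    rw [F.norm_sq]
    nth_rewrite 2 [hz]
    rw [inner_annihilateAux]
    refine ((tensor E φ).norm_inner_le _ _).trans ?_
    gcongr
    exact norm_tmul_le' φ e z
  by_cases h0 : ‖z‖ = 0
  · rw [h0]; positivity
  · have : 0 < ‖z‖ := lt_of_le_of_ne (norm_nonneg _) (Ne.symm h0)
    nlinarith

/-- The annihilation operator `E ⊗_φ F → F`, `x ⊗ y ↦ φ(⟨e, x⟩) y`, the adjoint of `create φ e`. -/
noncomputable def annihilate (e : E) : tensor E φ →L[ℂ] F :=
  (annihilateAux φ e).extendOfNorm (tensorMk φ)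

lemma annihilate_mk (e : E) (t : E ⊗[ℂ] F) :
    annihilate φ e (tensorMk φ t) = annihilateAux φ e t :=
  LinearMap.extendOfNorm_eq (preTensor E φ).dense_toCompletion
    ⟨‖e‖, norm_annihilateAux_le φ e⟩ t

lemma annihilate_tmul (e x : E) (y : F) : annihilate φ e (tmul φ x y) = φ (E.inner e x) y :=
  annihilate_mk φ e (x ⊗ₜ y)

lemma inner_annihilate (e : E) (y : F) (t : tensor E φ) :
    F.inner y (annihilate φ e t) = (tensor E φ).inner (tmul φ e y) t := by
  refine (preTensor E φ).dense_toCompletion.induction_on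
    (p := fun t => F.inner y (annihilate φ e t) = (tensor E φ).inner (tmul φ e y) t) t ?_ ?_
  · exact isClosed_eq (F.continuous_inner_comp continuous_const (annihilate φ e).continuous)
      ((tensor E φ).continuous_inner_comp continuous_const continuous_id)
  · intro t
    refine Eq.trans ?_ (inner_annihilateAux φ e y t)
    rw [← annihilate_mk]
    rfl

lemma inner_annihilate_left (e : E) (t : tensor E φ) (y : F) :
    F.inner (annihilate φ e t) y = (tensor E φ).inner t (tmul φ e y) := by
  rw [← F.star_inner, inner_annihilate, (tensor E φ).star_inner]

lemma norm_annihilate_le (e : E) (t : tensor E φ) : ‖annihilate φ e t‖ ≤ ‖e‖ * ‖t‖ := by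
  refine (preTensor E φ).dense_toCompletion.induction_on
    (p := fun t => ‖annihilate φ e t‖ ≤ ‖e‖ * ‖t‖) t ?_ ?_
  · exact isClosed_le (annihilate φ e).continuous.norm (continuous_norm.const_mul _)
  · intro t
    have := norm_annihilateAux_le φ e t
    rw [← annihilate_mk] at this
    exact this

lemma annihilate_add (e e' : E) (t : tensor E φ) :
    annihilate φ (e + e') t = annihilate φ e t + annihilate φ e' t := by
  refine F.ext_inner fun y => ?_
  rw [F.inner_add_right, inner_annihilate, inner_annihilate, inner_annihilate, tmul_add_left,
    (tensor E φ).inner_add_left]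

/-- Two vectors in `E ⊗_φ F` are equal if all annihilation operators agree on them. -/
lemma ext_annihilate {ι : Type*} (a : ι → E)
    (ha : Dense (Submodule.span ℂ (Set.range a) : Set E)) {t t' : tensor E φ}
    (h : ∀ i, annihilate φ (a i) t = annihilate φ (a i) t') : t = t' := by
  refine HilbertModule.ext_inner_of_dense _ (dense_tmul_of_dense φ a (id : F → F) ha (by simp))
    fun p => ?_
  rw [← inner_annihilate, ← inner_annihilate, h]

/-- The creation operators are `A`-linear, in adjoint form. -/
lemma annihilate_rep (ρ : StarRep A E) (a : A) (e : E) (t : tensor E φ) :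
    annihilate φ (ρ a e) t = annihilate φ e (ρ.tensor φ (star a) t) := by
  refine F.ext_inner fun y => ?_
  rw [inner_annihilate, inner_annihilate, ← StarRep.tensor_tmul, StarRep.inner_apply_left]

/-- Annihilation operators turn the action of `B` on `F` into the right action on `E`. -/
lemma rep_annihilate (b : B) (e : E) (t : tensor E φ) :
    φ b (annihilate φ e t) = annihilate φ (E.act e (star b)) t := by
  refine F.ext_inner fun y => ?_
  rw [StarRep.inner_apply, inner_annihilate, inner_annihilate, tmul_act]

/-- Isometries of the second factor commute with annihilation operators. -/
lemma Isometry.map_annihilate {F₁ F₂ : HilbertModule D} (φ₁ : StarRep B F₁) (φ₂ : StarRep B F₂)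
    (V : Isometry F₁ F₂) (hV : ∀ b x, V (φ₁ b x) = φ₂ b (V x)) (e : E) (t : tensor E φ₁) :
    V (annihilate φ₁ e t) = annihilate φ₂ e (V.lTensor E φ₁ φ₂ hV t) := by
  refine eq_of_generators (E := tensor E φ₁) (F := F₂)
    (S := V.toLI.toContinuousLinearMap.comp (annihilate φ₁ e))
    (T := (annihilate φ₂ e).comp (V.lTensor E φ₁ φ₂ hV).toLI.toContinuousLinearMap)
    (fun p : E × F₁ => tmul φ₁ p.1 p.2) (dense_tmul φ₁) (fun p => ?_) t
  change V (annihilate φ₁ e (tmul φ₁ p.1 p.2))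
    = annihilate φ₂ e (V.lTensor E φ₁ φ₂ hV (tmul φ₁ p.1 p.2))
  rw [annihilate_tmul, Isometry.lTensor_tmul, annihilate_tmul, hV]

/-- Annihilation operators are compatible with the associativity isomorphism. -/
lemma annihilate_tensorAssoc {M : HilbertModule A} {F : HilbertModule B} {E : HilbertModule D}
    (φ : StarRep A F) (ψ : StarRep B E) (m : M) (t : tensor M φ) (z : E) :
    annihilate (φ.tensor ψ) m (tensorAssoc M φ ψ (tmul ψ t z)) = tmul ψ (annihilate φ m t) z := by
  refine eq_of_generators (E := tensor M φ) (F := tensor F ψ)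
    (S := (annihilate (φ.tensor ψ) m).comp ((tensorAssoc M φ ψ).toCLM.comp
      ⟨tmulL ψ z, continuous_tmul_left ψ z⟩))
    (T := ContinuousLinearMap.comp ⟨tmulL ψ z, continuous_tmul_left ψ z⟩ (annihilate φ m))
    (fun p : M × F => tmul φ p.1 p.2) (dense_tmul φ) (fun p => ?_) t
  change annihilate (φ.tensor ψ) m (tensorAssoc M φ ψ (tmul ψ (tmul φ p.1 p.2) z))
    = tmul ψ (annihilate φ m (tmul φ p.1 p.2)) z
  rw [tensorAssoc_tmul, annihilate_tmul, annihilate_tmul, StarRep.tensor_tmul]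

end Creation

/-! ### Domination and approximation of compactly supported functions -/

section Domination

variable {X Y Z W : Type u} [TopologicalSpace X] [TopologicalSpace Y] [TopologicalSpace Z]
  [TopologicalSpace W]

/-- `Dominates η ξ` says that `η` is real-valued with `|ξ| ≤ η` pointwise. -/
def Dominates (η ξ : C_c(X, ℂ)) : Prop := ∀ x, ∃ t : ℝ, ‖ξ x‖ ≤ t ∧ η x = t

lemma IntegrationMap.nonneg_of_nonneg {f : C(X, Y)} (I : IntegrationMap f) {ζ : C_c(X, ℂ)}
    (h : ∀ x, ∃ t : ℝ, 0 ≤ t ∧ ζ x = t) (y : Y) : ∃ t : ℝ, 0 ≤ t ∧ I ζ y = t := by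
  obtain ⟨η, rfl⟩ := exists_sqrt ζ h
  exact I.nonneg η y

/-- Integration against a family of positive measures preserves domination. -/
lemma Dominates.integrate {f : C(X, Y)} (I : IntegrationMap f) {η ξ : C_c(X, ℂ)}
    (h : Dominates η ξ) : Dominates (I η) (I ξ) := by
  intro y
  obtain ⟨T, hT0, hT⟩ := I.nonneg_of_nonneg (ζ := η) (fun x => by
    obtain ⟨t, ht, hx⟩ := h x
    exact ⟨t, (norm_nonneg _).trans ht, hx⟩) y
  refine ⟨T, ?_, hT⟩
  obtain ⟨θ, hθ, hθ'⟩ : ∃ θ : ℂ, ‖θ‖ = 1 ∧ θ * I ξ y = (‖I ξ y‖ : ℂ) := by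
    by_cases h0 : I ξ y = 0
    · exact ⟨1, by simp, by simp [h0]⟩
    · have hn : (‖I ξ y‖ : ℂ) ≠ 0 := by simpa using h0
      refine ⟨star (I ξ y) / ‖I ξ y‖, ?_, ?_⟩
      · rw [norm_div, norm_star, Complex.norm_real, norm_norm, div_self (by simpa using h0)]
      · rw [div_mul_eq_mul_div, RCLike.star_def, Complex.conj_mul', sq, mul_div_assoc,
          div_self hn, mul_one]
  -- `η - Re (θ ξ)` is a nonnegative function
  obtain ⟨t, ht0, ht⟩ := I.nonneg_of_nonneg
    (ζ := η - (2⁻¹ : ℂ) • (θ • ξ + star (θ • ξ))) (fun x => by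
      obtain ⟨t, ht, hx⟩ := h x
      refine ⟨t - (θ * ξ x).re, ?_, ?_⟩
      · have h1 := (Complex.re_le_norm (θ * ξ x))
        rw [norm_mul, hθ, one_mul] at h1
        linarith
      · simp only [CompactlySupportedContinuousMap.sub_apply,
          CompactlySupportedContinuousMap.smul_apply, CompactlySupportedContinuousMap.add_apply,
          CompactlySupportedContinuousMap.star_apply, smul_eq_mul, hx, RCLike.star_def]
        rw [Complex.add_conj]
        push_cast
        ring) y
  have h2 : I (η - (2⁻¹ : ℂ) • (θ • ξ + star (θ • ξ))) y = (T - ‖I ξ y‖ : ℝ) := by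
    rw [map_sub, map_smul, map_add, I.map_star, map_smul]
    simp only [CompactlySupportedContinuousMap.sub_apply,
      CompactlySupportedContinuousMap.smul_apply, CompactlySupportedContinuousMap.add_apply,
      CompactlySupportedContinuousMap.star_apply, smul_eq_mul, hT, RCLike.star_def, hθ']
    rw [Complex.conj_ofReal]
    push_cast
    ring
  rw [h2] at ht
  have := Complex.ofReal_injective ht
  linarith

lemma Dominates.mul {η ξ η' ξ' : C_c(X, ℂ)} (h : Dominates η ξ) (h' : Dominates η' ξ') :
    Dominates (η * η') (ξ * ξ') := by
  intro x
  obtain ⟨t, ht, hx⟩ := h x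
  obtain ⟨t', ht', hx'⟩ := h' x
  refine ⟨t * t', ?_, by simp [hx, hx']⟩
  rw [CompactlySupportedContinuousMap.mul_apply, norm_mul]
  exact mul_le_mul ht ht' (norm_nonneg _) ((norm_nonneg _).trans ht)

lemma Dominates.star {η ξ : C_c(X, ℂ)} (h : Dominates η ξ) : Dominates (star η) (star ξ) := by
  intro x
  obtain ⟨t, ht, hx⟩ := h x
  exact ⟨t, by simpa using ht, by simp [hx]⟩

lemma Dominates.sub {η ξ η' ξ' : C_c(X, ℂ)} (h : Dominates η ξ) (h' : Dominates η' ξ') :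
    Dominates (η + η') (ξ - ξ') := by
  intro x
  obtain ⟨t, ht, hx⟩ := h x
  obtain ⟨t', ht', hx'⟩ := h' x
  refine ⟨t + t', ?_, by simp [hx, hx']⟩
  exact (norm_sub_le _ _).trans (add_le_add ht ht')

lemma Dominates.norm_le {η ξ : C_c(X, ℂ)} (h : Dominates η ξ) (x : X) : ‖ξ x‖ ≤ ‖η x‖ := by
  obtain ⟨t, ht, hx⟩ := h x
  rw [hx, Complex.norm_real]
  exact ht.trans (le_abs_self t)

lemma Dominates.comp {e : X → Y} {η ξ : C_c(Y, ℂ)} (h : Dominates η ξ) {η' ξ' : C_c(X, ℂ)}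
    (hη : ∀ x, η' x = η (e x)) (hξ : ∀ x, ξ' x = ξ (e x)) : Dominates η' ξ' := by
  intro x
  rw [hη, hξ]
  exact h (e x)

lemma toC₀_smul_eq_mul (g e : C_c(X, ℂ)) : toC₀ g • e = g * e := rfl

lemma norm_toC₀_le (ξ : C_c(X, ℂ)) {M : ℝ} (hM : 0 ≤ M) (h : ∀ x, ‖ξ x‖ ≤ M) :
    ‖toC₀ ξ‖ ≤ M := by
  rw [← ZeroAtInftyContinuousMap.norm_toBCF_eq_norm]
  exact (BoundedContinuousFunction.norm_le hM).2 h

lemma norm_apply_le_norm_toC₀ (ξ : C_c(X, ℂ)) (x : X) : ‖ξ x‖ ≤ ‖toC₀ ξ‖ := by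
  rw [← ZeroAtInftyContinuousMap.norm_toBCF_eq_norm]
  exact BoundedContinuousFunction.norm_coe_le_norm (toC₀ ξ).toBCF x

lemma Dominates.norm_toC₀_le {η ξ : C_c(X, ℂ)} (h : Dominates η ξ) : ‖toC₀ ξ‖ ≤ ‖toC₀ η‖ :=
  GroupoidRep.norm_toC₀_le ξ (norm_nonneg _) fun x =>
    (h.norm_le x).trans (norm_apply_le_norm_toC₀ η x)

lemma IntegrationMap.norm_cls_sq {f : C(X, Y)} (I : IntegrationMap f) (ξ : C_c(X, ℂ)) :
    ‖I.cls ξ‖ ^ 2 = ‖toC₀ (I (star ξ * ξ))‖ := by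
  rw [I.L2.norm_sq, I.inner_cls]

lemma Dominates.norm_cls_le {f : C(X, Y)} (I : IntegrationMap f) {η ξ : C_c(X, ℂ)}
    (h : Dominates η ξ) : ‖I.cls ξ‖ ≤ ‖I.cls η‖ := by
  refine le_of_sq_le_sq ?_ (norm_nonneg _)
  rw [I.norm_cls_sq, I.norm_cls_sq]
  exact ((h.star.mul h).integrate I).norm_toC₀_le

/-- A cut-off function with values in `[0, 1]` that is `1` on a compact set. -/
lemma exists_unit_bump [T2Space X] [LocallyCompactSpace X] {K : Set X} (hK : IsCompact K) :
    ∃ χ : C_c(X, ℂ), (∀ x ∈ K, χ x = 1) ∧ ∀ x, ∃ t : ℝ, 0 ≤ t ∧ t ≤ 1 ∧ χ x = t := by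
  obtain ⟨g, hg1, -, hg, hg2⟩ := exists_continuous_one_zero_of_isCompact (s := K) (t := ∅)
    hK isClosed_empty (Set.disjoint_empty _)
  refine ⟨⟨⟨fun x => (g x : ℂ), by fun_prop⟩, hg.comp_left Complex.ofReal_zero⟩, fun x hx => ?_,
    fun x => ⟨g x, (hg2 x).1, (hg2 x).2, rfl⟩⟩
  have := hg1 hx
  simp_all

/-- A function in `C_c(Y)` that is `1` on the images of the supports of two functions on `X`. -/
lemma exists_unit_comp₂ [T2Space Y] [LocallyCompactSpace Y] (f : C(X, Y)) (ξ ξ' : C_c(X, ℂ)) :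
    ∃ η : C_c(Y, ℂ), (∀ x, ξ x ≠ 0 → η (f x) = 1) ∧ (∀ x, ξ' x ≠ 0 → η (f x) = 1) := by
  obtain ⟨η, hη⟩ := exists_bump ((ξ.hasCompactSupport'.isCompact.image f.continuous).union
    (ξ'.hasCompactSupport'.isCompact.image f.continuous))
  exact ⟨η, fun x hx => hη _ (Or.inl ⟨x, subset_tsupport _ hx, rfl⟩),
    fun x hx => hη _ (Or.inr ⟨x, subset_tsupport _ hx, rfl⟩)⟩

/-- The function `(w, x) ↦ u(w) v(x)` on a fibre product. -/
noncomputable def fiberBox [T2Space Y] [T2Space W] [T2Space X] (b : C(W, Y)) (p : C(X, Y))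
    (u : C_c(W, ℂ)) (v : C_c(X, ℂ)) : C_c(FiberProduct b p, ℂ) where
  toFun q := u q.1.1 * v q.1.2
  continuous_toFun := by
    have := u.continuous
    have := v.continuous
    fun_prop
  hasCompactSupport' := by
    have hK := (u.hasCompactSupport'.isCompact.prod v.hasCompactSupport'.isCompact)
    refine HasCompactSupport.intro
      ((isClosedEmbedding_fiberProduct b p).isCompact_preimage hK) fun q hq => ?_
    by_contra h
    refine hq ⟨?_, ?_⟩
    · exact subset_tsupport _ fun h' => h (by rw [show u q.1.1 = 0 from h', zero_mul])
    · exact subset_tsupport _ fun h' => h (by rw [show v q.1.2 = 0 from h', mul_zero])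

lemma fiberBox_apply [T2Space Y] [T2Space W] [T2Space X] (b : C(W, Y)) (p : C(X, Y))
    (u : C_c(W, ℂ)) (v : C_c(X, ℂ)) (q : FiberProduct b p) :
    fiberBox b p u v q = u q.1.1 * v q.1.2 := rfl

/-- A compactly supported function on a fibre product is a limit of finite sums of products
`u(w) v(x)`, uniformly and with a common bound `a(w) c(x)` on the supports: cut the function along
a partition of unity in the variable `w`. -/
lemma exists_box_approx [T2Space Y] [T2Space W] [T2Space X] [LocallyCompactSpace W]
    [LocallyCompactSpace X] (b : C(W, Y)) (p : C(X, Y)) (k : C_c(FiberProduct b p, ℂ)) :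
    ∃ (a : C_c(W, ℂ)) (c : C_c(X, ℂ)), Dominates (fiberBox b p a c) k ∧
      ∀ ε : ℝ, 0 < ε → ∃ (n : ℕ) (u : Fin n → C_c(W, ℂ)) (v : Fin n → C_c(X, ℂ)),
        Dominates ((ε : ℂ) • fiberBox b p a c) (k - ∑ i, fiberBox b p (u i) (v i)) := by
  obtain ⟨K, hK⟩ := exists_extension (isClosedEmbedding_fiberProduct b p) k
  have hC := K.hasCompactSupport'.isCompact
  have hC₂ := hC.image continuous_snd
  obtain ⟨a₀, ha₀, ha₀'⟩ := exists_unit_bump (hC.image continuous_fst)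
  obtain ⟨c, hc, hc'⟩ := exists_unit_bump hC₂
  obtain ⟨M, hM⟩ := (K.continuous.norm.bddAbove_range_of_hasCompactSupport
    (K.hasCompactSupport'.norm))
  set N : ℝ := max M 1 with hN
  have hN1 : 1 ≤ N := le_max_right _ _
  have hK0 : ∀ w x, x ∉ Prod.snd '' tsupport K → K (w, x) = 0 := fun w x hx =>
    image_eq_zero_of_notMem_tsupport fun h => hx ⟨_, h, rfl⟩
  have hKa : ∀ w x, a₀ w ≠ 1 → K (w, x) = 0 := fun w x hx =>
    image_eq_zero_of_notMem_tsupport fun h => hx (ha₀ w ⟨_, h, rfl⟩)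
  have hKb : ∀ q, ‖K q‖ ≤ N := fun q => (hM ⟨q, rfl⟩).trans (le_max_left _ _)
  refine ⟨(N : ℂ) • a₀, c, ?_, ?_⟩
  · intro q
    obtain ⟨t, ht0, ht1, ht⟩ := ha₀' q.1.1
    obtain ⟨t', ht0', ht1', ht'⟩ := hc' q.1.2
    refine ⟨N * t * t', ?_, by simp [fiberBox_apply, ht, ht']⟩
    rw [← hK]
    by_cases h0 : K q.1 = 0
    · rw [h0, norm_zero]; positivity
    · have e1 : a₀ q.1.1 = 1 := by by_contra h; exact h0 (hKa _ _ h)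
      have e2 : c q.1.2 = 1 := hc _ (by by_contra h; exact h0 (hK0 _ _ h))
      rw [ht] at e1
      rw [ht'] at e2
      rw [Complex.ofReal_eq_one.1 e1, Complex.ofReal_eq_one.1 e2, mul_one, mul_one]
      exact hKb _
  · intro ε hε
    -- near `w₀` the extension `K` of `k` is uniformly close to `K(w₀, ·)`
    have hV : ∀ w₀ : W, ∃ V : Set W, IsOpen V ∧ w₀ ∈ V ∧
        ∀ w ∈ V, ∀ x ∈ Prod.snd '' tsupport K, ‖K (w, x) - K (w₀, x)‖ < ε := by
      intro w₀
      have e2 : ∀ᶠ w in 𝓝 w₀, ∀ x ∈ Prod.snd '' tsupport K, ‖K (w, x) - K (w₀, x)‖ < ε := by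
        refine hC₂.eventually_forall_of_forall_eventually fun x _ => ?_
        have hc : Continuous fun z : W × X => ‖K z - K (w₀, z.2)‖ := by
          have := K.continuous
          fun_prop
        refine hc.continuousAt.eventually_lt_const ?_
        simp only [sub_self, norm_zero]
        exact hε
      obtain ⟨V, hV, hVo, hw⟩ := eventually_nhds_iff.1 e2
      exact ⟨V, hVo, hw, hV⟩
    choose V hVo hwV hV using hV
    obtain ⟨s, hs⟩ := (a₀.hasCompactSupport'.isCompact).elim_finite_subcover V hVo
      (fun w _ => Set.mem_iUnion.2 ⟨w, hwV w⟩)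
    let e := s.equivFin.symm
    obtain ⟨ρ, hρV, hρ1, hρ01, hρc⟩ := exists_continuous_sum_one_of_isOpen_isCompact
      (s := fun i : Fin s.card => V (e i)) (fun i => hVo _) a₀.hasCompactSupport'.isCompact (by
        intro w hw
        obtain ⟨w₀, hw₀, h⟩ := Set.mem_iUnion₂.1 (hs hw)
        exact Set.mem_iUnion.2 ⟨s.equivFin ⟨w₀, hw₀⟩, by simpa [e] using h⟩)
    let ρ' : Fin s.card → C(W, ℂ) := fun i => ⟨fun w => (ρ i w : ℂ), by fun_prop⟩
    refine ⟨s.card, fun i => ρ' i • a₀, fun i => FiberMeasures.slice K (e i), ?_⟩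
    intro q
    obtain ⟨w, x⟩ := q.1
    obtain ⟨⟨w, x⟩, hq⟩ := q
    obtain ⟨t, ht0, ht1, ht⟩ := ha₀' w
    obtain ⟨t', ht0', ht1', ht'⟩ := hc' x
    refine ⟨ε * (N * t * t'), ?_, by simp [fiberBox_apply, ht, ht']⟩
    have hsum : (k - ∑ i, fiberBox b p (ρ' i • a₀) (FiberMeasures.slice K (e i))) ⟨(w, x), hq⟩
        = K (w, x) - ∑ i, (ρ i w : ℂ) * t * K (e i, x) := by
      rw [CompactlySupportedContinuousMap.sub_apply, CompactlySupportedContinuousMap.sum_apply,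
        ← hK]
      congr 1
      refine Finset.sum_congr rfl fun i _ => ?_
      rw [← ht]
      rfl
    rw [hsum]
    by_cases hx : x ∈ Prod.snd '' tsupport K
    · have e2 : c x = 1 := hc _ hx
      rw [ht'] at e2
      rw [Complex.ofReal_eq_one.1 e2, mul_one]
      by_cases hw : w ∈ tsupport a₀
      · have h1 : ∑ i, ρ i w = 1 := by simpa using hρ1 hw
        have hKt : K (w, x) = t * K (w, x) := by
          by_cases h : a₀ w = 1
          · rw [← ht, h, one_mul]
          · rw [hKa w x h, mul_zero]
        have h2 : K (w, x) - ∑ i, (ρ i w : ℂ) * t * K (e i, x)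
            = ∑ i, (ρ i w : ℂ) * t * (K (w, x) - K (e i, x)) := by
          simp only [mul_sub, Finset.sum_sub_distrib]
          congr 1
          rw [← Finset.sum_mul, ← Finset.sum_mul, ← Complex.ofReal_sum, h1, Complex.ofReal_one,
            one_mul]
          exact hKt
        rw [h2]
        calc ‖∑ i, (ρ i w : ℂ) * t * (K (w, x) - K (e i, x))‖
            ≤ ∑ i, ρ i w * (t * ε) := by
              refine norm_sum_le_of_le _ fun i _ => ?_
              rw [norm_mul, norm_mul, Complex.norm_real, Complex.norm_real,
                Real.norm_of_nonneg (hρ01 i w).1, Real.norm_of_nonneg ht0, mul_assoc]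
              by_cases hi : ρ i w = 0
              · rw [hi, zero_mul, zero_mul]
              · have := hV _ w (hρV i (subset_tsupport _ hi)) x hx
                have h0 := (hρ01 i w).1
                gcongr
          _ = ε * t := by rw [← Finset.sum_mul, h1]; ring
          _ ≤ ε * (N * t) := by
              have : t ≤ N * t := le_mul_of_one_le_left ht0 hN1
              gcongr
      · have h1 : (t : ℂ) = 0 := ht ▸ image_eq_zero_of_notMem_tsupport hw
        have h3 : K (w, x) = 0 := hKa w x (by rw [ht, h1]; simp)
        simp only [h1, h3, mul_zero, zero_mul, Finset.sum_const_zero, sub_zero, norm_zero]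
        positivity
    · simp only [hK0 _ x hx, mul_zero, Finset.sum_const_zero, sub_zero, norm_zero]
      positivity

/-- Products `u(w) v(x)` are total in the Hilbert module of any family of measures on a fibre
product. -/
lemma dense_cls_fiberBox [T2Space Y] [T2Space W] [T2Space X] [LocallyCompactSpace W]
    [LocallyCompactSpace X] {b : C(W, Y)} {p : C(X, Y)} {h : C(FiberProduct b p, Z)}
    (K : IntegrationMap h) :
    Dense (Submodule.span ℂ (Set.range fun q : C_c(W, ℂ) × C_c(X, ℂ) =>
      K.cls (fiberBox b p q.1 q.2)) : Set K.L2) := by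
  set S := Submodule.span ℂ (Set.range fun q : C_c(W, ℂ) × C_c(X, ℂ) =>
      K.cls (fiberBox b p q.1 q.2)) with hS
  have h1 : Submodule.span ℂ (Set.range K.cls) ≤ S.topologicalClosure := by
    rw [Submodule.span_le]
    rintro _ ⟨k, rfl⟩
    obtain ⟨a, c, -, happ⟩ := exists_box_approx b p k
    rw [SetLike.mem_coe, ← SetLike.mem_coe, Submodule.topologicalClosure_coe,
      Metric.mem_closure_iff]
    intro ε hε
    set N := ‖K.cls (fiberBox b p a c)‖ with hN
    obtain ⟨n, u, v, hd⟩ := happ (ε / (N + 1)) (by positivity)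
    refine ⟨K.cls (∑ i, fiberBox b p (u i) (v i)), ?_, ?_⟩
    · rw [map_sum]
      exact Submodule.sum_mem _ fun i _ => Submodule.subset_span ⟨(u i, v i), rfl⟩
    · rw [dist_eq_norm, ← map_sub]
      refine (hd.norm_cls_le K).trans_lt ?_
      rw [map_smul, norm_smul, Complex.norm_real, Real.norm_of_nonneg (by positivity), ← hN,
        div_mul_eq_mul_div, div_lt_iff₀ (by positivity)]
      nlinarith [norm_nonneg (K.cls (fiberBox b p a c))]
  have h4 : Dense (S.topologicalClosure : Set K.L2) := K.dense_cls.mono h1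
  rw [Submodule.topologicalClosure_coe] at h4
  exact dense_closure.1 h4

end Domination

/-! ### Matrix coefficients of pull-backs -/

section Coefficients

variable {X Y Y' Z : Type u} [TopologicalSpace X] [TopologicalSpace Y] [TopologicalSpace Y']
  [TopologicalSpace Z]
  [T2Space Y] [LocallyCompactSpace Y] [T2Space Y'] [LocallyCompactSpace Y']
  {D : Type u} [NonUnitalCStarAlgebra D] {F : HilbertModule D}

/-- The operator `T_η* U T_ξ` only depends on the product `conj η · ξ`; it is called `L(conj η · ξ)`
here.  The matrix coefficients of the pull-back `d*(U)` are obtained from `L` by integration along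
`d`. -/
lemma inner_pullback {d : C(X, Y)} {g₁ g₂ : C(Y, Z)} {h₁ h₂ : C(X, Z)} (I : IntegrationMap d)
    (J₁ : IntegrationMap g₁) (J₂ : IntegrationMap g₂)
    (K₁ : IntegrationMap h₁) (K₂ : IntegrationMap h₂)
    (hK₁ : ∀ ξ, K₁ ξ = J₁ (I ξ)) (hK₂ : ∀ ξ, K₂ ξ = J₂ (I ξ)) (φ : StarRep C₀(Z, ℂ) F)
    (U : Unitary (tensor J₁.L2 φ) (tensor J₂.L2 φ))
    (hU : ∀ a x, U (J₁.mulRep.tensor φ a x) = J₂.mulRep.tensor φ a (U x))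
    (L : C_c(Y, ℂ) → F →L[ℂ] F)
    (hL : ∀ η ξ x, annihilate φ (J₂.cls η) (U (tmul φ (J₁.cls ξ) x)) = L (star η * ξ) x)
    (C C' : C_c(X, ℂ)) (x y : F) :
    (tensor K₂.L2 φ).inner (tmul φ (K₂.cls C') y)
        (pullback I J₁ J₂ K₁ K₂ hK₁ hK₂ φ U hU (tmul φ (K₁.cls C) x))
      = F.inner y (L (I (star C' * C)) x) := by
  -- multiplying by `e ∘ d` does not change `C` and `C'`, so that `C ⊗ e ⊗ x` becomes `C ⊗ x`
  obtain ⟨e, he, he'⟩ := exists_unit_comp₂ d C C'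
  have e1 : (e.toContinuousMap.comp d) • C = C := by
    ext q
    by_cases hq : C q = 0
    · simp [hq]
    · simp [he q hq]
  have e2 : (e.toContinuousMap.comp d) • C' = C' := by
    ext q
    by_cases hq : C' q = 0
    · simp [hq]
    · simp [he' q hq]
  have e3 : star e * (I (star C' * C) * e) = I (star C' * C) := by
    have : star e * (I (star C' * C) * e)
        = (star e * e).toContinuousMap • I (star C' * C) := by
      ext q
      simp
      ring
    rw [this, ← I.map_smul_comp]
    congr 1
    ext q
    by_cases hq : C q = 0
    · simp [hq]
    · simp [he q hq]
  have h1 := canon_tmul I J₁ K₁ hK₁ φ C e x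
  have h2 := canon_tmul I J₂ K₂ hK₂ φ C' e y
  rw [e1] at h1
  rw [e2] at h2
  rw [← h1, ← h2, pullback, Unitary.trans_apply, Unitary.trans_apply, Unitary.symm_apply_apply,
    Unitary.lTensor_tmul, Isometry.inner_map, inner_tmul, I.inner_cls, ← hU, StarRep.tensor_tmul,
    J₁.mulRep_cls, toC₀_smul_eq_mul, ← inner_annihilate, hL, e3]

/-- Inner products between vectors that come from the two sides of a fibre square
`X = Y ×_Z Y'` whose family of measures is the product family. -/
lemma inner_canon_canon {da : C(X, Y)} {db : C(X, Y')} {ga : C(Y, Z)} {gb : C(Y', Z)}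
    {h : C(X, Z)} (Ia : IntegrationMap da) (Ib : IntegrationMap db)
    (Ja : IntegrationMap ga) (Jb : IntegrationMap gb) (K : IntegrationMap h)
    (hKa : ∀ ξ, K ξ = Ja (Ia ξ)) (hKb : ∀ ξ, K ξ = Jb (Ib ξ)) (φ : StarRep C₀(Z, ℂ) F)
    (hK : ∀ (b₁ : C_c(Y, ℂ)) (b₂ : C_c(Y', ℂ)) (ζ : C_c(X, ℂ)),
      (∀ x, ζ x = b₁ (da x) * b₂ (db x)) → K ζ = Ja b₁ * Jb b₂)
    (A₁ A₂ : C_c(X, ℂ)) (a₁ : C_c(Y, ℂ)) (a₂ : C_c(Y', ℂ))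
    (hA : ∀ x, star (A₁ x) * A₂ x = a₁ (da x) * a₂ (db x))
    (p : tensor Ja.L2 φ) (q : tensor Jb.L2 φ) :
    (tensor K.L2 φ).inner
        (IntegrationMap.canon Ia Ja K hKa φ (tmul (Ja.mulRep.tensor φ) (Ia.cls A₁) p))
        (IntegrationMap.canon Ib Jb K hKb φ (tmul (Jb.mulRep.tensor φ) (Ib.cls A₂) q))
      = F.inner (annihilate φ (Ja.cls a₁) p) (annihilate φ (Jb.cls (star a₂)) q) := by
  let S : tensor Ja.L2 φ →L[ℂ] tensor K.L2 φ :=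
    (IntegrationMap.canon Ia Ja K hKa φ).toCLM.comp (create (Ja.mulRep.tensor φ) (Ia.cls A₁))
  let T : tensor Jb.L2 φ →L[ℂ] tensor K.L2 φ :=
    (IntegrationMap.canon Ib Jb K hKb φ).toCLM.comp (create (Jb.mulRep.tensor φ) (Ib.cls A₂))
  change (tensor K.L2 φ).inner (S p) (T q) = _
  -- both sides are continuous, so elementary tensors `c ⊗ y` and `c' ⊗ x` suffice
  have base : ∀ (c : C_c(Y, ℂ)) (y : F) (c' : C_c(Y', ℂ)) (x : F),
      (tensor K.L2 φ).inner (S (tmul φ (Ja.cls c) y)) (T (tmul φ (Jb.cls c') x))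
        = F.inner (annihilate φ (Ja.cls a₁) (tmul φ (Ja.cls c) y))
          (annihilate φ (Jb.cls (star a₂)) (tmul φ (Jb.cls c') x)) := by
    intro c y c' x
    change (tensor K.L2 φ).inner
      (IntegrationMap.canon Ia Ja K hKa φ (tmul _ (Ia.cls A₁) (tmul φ (Ja.cls c) y)))
      (IntegrationMap.canon Ib Jb K hKb φ (tmul _ (Ib.cls A₂) (tmul φ (Jb.cls c') x))) = _
    rw [canon_tmul, canon_tmul, inner_tmul, K.inner_cls, annihilate_tmul, annihilate_tmul,
      StarRep.inner_apply_left, Ja.L2.star_inner, Ja.inner_cls, Jb.inner_cls]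
    have e : K (star ((c.toContinuousMap.comp da) • A₁) * ((c'.toContinuousMap.comp db) • A₂))
        = Ja (star c * a₁) * Jb (a₂ * c') := hK _ _ _ fun z => by
      have := hA z
      simp only [CompactlySupportedContinuousMap.mul_apply,
        CompactlySupportedContinuousMap.star_apply, CompactlySupportedContinuousMap.smulc_apply,
        ContinuousMap.comp_apply, smul_eq_mul, star_mul'] at this ⊢
      calc _ = star (c (da z)) * (star (A₁ z) * A₂ z) * c' (db z) := by
            simp only [CompactlySupportedContinuousMap.coe_toContinuousMap]; ring
        _ = _ := by rw [this]; ring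
    rw [e, star_star]
    change F.inner y (φ (toC₀ (Ja (star c * a₁)) * toC₀ (Jb (a₂ * c'))) x) = _
    rw [map_mul]
    rfl
  have step : ∀ (c : C_c(Y, ℂ)) (y : F) (q : tensor Jb.L2 φ),
      (tensor K.L2 φ).inner (S (tmul φ (Ja.cls c) y)) (T q)
        = F.inner (annihilate φ (Ja.cls a₁) (tmul φ (Ja.cls c) y))
          (annihilate φ (Jb.cls (star a₂)) q) := by
    intro c y q
    have := ContinuousLinearMap.ext_on (dense_tmul_of_dense φ (fun ξ => Jb.cls ξ) (id : F → F)
      Jb.dense_cls (by simp)) (f := ((tensor K.L2 φ).innerCLM (S (tmul φ (Ja.cls c) y))).comp T)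
      (g := (F.innerCLM (annihilate φ (Ja.cls a₁) (tmul φ (Ja.cls c) y))).comp
        (annihilate φ (Jb.cls (star a₂)))) (by
          rintro _ ⟨⟨c', x⟩, rfl⟩
          exact base c y c' x)
    exact DFunLike.congr_fun this q
  have := ContinuousLinearMap.ext_on (dense_tmul_of_dense φ (fun ξ => Ja.cls ξ) (id : F → F)
    Ja.dense_cls (by simp)) (f := ((tensor K.L2 φ).innerCLM (T q)).comp S)
    (g := (F.innerCLM (annihilate φ (Jb.cls (star a₂)) q)).comp
      (annihilate φ (Ja.cls a₁))) (by
        rintro _ ⟨⟨c, y⟩, rfl⟩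
        have := congrArg star (step c y q)
        rw [HilbertModule.star_inner, HilbertModule.star_inner] at this
        exact this)
  have := congrArg star (DFunLike.congr_fun this p)
  change star ((tensor K.L2 φ).inner (T q) (S p)) = star (F.inner _ _) at this
  rwa [HilbertModule.star_inner, HilbertModule.star_inner] at this

end Coefficients

/-! ### Norming positive functionals and Hilbert space representations -/

section States

open scoped ComplexOrder

/-- A positive element `star c * c` of a unital C*-algebra is normed by a positive functional of
norm at most one: symmetrize a functional that norms `1 + star c * c`. -/
lemma exists_norming_positive {A : Type u} [CStarAlgebra A] (c : A) :
    ∃ ω : A →ₗ[ℂ] ℂ, (∀ x, ‖ω x‖ ≤ ‖x‖) ∧ (∀ x, ∃ t : ℝ, 0 ≤ t ∧ ω (star x * x) = t) ∧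
      ω (star c * c) = ‖star c * c‖ := by
  let _ := CStarAlgebra.spectralOrder A
  have := CStarAlgebra.spectralOrderedRing A
  rcases subsingleton_or_nontrivial A with hA | hA
  · refine ⟨0, fun x => by simp, fun x => ⟨0, le_rfl, by simp⟩, ?_⟩
    rw [Subsingleton.elim (star c * c) 0]
    simp
  set a := star c * c with ha
  have ha0 : 0 ≤ a := star_mul_self_nonneg c
  -- `a` is positive, so that its norm belongs to its spectrum
  have hnorm : ‖a + 1‖ = ‖a‖ + 1 := by
    refine le_antisymm ((norm_add_le _ _).trans (by rw [CStarRing.norm_one])) ?_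
    have h0 : ‖a‖ ∈ spectrum ℝ a := CStarAlgebra.norm_mem_spectrum_of_nonneg ha0
    have h1 : ‖a‖ + 1 ∈ spectrum ℝ (algebraMap ℝ A 1 + a) := by
      rw [spectrum.add_mem_add_iff]
      exact h0
    rw [map_one] at h1
    have h2 := spectrum.norm_le_norm_of_mem h1
    rwa [Real.norm_of_nonneg (by positivity), add_comm 1 a] at h2
  obtain ⟨g, hg, hga⟩ := exists_dual_vector'' ℂ (a + 1)
  have hgn : ∀ x, ‖g x‖ ≤ ‖x‖ := fun x => (g.le_opNorm x).trans
    (mul_le_of_le_one_left (norm_nonneg _) hg)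
  -- the self-adjoint part of `g`
  obtain ⟨ω, hω⟩ : ∃ ω : A →ₗ[ℂ] ℂ, ∀ x, ω x = (2⁻¹ : ℂ) * (g x + star (g (star x))) := by
    have h1 : ∀ x y, (2⁻¹ : ℂ) * (g (x + y) + star (g (star (x + y))))
        = 2⁻¹ * (g x + star (g (star x))) + 2⁻¹ * (g y + star (g (star y))) := fun x y => by
      rw [star_add, map_add, map_add, star_add]
      ring
    have h2 : ∀ (z : ℂ) x, (2⁻¹ : ℂ) * (g (z • x) + star (g (star (z • x))))
        = z • (2⁻¹ * (g x + star (g (star x)))) := fun z x => by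
      rw [star_smul, map_smul, map_smul, smul_eq_mul, smul_eq_mul, smul_eq_mul, star_mul',
        star_star]
      ring
    exact ⟨⟨⟨_, h1⟩, h2⟩, fun _ => rfl⟩
  have hωn : ∀ x, ‖ω x‖ ≤ ‖x‖ := fun x => by
    have h1 := hgn x
    have h2 := hgn (star x)
    rw [norm_star] at h2
    have h3 := norm_add_le (g x) (star (g (star x)))
    rw [norm_star] at h3
    rw [hω, norm_mul, norm_inv, Complex.norm_ofNat]
    linarith
  have hsa : ∀ x : A, star x = x → ω x = ((g x).re : ℂ) := fun x hx => by
    rw [hω, hx, RCLike.star_def, Complex.add_conj]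
    push_cast
    ring
  -- neither summand exceeds its norm, so both are attained
  have hre : (g a).re + (g 1).re = ‖a‖ + 1 := by
    rw [← Complex.add_re, ← map_add, hga, hnorm]
    exact Complex.ofReal_re _
  have h1 : (g 1).re ≤ 1 := (Complex.re_le_norm _).trans ((hgn 1).trans (by rw [CStarRing.norm_one]))
  have h2 : (g a).re ≤ ‖a‖ := (Complex.re_le_norm _).trans (hgn a)
  have hg1 : (g 1).re = 1 := by linarith
  have hga' : (g a).re = ‖a‖ := by linarith
  -- `g` is positive since `‖g‖ ≤ 1 = Re g(1)` and `‖1 - x‖ ≤ 1` for `0 ≤ x ≤ 1`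
  have pos : ∀ x : A, 0 ≤ x → ‖x‖ ≤ 1 → 0 ≤ (g x).re := by
    intro x hx hx1
    have h3 : 0 ≤ 1 - x := sub_nonneg.2 ((CStarAlgebra.norm_le_one_iff_of_nonneg x hx).1 hx1)
    have h4 : ‖1 - x‖ ≤ 1 :=
      (CStarAlgebra.norm_le_one_iff_of_nonneg _ h3).2 (sub_le_self _ hx)
    have h5 := (Complex.re_le_norm _).trans ((hgn (1 - x)).trans h4)
    rw [map_sub, Complex.sub_re, hg1] at h5
    linarith
  refine ⟨ω, hωn, fun x => ⟨(g (star x * x)).re, ?_, hsa _ (by simp)⟩, ?_⟩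
  · set y := star x * x with hy
    have hy0 : 0 ≤ y := star_mul_self_nonneg x
    set r : ℝ := (‖y‖ + 1)⁻¹ with hr
    have hr0 : 0 < r := by positivity
    have h6 := pos ((r : ℂ) • y) (by
        have := smul_nonneg hr0.le hy0
        rwa [← Complex.coe_smul] at this) (by
        rw [norm_smul, Complex.norm_real, Real.norm_of_nonneg hr0.le, hr, inv_mul_le_iff₀
          (by positivity)]
        linarith)
    rw [map_smul, smul_eq_mul, Complex.re_ofReal_mul] at h6
    exact (mul_nonneg_iff_of_pos_left hr0).1 h6
  · rw [hsa _ (by simp [ha]), hga']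

variable {A : Type u} [NonUnitalCStarAlgebra A]

lemma span_star_mul_self : Submodule.span ℂ {a : A | ∃ b : A, a = star b * b} = ⊤ := by
  let _ := CStarAlgebra.spectralOrder A
  have := CStarAlgebra.spectralOrderedRing A
  rw [← CStarAlgebra.span_nonneg (A := A)]
  congr 1
  ext a
  exact CStarAlgebra.nonneg_iff_eq_star_mul_self.symm

/-- Every element of a C*-algebra has the same norm in some Gelfand--Naimark--Segal
representation, which is nondegenerate. -/
lemma exists_norming_rep (a : A) :
    ∃ (H : Type u) (_ : NormedAddCommGroup H) (_ : InnerProductSpace ℂ H) (_ : CompleteSpace H)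
      (π : A →⋆ₙₐ[ℂ] (H →L[ℂ] H)),
      Dense (Submodule.span ℂ {y : H | ∃ b x, π b x = y} : Set H) ∧ ‖a‖ ≤ ‖π a‖ := by
  let _ := CStarAlgebra.spectralOrder A
  have := CStarAlgebra.spectralOrderedRing A
  -- a positive functional that norms `a * star a * a * star a`
  let c : Unitization ℂ A := ((a * star a : A) : Unitization ℂ A)
  obtain ⟨ω, hω, hpos, hωc⟩ := exists_norming_positive c
  have hf0 : ∀ x : A, 0 ≤ x → (0 : ℂ) ≤ ω (x : Unitization ℂ A) := fun x hx => by
    obtain ⟨b, rfl⟩ := CStarAlgebra.nonneg_iff_eq_star_mul_self.1 hx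
    obtain ⟨t, ht, h⟩ := hpos (b : Unitization ℂ A)
    rw [Unitization.inr_mul, Unitization.inr_star, h]
    exact Complex.zero_le_real.2 ht
  let f : A →ₚ[ℂ] ℂ := PositiveLinearMap.mk₀
    (ω ∘ₗ ((Unitization.inrNonUnitalStarAlgHom ℂ A : A →⋆ₙₐ[ℂ] Unitization ℂ A) :
      A →ₗ[ℂ] Unitization ℂ A)) hf0
  have hf : ∀ x : A, f x = ω (x : Unitization ℂ A) := fun _ => rfl
  refine ⟨f.GNS, inferInstance, inferInstance, inferInstance, f.gnsNonUnitalStarAlgHom, ?_, ?_⟩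
  · have h1 : ∀ y : A, ((f.toPreGNS y : f.PreGNS) : f.GNS) ∈
        Submodule.span ℂ {y : f.GNS | ∃ b x, f.gnsNonUnitalStarAlgHom b x = y} := by
      intro y
      have hy : y ∈ Submodule.span ℂ {a : A | ∃ b : A, a = star b * b} := by
        rw [span_star_mul_self]; trivial
      induction hy using Submodule.span_induction with
      | mem z hz =>
        obtain ⟨b, rfl⟩ := hz
        refine Submodule.subset_span ⟨star b, (f.toPreGNS b : f.PreGNS), ?_⟩
        simp
      | zero =>
        rw [map_zero, UniformSpace.Completion.coe_zero]
        exact Submodule.zero_mem _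
      | add a b _ _ ha hb =>
        rw [map_add, UniformSpace.Completion.coe_add]
        exact Submodule.add_mem _ ha hb
      | smul z a _ ha =>
        rw [map_smul, UniformSpace.Completion.coe_smul]
        exact Submodule.smul_mem _ z ha
    refine (UniformSpace.Completion.denseRange_coe (α := f.PreGNS)).mono ?_
    rintro _ ⟨y, rfl⟩
    exact h1 y
  · -- the vector `star a` has norm at most `‖a‖` and is mapped to a vector of norm `‖a‖ ^ 2`
    by_cases h0 : ‖a‖ = 0
    · rw [h0]; exact norm_nonneg _
    have hpos : 0 < ‖a‖ := lt_of_le_of_ne (norm_nonneg _) (Ne.symm h0)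
    set v : f.GNS := ((f.toPreGNS (star a) : f.PreGNS) : f.GNS) with hv
    have h1 : ‖v‖ ^ 2 ≤ ‖a‖ ^ 2 := by
      have h2 := f.preGNS_norm_sq (f.toPreGNS (star a))
      rw [hv, UniformSpace.Completion.norm_coe]
      have h3 : ‖((‖f.toPreGNS (star a)‖ : ℂ)) ^ 2‖ = ‖f.toPreGNS (star a)‖ ^ 2 := by
        rw [norm_pow, Complex.norm_real, norm_norm]
      rw [← h3, h2, hf]
      refine (hω _).trans ?_
      rw [Unitization.norm_inr, PositiveLinearMap.ofPreGNS_toPreGNS, star_star,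
        CStarRing.norm_self_mul_star, sq]
    have h2 : ‖f.gnsNonUnitalStarAlgHom a v‖ ^ 2 = ‖a‖ ^ 4 := by
      have h2 := f.preGNS_norm_sq (f.toPreGNS (a * star a))
      have h4 : f.gnsNonUnitalStarAlgHom a v = ((f.toPreGNS (a * star a) : f.PreGNS) : f.GNS) := by
        rw [hv]; simp
      rw [h4, UniformSpace.Completion.norm_coe]
      have h3 : ‖((‖f.toPreGNS (a * star a)‖ : ℂ)) ^ 2‖ = ‖f.toPreGNS (a * star a)‖ ^ 2 := by
        rw [norm_pow, Complex.norm_real, norm_norm]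
      rw [← h3, h2, hf, PositiveLinearMap.ofPreGNS_toPreGNS, Unitization.inr_mul,
        Unitization.inr_star]
      change ‖ω (star c * c)‖ = _
      rw [hωc, Complex.norm_real, norm_norm, CStarRing.norm_star_mul_self, Unitization.norm_inr,
        CStarRing.norm_self_mul_star]
      ring
    have h3 : ‖v‖ ≤ ‖a‖ := le_of_sq_le_sq h1 hpos.le
    have h4 : ‖f.gnsNonUnitalStarAlgHom a v‖ = ‖a‖ ^ 2 :=
      (sq_eq_sq₀ (norm_nonneg _) (by positivity)).1 (h2.trans (by ring))
    have h5 : ‖f.gnsNonUnitalStarAlgHom a v‖ ≤ ‖f.gnsNonUnitalStarAlgHom a‖ * ‖a‖ :=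
      (ContinuousLinearMap.le_opNorm _ _).trans (by gcongr)
    rw [h4, sq] at h5
    exact le_of_mul_le_mul_right h5 hpos

end States

/-! ### The universal C*-norm on the convolution algebra -/

namespace CStarSeminorm

variable {A : Type u} [NonUnitalRing A] [StarRing A] [Module ℂ A] [IsScalarTower ℂ A A]
  [SMulCommClass ℂ A A] [StarModule ℂ A] (p : CStarSeminorm A)

/-- The canonical *-homomorphism to the completion. -/
noncomputable def toComplHom : A →⋆ₙₐ[ℂ] p.Compl where
  toFun := p.toCompl
  map_smul' c a := UniformSpace.Completion.coe_smul c (show p.Alg from a)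
  map_zero' := UniformSpace.Completion.coe_zero
  map_add' a b := UniformSpace.Completion.coe_add (show p.Alg from a) (show p.Alg from b)
  map_mul' a b := (complMul_coe p.Alg a b).symm
  map_star' a := (complStar_coe p.Alg a).symm

lemma norm_toComplHom (a : A) : ‖p.toComplHom a‖ = p.toFun a :=
  UniformSpace.Completion.norm_coe (show p.Alg from a)

lemma denseRange_toComplHom : DenseRange p.toComplHom :=
  UniformSpace.Completion.denseRange_coe (α := p.Alg)

variable {D : Type u} [NonUnitalCStarAlgebra D] {F : HilbertModule D}

/-- A *-homomorphism to adjointable operators that is bounded by `p` extends to `p.Compl`. -/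
lemma exists_extension (L : A →ₙₐ[ℂ] (F →L[ℂ] F))
    (hstar : ∀ a x y, F.inner (L (star a) x) y = F.inner x (L a y))
    (hL : ∀ a, ‖L a‖ ≤ p.toFun a) :
    ∃ π : StarRep p.Compl F, ∀ a, π (p.toComplHom a) = L a := by
  let T : p.Compl →L[ℂ] (F →L[ℂ] F) :=
    (L : A →ₗ[ℂ] (F →L[ℂ] F)).extendOfNorm (p.toComplHom : A →ₗ[ℂ] p.Compl)
  have hT : ∀ a, T (p.toComplHom a) = L a := fun a =>
    LinearMap.extendOfNorm_eq (f := (L : A →ₗ[ℂ] (F →L[ℂ] F)))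
      (e := (p.toComplHom : A →ₗ[ℂ] p.Compl)) p.denseRange_toComplHom
      ⟨1, fun x => by rw [one_mul]; exact (hL x).trans_eq (p.norm_toComplHom x).symm⟩ a
  refine ⟨⟨⟨⟨⟨T, map_smul T⟩, map_zero T, map_add T⟩, fun a b => ?_⟩, fun a x y => ?_⟩, hT⟩
  · change T (a * b) = T a * T b
    refine p.denseRange_toComplHom.induction_on₂ (p := fun a b => T (a * b) = T a * T b)
      (isClosed_eq (by fun_prop) (by fun_prop)) (fun a b => ?_) a b
    rw [← map_mul, hT, hT, hT, map_mul]
  · change F.inner (T (star a) x) y = F.inner x (T a y)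
    refine p.denseRange_toComplHom.induction_on
      (p := fun a => F.inner (T (star a) x) y = F.inner x (T a y)) a
      (isClosed_eq (F.continuous_inner_comp (by fun_prop) (by fun_prop))
        (F.continuous_inner_comp (by fun_prop) (by fun_prop))) (fun a => ?_)
    rw [← map_star, hT, hT, hstar]

end CStarSeminorm

lemma StarRep.norm_le {A D : Type u} [NonUnitalCStarAlgebra A] [NonUnitalCStarAlgebra D]
    {F : HilbertModule D} (π : StarRep A F) (a : A) : ‖π a‖ ≤ ‖a‖ :=
  ContinuousLinearMap.opNorm_le_bound _ (norm_nonneg a) fun x => norm_rep_le π a x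

lemma StarRep.continuous {A D : Type u} [NonUnitalCStarAlgebra A] [NonUnitalCStarAlgebra D]
    {F : HilbertModule D} (π : StarRep A F) : Continuous π :=
  (LinearMap.mkContinuous (π.toHom : A →ₗ[ℂ] (F →L[ℂ] F)) 1 fun a => by
    rw [one_mul]; exact π.norm_le a).continuous

section Conv

variable {G0 G1 : Type u} [TopologicalSpace G0] [TopologicalSpace G1]
  [T2Space G0] [T2Space G1] [LocallyCompactSpace G1]
  [MeasurableSpace G1] [BorelSpace G1] {𝒢 : TopGroupoid G0 G1} (α : HaarSystem 𝒢)

lemma maxSeminorm_le_INorm (f : C_c(G1, ℂ)) :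
    (maxSeminorm α).toFun (Conv.of α f) ≤ INorm α f := by
  refine csSup_le (normValues_nonempty α _) ?_
  rintro _ ⟨H, _, _, _, L, rfl⟩
  exact L.norm_le f

/-- Every C*-seminorm that is bounded by the `I`-norm is bounded by the norm of `C*(G, α)`, because
it is the supremum of the norms in Hilbert space representations. -/
lemma le_maxSeminorm (p : CStarSeminorm (Conv α))
    (hp : ∀ f : C_c(G1, ℂ), p.toFun (Conv.of α f) ≤ INorm α f) (f : Conv α) :
    p.toFun f ≤ (maxSeminorm α).toFun f := by
  obtain ⟨H, _, _, _, π, hπ, hn⟩ := exists_norming_rep (p.toComplHom f)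
  rw [p.norm_toComplHom] at hn
  refine hn.trans (le_csSup (bddAbove_normValues α f)
    ⟨H, _, _, _, ⟨π.comp p.toComplHom, ?_, fun g => ?_⟩, rfl⟩)
  · set S := Submodule.span ℂ {y : H | ∃ g x, (π.comp p.toComplHom) g x = y} with hS
    have h1 : Submodule.span ℂ {y : H | ∃ b x, π b x = y} ≤ S.topologicalClosure := by
      rw [Submodule.span_le]
      rintro _ ⟨b, x, rfl⟩
      have hc : Continuous fun b => π b x := by
        have : Continuous π := AddMonoidHomClass.continuous_of_bound π 1 fun b => by
          rw [one_mul]; exact NonUnitalStarAlgHom.norm_apply_le π b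
        fun_prop
      refine p.denseRange_toComplHom.induction_on (p := fun b => π b x ∈ S.topologicalClosure) b
        (S.isClosed_topologicalClosure.preimage hc) fun g => ?_
      exact S.le_topologicalClosure (Submodule.subset_span ⟨g, x, rfl⟩)
    have h4 : Dense (S.topologicalClosure : Set H) := hπ.mono h1
    rw [Submodule.topologicalClosure_coe] at h4
    exact dense_closure.1 h4
  · exact (NonUnitalStarAlgHom.norm_apply_le π (p.toComplHom (Conv.of α g))).trans
      ((p.norm_toComplHom _).trans_le (hp g))

variable {D : Type u} [NonUnitalCStarAlgebra D] {F : HilbertModule D}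

/-- The operator norms in a *-homomorphism to adjointable operators form a C*-seminorm. -/
noncomputable def CStarSeminorm.ofHom {A : Type u} [NonUnitalRing A] [StarRing A] [Module ℂ A]
    (L : A →ₙₐ[ℂ] (F →L[ℂ] F))
    (hstar : ∀ a x y, F.inner (L (star a) x) y = F.inner x (L a y)) : CStarSeminorm A :=
  have sq : ∀ a, ‖L a‖ * ‖L a‖ ≤ ‖L (star a * a)‖ := fun a => by
    have h : ‖L a‖ ≤ √‖L (star a * a)‖ := by
      refine ContinuousLinearMap.opNorm_le_bound _ (Real.sqrt_nonneg _) fun x => ?_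
      refine le_of_sq_le_sq ?_ (by positivity)
      rw [F.norm_sq, mul_pow, Real.sq_sqrt (norm_nonneg _)]
      have h1 : F.inner (L a x) (L a x) = F.inner (L (star a * a) x) x := by
        rw [map_mul]
        exact (hstar a (L a x) x).symm
      rw [h1]
      calc _ ≤ ‖L (star a * a) x‖ * ‖x‖ := F.norm_inner_le _ _
        _ ≤ (‖L (star a * a)‖ * ‖x‖) * ‖x‖ := by gcongr; exact ContinuousLinearMap.le_opNorm _ _
        _ = _ := by ring
    calc _ ≤ √‖L (star a * a)‖ * √‖L (star a * a)‖ := by gcongr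
      _ = _ := Real.mul_self_sqrt (norm_nonneg _)
  have star_le : ∀ a, ‖L a‖ ≤ ‖L (star a)‖ := fun a => by
    by_cases h0 : ‖L a‖ = 0
    · rw [h0]; exact norm_nonneg _
    have hpos : 0 < ‖L a‖ := lt_of_le_of_ne (norm_nonneg _) (Ne.symm h0)
    have h1 := (sq a).trans ((congrArg norm (map_mul L (star a) a)).trans_le (norm_mul_le _ _))
    exact le_of_mul_le_mul_right h1 hpos
  { toFun := fun a => ‖L a‖
    nonneg := fun a => norm_nonneg _
    add_le := fun a b => by rw [map_add]; exact norm_add_le _ _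
    smul_eq := fun c a => by rw [map_smul, norm_smul]
    mul_le := fun a b => by rw [map_mul]; exact norm_mul_le _ _
    star_eq := fun a => le_antisymm (by simpa using star_le (star a)) (star_le a)
    sq_le := sq }

/-- A *-homomorphism of the convolution algebra to adjointable operators that is bounded by the
`I`-norm extends to `C*(G, α)`. -/
lemma exists_starRep_of_INorm_le (L : Conv α →ₙₐ[ℂ] (F →L[ℂ] F))
    (hstar : ∀ a x y, F.inner (L (star a) x) y = F.inner x (L a y))
    (hL : ∀ f : C_c(G1, ℂ), ‖L (Conv.of α f)‖ ≤ INorm α f) :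
    ∃ π : StarRep (GroupoidCStar α) F, ∀ f, π ((maxSeminorm α).toComplHom f) = L f :=
  (maxSeminorm α).exists_extension L hstar fun f =>
    le_maxSeminorm α (CStarSeminorm.ofHom L hstar) hL f

end Conv

/-! ### Operators from a unitary that is linear over functions -/

section CoefficientOperators

variable {Y Z : Type u} [TopologicalSpace Y] [TopologicalSpace Z]
  [T2Space Y] [LocallyCompactSpace Y] {g₁ g₂ : C(Y, Z)}
  {D : Type u} [NonUnitalCStarAlgebra D] {F : HilbertModule D}

lemma annihilate_smul {B : Type u} [NonUnitalCStarAlgebra B] {E : HilbertModule B}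
    (φ : StarRep B F) (c : ℂ) (e : E) (t : tensor E φ) :
    annihilate φ (c • e) t = star c • annihilate φ e t := by
  refine F.ext_inner fun y => ?_
  rw [F.inner_smul_right, inner_annihilate, inner_annihilate, tmul_smul_left,
    (tensor E φ).inner_smul_left]

lemma exists_common_unit (f g : C_c(Y, ℂ)) : ∃ e : C_c(Y, ℂ), e * f = f ∧ e * g = g := by
  obtain ⟨e, he, he'⟩ := exists_unit_comp₂ (ContinuousMap.id Y) f g
  refine ⟨e, ?_, ?_⟩ <;> ext q
  · by_cases hq : f q = 0
    · simp [hq]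
    · have : e q = 1 := he q hq
      simp [this]
  · by_cases hq : g q = 0
    · simp [hq]
    · have : e q = 1 := he' q hq
      simp [this]

/-- The operator `T_η* U T_ξ`, where `T_ξ y = ξ ⊗ y`. -/
noncomputable def sandwich (J₁ : IntegrationMap g₁) (J₂ : IntegrationMap g₂)
    (φ : StarRep C₀(Z, ℂ) F) (U : Unitary (tensor J₁.L2 φ) (tensor J₂.L2 φ)) (η ξ : C_c(Y, ℂ)) :
    F →L[ℂ] F :=
  (annihilate φ (J₂.cls η)).comp (U.toCLM.comp (create φ (J₁.cls ξ)))

lemma sandwich_apply (J₁ : IntegrationMap g₁) (J₂ : IntegrationMap g₂)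
    (φ : StarRep C₀(Z, ℂ) F) (U : Unitary (tensor J₁.L2 φ) (tensor J₂.L2 φ)) (η ξ : C_c(Y, ℂ))
    (x : F) :
    sandwich J₁ J₂ φ U η ξ x = annihilate φ (J₂.cls η) (U (tmul φ (J₁.cls ξ) x)) := rfl

lemma norm_sandwich_le (J₁ : IntegrationMap g₁) (J₂ : IntegrationMap g₂)
    (φ : StarRep C₀(Z, ℂ) F) (U : Unitary (tensor J₁.L2 φ) (tensor J₂.L2 φ)) (η ξ : C_c(Y, ℂ)) :
    ‖sandwich J₁ J₂ φ U η ξ‖ ≤ ‖J₂.cls η‖ * ‖J₁.cls ξ‖ := by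
  refine ContinuousLinearMap.opNorm_le_bound _ (by positivity) fun x => ?_
  rw [sandwich_apply, mul_assoc]
  refine (norm_annihilate_le φ _ _).trans ?_
  rw [U.norm_map]
  gcongr
  exact norm_tmul_le' φ _ _

/-- For a `C₀(Y)`-linear unitary `U`, the operator `T_η* U T_ξ` depends only on `conj η · ξ`, and
linearly so. -/
lemma exists_coefficient (J₁ : IntegrationMap g₁) (J₂ : IntegrationMap g₂)
    (φ : StarRep C₀(Z, ℂ) F) (U : Unitary (tensor J₁.L2 φ) (tensor J₂.L2 φ))
    (hU : ∀ a x, U (J₁.mulRep.tensor φ a x) = J₂.mulRep.tensor φ a (U x)) :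
    ∃ L : C_c(Y, ℂ) →ₗ[ℂ] (F →L[ℂ] F), ∀ η ξ x,
      annihilate φ (J₂.cls η) (U (tmul φ (J₁.cls ξ) x)) = L (star η * ξ) x := by
  set T := sandwich J₁ J₂ φ U with hT
  -- `U` is `C₀(Y)`-linear
  have bal : ∀ a η ξ, T η (a * ξ) = T (star a * η) ξ := by
    intro a η ξ
    ext x
    rw [hT, sandwich_apply, sandwich_apply, ← toC₀_smul_eq_mul, ← J₁.mulRep_cls,
      ← StarRep.tensor_tmul, hU, ← toC₀_smul_eq_mul, ← J₂.mulRep_cls, annihilate_rep]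
    congr 3
    ext y
    simp
  have addξ : ∀ η ξ ξ', T η (ξ + ξ') = T η ξ + T η ξ' := by
    intro η ξ ξ'
    ext x
    rw [hT, _root_.add_apply, sandwich_apply, sandwich_apply, sandwich_apply, map_add,
      tmul_add_left, map_add, map_add]
  have addη : ∀ η η' ξ, T (η + η') ξ = T η ξ + T η' ξ := by
    intro η η' ξ
    ext x
    rw [hT, _root_.add_apply, sandwich_apply, sandwich_apply, sandwich_apply, map_add,
      annihilate_add]
  have smulη : ∀ (c : ℂ) η ξ, T (c • η) ξ = star c • T η ξ := by
    intro c η ξ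
    ext x
    rw [hT, _root_.smul_apply, sandwich_apply, sandwich_apply, map_smul, annihilate_smul]
  -- `L(f) = T_{conj f}* U T_e` for any `e` with `e f = f`
  choose e he using fun f : C_c(Y, ℂ) => (exists_common_unit f f).imp fun e he => he.1
  have indep : ∀ f e', e' * f = f → T (star f) (e f) = T (star f) e' := by
    intro f e' he'
    have hs : ∀ a : C_c(Y, ℂ), a * f = f → star a * star f = star f := fun a ha =>
      (star_mul' a f).symm.trans (congrArg star ha)
    have h1 : T (star f) (e' * e f) = T (star f) (e f) := by
      rw [bal, hs e' he']
    have h2 : T (star f) (e f * e') = T (star f) e' := by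
      rw [bal, hs _ (he f)]
    rw [← h1, mul_comm, h2]
  refine ⟨⟨⟨fun f => T (star f) (e f), fun f g => ?_⟩, fun c f => ?_⟩, fun η ξ x => ?_⟩
  · obtain ⟨e', h1, h2⟩ := exists_common_unit f g
    change T _ _ = T _ _ + T _ _
    rw [indep f e' h1, indep g e' h2, indep (f + g) e' (by rw [mul_add, h1, h2]), star_add, addη]
  · change T _ _ = c • T _ _
    rw [indep (c • f) (e f) (by rw [mul_smul_comm, he]), star_smul, smulη, star_star]
  · change T η ξ x = T _ _ x
    obtain ⟨e', h1, -⟩ := exists_common_unit ξ ξ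
    rw [indep _ e' (by rw [mul_left_comm, h1])]
    nth_rewrite 1 [← h1]
    rw [mul_comm e' ξ, bal, star_mul', star_star, mul_comm η]

variable {X : Type u} [TopologicalSpace X]

lemma pullback_canon_tmul {d : C(X, Y)} {h₁ h₂ : C(X, Z)} (I : IntegrationMap d)
    (J₁ : IntegrationMap g₁) (J₂ : IntegrationMap g₂) (K₁ : IntegrationMap h₁)
    (K₂ : IntegrationMap h₂) (hK₁ : ∀ ξ, K₁ ξ = J₁ (I ξ)) (hK₂ : ∀ ξ, K₂ ξ = J₂ (I ξ))
    (φ : StarRep C₀(Z, ℂ) F) (U : Unitary (tensor J₁.L2 φ) (tensor J₂.L2 φ))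
    (hU : ∀ a x, U (J₁.mulRep.tensor φ a x) = J₂.mulRep.tensor φ a (U x))
    (A : C_c(X, ℂ)) (p : tensor J₁.L2 φ) :
    pullback I J₁ J₂ K₁ K₂ hK₁ hK₂ φ U hU
        (IntegrationMap.canon I J₁ K₁ hK₁ φ (tmul (J₁.mulRep.tensor φ) (I.cls A) p))
      = IntegrationMap.canon I J₂ K₂ hK₂ φ (tmul (J₂.mulRep.tensor φ) (I.cls A) (U p)) := by
  rw [pullback, Unitary.trans_apply, Unitary.trans_apply, Unitary.symm_apply_apply,
    Unitary.lTensor_tmul]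

/-- `A ⊗ y` is the image of `A ⊗ (b ⊗ y)` if `b` is `1` on the image of the support of `A`. -/
lemma canon_tmul_of_unit {d : C(X, Y)} {h₁ : C(X, Z)} (I : IntegrationMap d)
    (J₁ : IntegrationMap g₁) (K₁ : IntegrationMap h₁) (hK₁ : ∀ ξ, K₁ ξ = J₁ (I ξ))
    (φ : StarRep C₀(Z, ℂ) F) (A : C_c(X, ℂ)) (b : C_c(Y, ℂ)) (hb : ∀ x, b (d x) * A x = A x)
    (y : F) :
    IntegrationMap.canon I J₁ K₁ hK₁ φ
        (tmul (J₁.mulRep.tensor φ) (I.cls A) (tmul φ (J₁.cls b) y))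
      = tmul φ (K₁.cls A) y := by
  rw [canon_tmul]
  congr 2
  ext x
  exact hb x

end CoefficientOperators

/-! ### The cocycle identity and convolution -/

section Cocycle

variable {G0 G1 : Type u} [TopologicalSpace G0] [TopologicalSpace G1]
  [T2Space G0] [T2Space G1] [LocallyCompactSpace G1]
  [MeasurableSpace G1] [BorelSpace G1] {𝒢 : TopGroupoid G0 G1} (α : HaarSystem 𝒢)

/-- The function `(g, h) ↦ u(g) v(g h)` on `G²`. -/
noncomputable def boxComp (𝒢 : TopGroupoid G0 G1) (u v : C_c(G1, ℂ)) : C_c(𝒢.Pairs, ℂ) :=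
  compHomeo 𝒢.homeo₁ (fiberBox 𝒢.r 𝒢.r v u)

lemma boxComp_apply (u v : C_c(G1, ℂ)) (q : 𝒢.Pairs) :
    boxComp 𝒢 u v q = u (𝒢.d₂ q) * v (𝒢.d₁ q) := mul_comm _ _

lemma boxTimes_apply (u v : C_c(G1, ℂ)) (q : 𝒢.Pairs) :
    boxTimes 𝒢 u v q = u (𝒢.d₂ q) * v (𝒢.d₀ q) := rfl

namespace HaarSystem

lemma int_apply (f : C_c(G1, ℂ)) (x : G0) : α.int f x = ∫ g, f g ∂α.meas x := rfl

/-- `λ₀ f (h)` as the integral of any function on `G¹` that agrees with `g ↦ f(g, h)` on the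
fibre. -/
lemma lam₀_apply' (f : C_c(𝒢.Pairs, ℂ)) (h : G1) {y : G0} (hy : y = 𝒢.r h) (k : G1 → ℂ)
    (hk : ∀ g (hg : 𝒢.s g = 𝒢.r h), f ⟨(g, h), hg⟩ = k g) :
    α.lam₀ f h = ∫ g, k g ∂α.tilde.meas y := by
  subst hy
  rw [lam₀_apply]
  refine α.tilde.integral_congr fun g hg => ?_
  rw [extendZero, dif_pos hg.symm]
  exact hk g hg

/-- `λ₁ f (k)` as the integral of any function on `G¹` that agrees with `g ↦ f(g, g⁻¹ k)` on the
fibre. -/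
lemma lam₁_apply' (f : C_c(𝒢.Pairs, ℂ)) (h : G1) {y : G0} (hy : y = 𝒢.r h) (k : G1 → ℂ)
    (hk : ∀ g (hg : 𝒢.r g = 𝒢.r h),
      f ⟨(g, 𝒢.comp (𝒢.inv g) h ((𝒢.s_inv g).trans hg)), by rw [𝒢.r_comp, 𝒢.r_inv]⟩ = k g) :
    α.lam₁ f h = ∫ g, k g ∂α.meas y := by
  subst hy
  rw [lam₁_apply]
  refine α.integral_congr fun g hg => ?_
  rw [extendZero, dif_pos hg.symm]
  exact hk g hg

/-- `λ₀` integrates a product `b₁(g) b₂(h)` to `α̃(b₁)(r(h)) b₂(h)`. -/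
lemma lam₀_of_mul (b₁ b₂ : C_c(G1, ℂ)) (ζ : C_c(𝒢.Pairs, ℂ))
    (hζ : ∀ q, ζ q = b₁ (𝒢.d₂ q) * b₂ (𝒢.d₀ q)) :
    α.lam₀ ζ = ((α.tildeInt b₁).toContinuousMap.comp 𝒢.r) • b₂ := by
  ext h
  rw [α.lam₀_apply' ζ h rfl (fun g => b₁ g * b₂ h) fun g hg => hζ _, integral_mul_const]
  rfl

/-- `λ₁` integrates a product `b₁(g) b₂(g h)` to `α(b₁)(r(k)) b₂(k)`, where `k = g h`. -/
lemma lam₁_of_mul (b₁ b₂ : C_c(G1, ℂ)) (ζ : C_c(𝒢.Pairs, ℂ))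
    (hζ : ∀ q, ζ q = b₁ (𝒢.d₂ q) * b₂ (𝒢.d₁ q)) :
    α.lam₁ ζ = ((α.int b₁).toContinuousMap.comp 𝒢.r) • b₂ := by
  ext h
  rw [α.lam₁_apply' ζ h rfl (fun g => b₁ g * b₂ h) fun g hg => ?_, integral_mul_const]
  · rfl
  · rw [hζ]
    congr 2
    exact 𝒢.comp_inv_cancel g h _

lemma mu₁_of_mul (b₁ b₂ : C_c(G1, ℂ)) (ζ : C_c(𝒢.Pairs, ℂ))
    (hζ : ∀ q, ζ q = b₁ (𝒢.d₂ q) * b₂ (𝒢.d₀ q)) :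
    α.mu₁ ζ = α.tildeInt b₁ * α.int b₂ := by
  change α.int (α.lam₀ ζ) = _
  rw [α.lam₀_of_mul b₁ b₂ ζ hζ, α.int.map_smul_comp]
  rfl

lemma mu₀_of_mul (b₁ b₂ : C_c(G1, ℂ)) (ζ : C_c(𝒢.Pairs, ℂ))
    (hζ : ∀ q, ζ q = b₁ (𝒢.d₂ q) * b₂ (𝒢.d₁ q)) :
    α.mu₀ ζ = α.int b₁ * α.int b₂ := by
  change α.int (α.lam₂ ζ) = _
  rw [← α.int_lam₁, α.lam₁_of_mul b₁ b₂ ζ hζ, α.int.map_smul_comp]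
  rfl

/-- `λ₀` integrates `conj f₁(g) f₂(g h)` to `f₁* * f₂`. -/
lemma lam₀_of_comp (f₁ f₂ : C_c(G1, ℂ)) (ζ : C_c(𝒢.Pairs, ℂ))
    (hζ : ∀ q, ζ q = star (f₁ (𝒢.d₂ q)) * f₂ (𝒢.d₁ q)) :
    α.lam₀ ζ = convolution α (involution 𝒢 f₁) f₂ := by
  ext h
  have h1 := α.lam₀_apply' ζ h rfl (fun g => extendZero (fun q : FiberProduct 𝒢.r 𝒢.r =>
      star (f₁ (𝒢.inv q.1.2)) * f₂ (𝒢.comp (𝒢.inv q.1.2) q.1.1 ((𝒢.s_inv _).trans q.2.symm)))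
      h (𝒢.inv g)) (fun g hg => by
    rw [extendZero, dif_pos (by rw [𝒢.r_inv, hg]), hζ]
    congr 1
    · exact congrArg (fun z => star (f₁ z)) (𝒢.inv_inv g).symm
    · exact congrArg f₂ (𝒢.comp_congr (𝒢.inv_inv g).symm rfl _ _))
  rw [h1, convolution_apply]
  change ∫ g, _ ∂(α.meas _).map 𝒢.inv = _
  rw [integral_map_inv]
  simp only [𝒢.inv_inv]
  rfl

end HaarSystem

variable {D : Type u} [NonUnitalCStarAlgebra D] {F : HilbertModule D}
  (φ : StarRep C₀(G0, ℂ) F) (U : Unitary (tensor α.tildeInt.L2 φ) (tensor α.int.L2 φ))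
  (hU : ∀ (a : C₀(G1, ℂ)) x,
    U (α.tildeInt.mulRep.tensor φ a x) = α.int.mulRep.tensor φ a (U x))

/-- The pull-back `d₀*(U)`. -/
noncomputable def pullback₀ : Unitary (tensor α.mu₂.L2 φ) (tensor α.mu₁.L2 φ) :=
  pullback α.lam₀ α.tildeInt α.int α.mu₂ α.mu₁ (fun _ => rfl) (fun _ => rfl) φ U hU

/-- The pull-back `d₁*(U)`. -/
noncomputable def pullback₁ : Unitary (tensor α.mu₂.L2 φ) (tensor α.mu₀.L2 φ) :=
  pullback α.lam₁ α.tildeInt α.int α.mu₂ α.mu₀ (fun ξ => (α.tildeInt_lam₁ ξ).symm)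
    (fun ξ => (α.int_lam₁ ξ).symm) φ U hU

/-- The pull-back `d₂*(U)`. -/
noncomputable def pullback₂ : Unitary (tensor α.mu₁.L2 φ) (tensor α.mu₀.L2 φ) :=
  pullback α.lam₂ α.tildeInt α.int α.mu₁ α.mu₀ (fun ξ => (α.tildeInt_lam₂ ξ).symm)
    (fun _ => rfl) φ U hU

/-- A vector `A ⊗ p` of `L²(G²) ⊗ (L²(G¹) ⊗ F)`, for the map `d₁` and the measures `α` on `G¹`,
seen in `L²(G², μ₀) ⊗ F`. -/
noncomputable def canon₁ (A : C_c(𝒢.Pairs, ℂ)) (p : tensor α.int.L2 φ) : tensor α.mu₀.L2 φ :=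
  IntegrationMap.canon α.lam₁ α.int α.mu₀ (fun ξ => (α.int_lam₁ ξ).symm) φ
    (tmul (α.int.mulRep.tensor φ) (α.lam₁.cls A) p)

/-- A vector `A ⊗ p` of `L²(G²) ⊗ (L²(G¹) ⊗ F)`, for the map `d₂` and the measures `α` on `G¹`,
seen in `L²(G², μ₀) ⊗ F`. -/
noncomputable def canon₂ (A : C_c(𝒢.Pairs, ℂ)) (p : tensor α.int.L2 φ) : tensor α.mu₀.L2 φ :=
  IntegrationMap.canon α.lam₂ α.int α.mu₀ (fun _ => rfl) φ
    (tmul (α.int.mulRep.tensor φ) (α.lam₂.cls A) p)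

/-- A vector `A ⊗ p` of `L²(G²) ⊗ (L²(G¹) ⊗ F)`, for the map `d₀` and the measures `α` on `G¹`,
seen in `L²(G², μ₁) ⊗ F`. -/
noncomputable def canon₀ (A : C_c(𝒢.Pairs, ℂ)) (p : tensor α.int.L2 φ) : tensor α.mu₁.L2 φ :=
  IntegrationMap.canon α.lam₀ α.int α.mu₁ (fun _ => rfl) φ
    (tmul (α.int.mulRep.tensor φ) (α.lam₀.cls A) p)

/-- A vector `A ⊗ p` of `L²(G²) ⊗ (L²(G¹) ⊗ F)`, for the map `d₂` and the measures `α̃` on `G¹`,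
seen in `L²(G², μ₁) ⊗ F`. -/
noncomputable def canonTilde₂ (A : C_c(𝒢.Pairs, ℂ)) (p : tensor α.tildeInt.L2 φ) :
    tensor α.mu₁.L2 φ :=
  IntegrationMap.canon α.lam₂ α.tildeInt α.mu₁ (fun ξ => (α.tildeInt_lam₂ ξ).symm) φ
    (tmul (α.tildeInt.mulRep.tensor φ) (α.lam₂.cls A) p)

lemma canon₂_unit (A : C_c(𝒢.Pairs, ℂ)) (b : C_c(G1, ℂ)) (hb : ∀ q, b (𝒢.d₂ q) * A q = A q)
    (y : F) : canon₂ α φ A (tmul φ (α.int.cls b) y) = tmul φ (α.mu₀.cls A) y :=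
  canon_tmul_of_unit α.lam₂ α.int α.mu₀ _ φ A b hb y

lemma canonTilde₂_unit (A : C_c(𝒢.Pairs, ℂ)) (b : C_c(G1, ℂ))
    (hb : ∀ q, b (𝒢.d₂ q) * A q = A q) (y : F) :
    canonTilde₂ α φ A (tmul φ (α.tildeInt.cls b) y) = tmul φ (α.mu₁.cls A) y :=
  canon_tmul_of_unit α.lam₂ α.tildeInt α.mu₁ _ φ A b hb y

lemma pullback₂_canonTilde₂ (A : C_c(𝒢.Pairs, ℂ)) (p : tensor α.tildeInt.L2 φ) :
    pullback₂ α φ U hU (canonTilde₂ α φ A p) = canon₂ α φ A (U p) :=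
  pullback_canon_tmul α.lam₂ α.tildeInt α.int α.mu₁ α.mu₀ _ _ φ U hU A p

lemma pullback₁_unit (A : C_c(𝒢.Pairs, ℂ)) (b : C_c(G1, ℂ)) (hb : ∀ q, b (𝒢.d₁ q) * A q = A q)
    (y : F) : pullback₁ α φ U hU (tmul φ (α.mu₂.cls A) y)
      = canon₁ α φ A (U (tmul φ (α.tildeInt.cls b) y)) :=
  (congrArg (pullback₁ α φ U hU)
    (canon_tmul_of_unit α.lam₁ α.tildeInt α.mu₂ (fun ξ => (α.tildeInt_lam₁ ξ).symm) φ A b hb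
      y).symm).trans
    (pullback_canon_tmul α.lam₁ α.tildeInt α.int α.mu₂ α.mu₀ _ _ φ U hU A _)

lemma pullback₀_unit (A : C_c(𝒢.Pairs, ℂ)) (b : C_c(G1, ℂ)) (hb : ∀ q, b (𝒢.d₀ q) * A q = A q)
    (y : F) : pullback₀ α φ U hU (tmul φ (α.mu₂.cls A) y)
      = canon₀ α φ A (U (tmul φ (α.tildeInt.cls b) y)) :=
  (congrArg (pullback₀ α φ U hU)
    (canon_tmul_of_unit α.lam₀ α.tildeInt α.mu₂ (fun _ => rfl) φ A b hb y).symm).trans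
    (pullback_canon_tmul α.lam₀ α.tildeInt α.int α.mu₂ α.mu₁ _ _ φ U hU A _)

lemma inner_canonTilde₂_canon₀ (A₁ A₂ : C_c(𝒢.Pairs, ℂ)) (a₁ a₂ : C_c(G1, ℂ))
    (hA : ∀ q, star (A₁ q) * A₂ q = a₁ (𝒢.d₂ q) * a₂ (𝒢.d₀ q)) (p : tensor α.tildeInt.L2 φ)
    (q : tensor α.int.L2 φ) :
    (tensor α.mu₁.L2 φ).inner (canonTilde₂ α φ A₁ p) (canon₀ α φ A₂ q)
      = F.inner (annihilate φ (α.tildeInt.cls a₁) p) (annihilate φ (α.int.cls (star a₂)) q) :=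
  inner_canon_canon α.lam₂ α.lam₀ α.tildeInt α.int α.mu₁ _ _ φ α.mu₁_of_mul A₁ A₂ a₁ a₂ hA p q

lemma inner_canon₂_canon₁ (A₁ A₂ : C_c(𝒢.Pairs, ℂ)) (a₁ a₂ : C_c(G1, ℂ))
    (hA : ∀ q, star (A₁ q) * A₂ q = a₁ (𝒢.d₂ q) * a₂ (𝒢.d₁ q)) (p q : tensor α.int.L2 φ) :
    (tensor α.mu₀.L2 φ).inner (canon₂ α φ A₁ p) (canon₁ α φ A₂ q)
      = F.inner (annihilate φ (α.int.cls a₁) p) (annihilate φ (α.int.cls (star a₂)) q) :=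
  inner_canon_canon α.lam₂ α.lam₁ α.int α.int α.mu₀ _ _ φ α.mu₀_of_mul A₁ A₂ a₁ a₂ hA p q

variable (L : C_c(G1, ℂ) → F →L[ℂ] F)
  (hL : ∀ η ξ x, annihilate φ (α.int.cls η) (U (tmul φ (α.tildeInt.cls ξ) x)) = L (star η * ξ) x)

include hL

/-- The matrix coefficients of `U⁻¹`. -/
lemma annihilate_symm (a b : C_c(G1, ℂ)) (y z : F) :
    F.inner (annihilate φ (α.tildeInt.cls a) (U.symm (tmul φ (α.int.cls b) y))) z
      = F.inner y (L (star b * a) z) := by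
  rw [inner_annihilate_left, Unitary.inner_symm_left, ← inner_annihilate, hL]

/-- The matrix coefficients of `d₂*(U) d₀*(U)` are products of matrix coefficients of `U`. -/
lemma inner_pullback₂_pullback₀ (u₁ u₂ v₁ v₂ : C_c(G1, ℂ)) (x y : F) :
    (tensor α.mu₀.L2 φ).inner (tmul φ (α.mu₀.cls (boxTimes 𝒢 v₁ v₂)) y)
        (pullback₂ α φ U hU (pullback₀ α φ U hU (tmul φ (α.mu₂.cls (boxTimes 𝒢 u₁ u₂)) x)))
      = F.inner y (L (star v₁ * u₁) (L (star v₂ * u₂) x)) := by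
  obtain ⟨b, hb, -⟩ := exists_common_unit v₁ v₁
  obtain ⟨b', hb', -⟩ := exists_common_unit u₂ u₂
  have hb1 : ∀ g, b g * v₁ g = v₁ g := fun g => DFunLike.congr_fun hb g
  have hb1' : ∀ g, b' g * u₂ g = u₂ g := fun g => DFunLike.congr_fun hb' g
  have hb2 : star (star v₁ * u₁) * b = star u₁ * v₁ := by
    rw [star_mul', star_star, mul_comm v₁, mul_assoc, mul_comm v₁, hb]
  have hb2' : star v₂ * u₂ * b' = star v₂ * u₂ := by
    rw [mul_assoc, mul_comm u₂, hb']
  rw [← canon₂_unit α φ (boxTimes 𝒢 v₁ v₂) b (fun q => by rw [boxTimes_apply, ← mul_assoc, hb1]),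
    pullback₀_unit α φ U hU (boxTimes 𝒢 u₁ u₂) b'
      (fun q => by rw [boxTimes_apply, mul_left_comm, hb1']),
    ← U.apply_symm_apply (tmul φ (α.int.cls b) y), ← pullback₂_canonTilde₂ α φ U hU,
    Isometry.inner_map,
    inner_canonTilde₂_canon₀ α φ _ _ (star v₁ * u₁) (star v₂ * u₂) (fun q => by
      simp only [boxTimes_apply, star_mul', CompactlySupportedContinuousMap.mul_apply,
        CompactlySupportedContinuousMap.star_apply]
      ring), annihilate_symm α φ U L hL, hL, star_star, hb2']
  rw [show star b * (star v₁ * u₁) = star v₁ * u₁ by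
    rw [← mul_assoc]; exact congrArg (· * u₁) ((star_mul' b v₁).symm.trans (congrArg star hb))]

/-- The matrix coefficients of `d₁*(U)` are matrix coefficients of `U` at convolutions. -/
lemma inner_pullback₁ (u₁ u₂ v₁ v₂ : C_c(G1, ℂ)) (x y : F) :
    (tensor α.mu₀.L2 φ).inner (tmul φ (α.mu₀.cls (boxTimes 𝒢 v₁ v₂)) y)
        (pullback₁ α φ U hU (tmul φ (α.mu₂.cls (boxTimes 𝒢 u₁ u₂)) x))
      = F.inner y (L (convolution α (star v₁ * u₁) (star v₂ * u₂)) x) := by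
  have h : star (boxTimes 𝒢 v₁ v₂) * boxTimes 𝒢 u₁ u₂
      = boxTimes 𝒢 (star v₁ * u₁) (star v₂ * u₂) := by
    ext q
    simp only [CompactlySupportedContinuousMap.mul_apply,
      CompactlySupportedContinuousMap.star_apply, boxTimes_apply, star_mul']
    ring
  rw [convolution, ← h]
  exact inner_pullback α.lam₁ α.tildeInt α.int α.mu₂ α.mu₀ _ _ φ U hU L hL _ _ x y

lemma inner_pullback₀ (A A' : C_c(𝒢.Pairs, ℂ)) (x y : F) :
    (tensor α.mu₁.L2 φ).inner (tmul φ (α.mu₁.cls A') y)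
        (pullback₀ α φ U hU (tmul φ (α.mu₂.cls A) x))
      = F.inner y (L (α.lam₀ (star A' * A)) x) :=
  inner_pullback α.lam₀ α.tildeInt α.int α.mu₂ α.mu₁ _ _ φ U hU L hL _ _ x y

/-- The cocycle identity for `U` says that its matrix coefficients are multiplicative for the
convolution. -/
lemma cocycle_iff :
    (∀ x, pullback₁ α φ U hU x = pullback₂ α φ U hU (pullback₀ α φ U hU x)) ↔
      ∀ f₁ f₂ x, L (convolution α f₁ f₂) x = L f₁ (L f₂ x) := by
  constructor
  · intro h f₁ f₂ x
    refine F.ext_inner fun y => ?_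
    obtain ⟨e₁, h1, -⟩ := exists_common_unit (star f₁) f₁
    obtain ⟨e₂, h2, -⟩ := exists_common_unit (star f₂) f₂
    have h1' : star e₁ * f₁ = f₁ := by
      have := congrArg star h1
      rwa [star_mul', star_star] at this
    have h2' : star e₂ * f₂ = f₂ := by
      have := congrArg star h2
      rwa [star_mul', star_star] at this
    have h3 := inner_pullback₁ α φ U hU L hL f₁ f₂ e₁ e₂ x y
    rw [h, inner_pullback₂_pullback₀ α φ U hU L hL, h1', h2'] at h3
    exact h3.symm
  · intro h x
    have hid : Dense (Submodule.span ℂ (Set.range (id : F → F)) : Set F) := by simp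
    have hd₂ := dense_tmul_of_dense φ
      (fun p : C_c(G1, ℂ) × C_c(G1, ℂ) => α.mu₂.cls (boxTimes 𝒢 p.1 p.2)) (id : F → F)
      (dense_cls_fiberBox (b := 𝒢.s) (p := 𝒢.r) α.mu₂) hid
    have hd₀ := dense_tmul_of_dense φ
      (fun p : C_c(G1, ℂ) × C_c(G1, ℂ) => α.mu₀.cls (boxTimes 𝒢 p.1 p.2)) (id : F → F)
      (dense_cls_fiberBox (b := 𝒢.s) (p := 𝒢.r) α.mu₀) hid
    refine eq_of_generators (E := tensor α.mu₂.L2 φ) (F := tensor α.mu₀.L2 φ) _ hd₂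
      (S := (pullback₁ α φ U hU).toCLM)
      (T := (pullback₂ α φ U hU).toCLM.comp (pullback₀ α φ U hU).toCLM) (fun p => ?_) x
    refine HilbertModule.ext_inner_of_dense _ hd₀ fun q => ?_
    exact (inner_pullback₁ α φ U hU L hL p.1.1 p.1.2 q.1.1 q.1.2 p.2 q.2).trans
      ((congrArg (F.inner q.2) (h _ _ _)).trans
        (inner_pullback₂_pullback₀ α φ U hU L hL p.1.1 p.1.2 q.1.1 q.1.2 p.2 q.2).symm)

/-- The cocycle identity in the form `d₀*(U) = d₂*(U)⁻¹ d₁*(U)` gives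
`L(f₁)* L(f₂) = L(f₁* * f₂)`. -/
lemma inner_coefficient
    (h : ∀ x, pullback₁ α φ U hU x = pullback₂ α φ U hU (pullback₀ α φ U hU x))
    (f₁ f₂ : C_c(G1, ℂ)) (x y : F) :
    F.inner (L f₁ y) (L f₂ x) = F.inner y (L (convolution α (involution 𝒢 f₁) f₂) x) := by
  obtain ⟨e₁, h1, h1'⟩ := exists_common_unit (star f₁) f₁
  obtain ⟨e₂, h2, h2'⟩ := exists_common_unit (star f₂) f₂
  have h2'' : star e₂ * f₂ = f₂ := by
    have := congrArg star h2
    rwa [star_mul', star_star] at this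
  have he1 : ∀ g, e₁ g * f₁ g = f₁ g := fun g => DFunLike.congr_fun h1' g
  have he1' : ∀ g, e₁ g * star (f₁ g) = star (f₁ g) := fun g => DFunLike.congr_fun h1 g
  have he2 : ∀ g, e₂ g * f₂ g = f₂ g := fun g => DFunLike.congr_fun h2' g
  have he2' : ∀ g, star (e₂ g) * f₂ g = f₂ g := fun g => DFunLike.congr_fun h2'' g
  have hA : ∀ q, star (boxComp 𝒢 f₁ e₂ q) * boxComp 𝒢 e₁ f₂ q
      = star (f₁ (𝒢.d₂ q)) * f₂ (𝒢.d₁ q) := fun q => by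
    rw [boxComp_apply, boxComp_apply, star_mul']
    calc _ = (e₁ (𝒢.d₂ q) * star (f₁ (𝒢.d₂ q))) * (star (e₂ (𝒢.d₁ q)) * f₂ (𝒢.d₁ q)) := by ring
      _ = _ := by rw [he1', he2']
  have h3 := inner_canon₂_canon₁ α φ (boxComp 𝒢 f₁ e₂) (boxComp 𝒢 e₁ f₂) (star f₁) f₂
    hA (U (tmul φ (α.tildeInt.cls e₁) y)) (U (tmul φ (α.tildeInt.cls e₂) x))
  rw [hL, hL, star_star, star_star, mul_comm f₁, mul_comm f₂, h1', h2',
    ← pullback₂_canonTilde₂ α φ U hU, ← pullback₁_unit α φ U hU _ e₂ (fun q => by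
      rw [boxComp_apply, mul_left_comm, he2]), h, Isometry.inner_map,
    canonTilde₂_unit α φ _ e₁ (fun q => by rw [boxComp_apply, ← mul_assoc, he1]),
    inner_pullback₀ α φ U hU L hL] at h3
  rw [← h3, α.lam₀_of_comp f₁ f₂ _ hA]

end Cocycle

/-! ### The I-norm and the range of the Haar system -/

section Norms

variable {X Y : Type u} [TopologicalSpace X] [TopologicalSpace Y]

/-- Compactly supported functions are dense in `C₀(X)`. -/
lemma exists_norm_sub_toC₀_le [T2Space X] [LocallyCompactSpace X] (a : C₀(X, ℂ)) {ε : ℝ}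
    (hε : 0 < ε) : ∃ b : C_c(X, ℂ), ‖a - toC₀ b‖ ≤ ε := by
  obtain ⟨K, hK, hK'⟩ : ∃ K : Set X, IsCompact K ∧ ∀ x ∉ K, ‖a x‖ < ε := by
    have h := a.zero_at_infty'.norm
    rw [norm_zero] at h
    have h1 := h.eventually (gt_mem_nhds hε)
    rw [Filter.Eventually, Filter.mem_cocompact] at h1
    obtain ⟨K, hK, hK'⟩ := h1
    exact ⟨K, hK, fun x hx => hK' hx⟩
  obtain ⟨χ, hχ, hχ'⟩ := exists_unit_bump hK
  refine ⟨(a : C(X, ℂ)) • χ, ?_⟩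
  rw [← ZeroAtInftyContinuousMap.norm_toBCF_eq_norm]
  refine (BoundedContinuousFunction.norm_le hε.le).2 fun x => ?_
  change ‖a x - a x * χ x‖ ≤ ε
  by_cases hx : x ∈ K
  · rw [hχ x hx]
    simpa using hε.le
  · obtain ⟨t, h0, h1, ht⟩ := hχ' x
    have h2 : a x - a x * χ x = a x * ((1 - t : ℝ) : ℂ) := by rw [ht]; push_cast; ring
    rw [h2, norm_mul, Complex.norm_real, Real.norm_of_nonneg (by linarith)]
    nlinarith [hK' x hx, norm_nonneg (a x)]

/-- A compactly supported function `f` is `conj f₁ · f₂` with `|f₁|² = |f₂|² = |f|`, namely for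
`f₁ = √|f|` and `f₂ = f / √|f|`. -/
lemma exists_factorization (f : C_c(X, ℂ)) : ∃ f₁ f₂ : C_c(X, ℂ), star f₁ * f₂ = f ∧
    (∀ x, (star f₁ * f₁) x = (‖f x‖ : ℂ)) ∧ ∀ x, (star f₂ * f₂) x = (‖f x‖ : ℂ) := by
  have hf := f.continuous
  have hf₁ : Continuous fun x => ((√‖f x‖ : ℝ) : ℂ) := by fun_prop
  have hn : ∀ x, ‖f x / ((√‖f x‖ : ℝ) : ℂ)‖ = √‖f x‖ := fun x => by
    rw [norm_div, Complex.norm_real, Real.norm_of_nonneg (Real.sqrt_nonneg _), Real.div_sqrt]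
  have hf₂ : Continuous fun x => f x / ((√‖f x‖ : ℝ) : ℂ) := by
    refine continuous_iff_continuousAt.2 fun x => ?_
    by_cases hx : f x = 0
    · -- at a zero of `f` the quotient tends to zero because its norm is `√|f|`
      rw [ContinuousAt, hx, zero_div, tendsto_zero_iff_norm_tendsto_zero]
      simp only [hn]
      have : Continuous fun x => √‖f x‖ := by fun_prop
      have h := this.tendsto x
      rwa [hx, norm_zero, Real.sqrt_zero] at h
    · refine hf.continuousAt.div hf₁.continuousAt ?_
      rw [Complex.ofReal_ne_zero]
      exact (Real.sqrt_pos.2 (norm_pos_iff.2 hx)).ne'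
  refine ⟨⟨⟨_, hf₁⟩, f.hasCompactSupport'.mono fun x hx => ?_⟩,
    ⟨⟨_, hf₂⟩, f.hasCompactSupport'.mono fun x hx => ?_⟩, ?_, fun x => ?_, fun x => ?_⟩
  · contrapose! hx
    have : f x = 0 := by simpa using hx
    simp [this]
  · contrapose! hx
    have : f x = 0 := by simpa using hx
    simp [this]
  · ext x
    change star ((√‖f x‖ : ℝ) : ℂ) * (f x / ((√‖f x‖ : ℝ) : ℂ)) = f x
    rw [RCLike.star_def, Complex.conj_ofReal]
    by_cases hx : f x = 0
    · simp [hx]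
    · refine mul_div_cancel₀ _ ?_
      rw [Complex.ofReal_ne_zero]
      exact (Real.sqrt_pos.2 (norm_pos_iff.2 hx)).ne'
  · change star ((√‖f x‖ : ℝ) : ℂ) * ((√‖f x‖ : ℝ) : ℂ) = _
    rw [RCLike.star_def, Complex.conj_ofReal, ← Complex.ofReal_mul,
      Real.mul_self_sqrt (norm_nonneg _)]
  · change star (f x / ((√‖f x‖ : ℝ) : ℂ)) * (f x / ((√‖f x‖ : ℝ) : ℂ)) = _
    rw [RCLike.star_def, Complex.conj_mul', hn, ← Complex.ofReal_pow,
      Real.sq_sqrt (norm_nonneg _)]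

variable [MeasurableSpace X] [BorelSpace X] [T2Space Y] {p : C(X, Y)} (m : FiberMeasures p)

lemma FiberMeasures.norm_integral_of_eq_norm {ζ f : C_c(X, ℂ)} (h : ∀ x, ζ x = (‖f x‖ : ℂ))
    (y : Y) : ‖m.toIntegrationMap ζ y‖ = ∫ x, ‖f x‖ ∂m.meas y := by
  have h1 : m.toIntegrationMap ζ y = ((∫ x, ‖f x‖ ∂m.meas y : ℝ) : ℂ) := by
    rw [m.toIntegrationMap_apply, ← integral_complex_ofReal]
    exact integral_congr_ae (Eventually.of_forall h)
  rw [h1, Complex.norm_real, Real.norm_of_nonneg (integral_nonneg fun x => norm_nonneg _)]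

lemma FiberMeasures.norm_toC₀_le_iSup {ζ f : C_c(X, ℂ)} (h : ∀ x, ζ x = (‖f x‖ : ℂ)) :
    ‖toC₀ (m.toIntegrationMap ζ)‖ ≤ ⨆ y, ∫ x, ‖f x‖ ∂m.meas y := by
  have h2 := m.norm_integral_of_eq_norm h
  refine norm_toC₀_le _ (Real.iSup_nonneg fun y => integral_nonneg fun x => norm_nonneg _)
    fun y => ?_
  rw [h2]
  refine le_ciSup (f := fun y => ∫ x, ‖f x‖ ∂m.meas y)
    ⟨‖toC₀ (m.toIntegrationMap ζ)‖, ?_⟩ y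
  rintro _ ⟨y, rfl⟩
  refine (h2 y).symm.trans_le ?_
  exact norm_apply_le_norm_toC₀ _ y

lemma FiberMeasures.iSup_integral_norm_le {η f : C_c(X, ℂ)} (h : Dominates η f) :
    ⨆ y, ∫ x, ‖f x‖ ∂m.meas y ≤ ‖toC₀ (m.toIntegrationMap η)‖ := by
  obtain ⟨f₁, f₂, -, hζ, -⟩ := exists_factorization f
  refine Real.iSup_le (fun y => ?_) (norm_nonneg _)
  rw [← m.norm_integral_of_eq_norm hζ y]
  have h1 : Dominates η (star f₁ * f₁) := fun x => by
    obtain ⟨t, ht, hx⟩ := h x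
    refine ⟨t, ?_, hx⟩
    rw [hζ, Complex.norm_real, norm_norm]
    exact ht
  exact ((h1.integrate m.toIntegrationMap).norm_le y).trans (norm_apply_le_norm_toC₀ _ y)

end Norms

section Integrate

variable {G0 G1 : Type u} [TopologicalSpace G0] [TopologicalSpace G1]
  [T2Space G0] [T2Space G1] [LocallyCompactSpace G1]
  [MeasurableSpace G1] [BorelSpace G1] {𝒢 : TopGroupoid G0 G1} (α : HaarSystem 𝒢)

/-- Every compactly supported function on the objects is `α(f)` for some `f`. -/
lemma HaarSystem.exists_int_eq (a : C_c(G0, ℂ)) : ∃ f : C_c(G1, ℂ), α.int f = a := by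
  obtain ⟨χ, hχ⟩ := exists_bump (a.hasCompactSupport'.isCompact.image 𝒢.unit.continuous)
  set h := α.int (star χ * χ) with hh
  -- the Haar measures have full support
  have hpos : ∀ x ∈ tsupport a, h x ≠ 0 := by
    intro x hx
    have h1 : h x = ((∫ g, ‖χ g‖ ^ 2 ∂α.meas x : ℝ) : ℂ) := by
      rw [hh, α.int_apply, ← integral_complex_ofReal]
      refine integral_congr_ae (Eventually.of_forall fun g => ?_)
      simp [Complex.conj_mul']
    rw [h1, Complex.ofReal_ne_zero]
    have hint : Integrable (fun g => ‖χ g‖ ^ 2) (α.meas x) :=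
      (by have := χ.continuous; fun_prop : Continuous fun g => ‖χ g‖ ^ 2).integrable_of_hasCompactSupport
        (χ.hasCompactSupport'.comp_left (g := fun z : ℂ => ‖z‖ ^ 2) (by simp))
    refine ((integral_pos_iff_support_of_nonneg (fun g => by positivity) hint).2 ?_).ne'
    have h2 := α.full_support (𝒢.unit x) {g | χ g ≠ 0}
      (isOpen_ne_fun χ.continuous continuous_const) (by
        change χ (𝒢.unit x) ≠ 0
        rw [hχ _ ⟨x, hx, rfl⟩]
        exact one_ne_zero)
    rw [𝒢.r_unit] at h2
    refine h2.trans_eq ?_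
    congr 1
    ext g
    simp
  have hc : Continuous fun x => a x / h x := by
    refine continuous_iff_continuousAt.2 fun x => ?_
    by_cases hx : x ∈ tsupport a
    · exact a.continuous.continuousAt.div h.continuous.continuousAt (hpos x hx)
    · have h1 : ∀ᶠ y in 𝓝 x, a y = 0 :=
        Filter.mem_of_superset ((isClosed_tsupport a).isOpen_compl.mem_nhds hx) fun y hy =>
          image_eq_zero_of_notMem_tsupport hy
      refine (continuousAt_const (y := (0 : ℂ))).congr (h1.mono fun y hy => ?_)
      simp [hy]
  refine ⟨((⟨_, hc⟩ : C(G0, ℂ)).comp 𝒢.r) • (star χ * χ), ?_⟩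
  rw [α.int.map_smul_comp]
  ext x
  change a x / h x * h x = a x
  by_cases hx : x ∈ tsupport a
  · exact div_mul_cancel₀ _ (hpos x hx)
  · rw [image_eq_zero_of_notMem_tsupport hx, zero_div, zero_mul]

lemma IntegrationMap.act_cls {X Y : Type u} [TopologicalSpace X] [TopologicalSpace Y]
    {f : C(X, Y)} (I : IntegrationMap f) (ξ : C_c(X, ℂ)) (a : C₀(Y, ℂ)) :
    I.L2.act (I.cls ξ) a = I.cls (((a : C(Y, ℂ)).comp f) • ξ) :=
  I.preL2.complAct_coe (I.preL2.toSpace ξ) a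

lemma exists_star_unit {X : Type u} [TopologicalSpace X] [T2Space X] [LocallyCompactSpace X]
    (f : C_c(X, ℂ)) : ∃ e : C_c(X, ℂ), star e * f = f := by
  obtain ⟨e, he, -⟩ := exists_common_unit (star f) f
  refine ⟨e, ?_⟩
  have := congrArg star he
  rwa [star_mul', star_star] at this

/-! ### The integrated form of a groupoid representation -/

variable {α}
variable {D : Type u} [NonUnitalCStarAlgebra D] {F : HilbertModule D}

namespace GroupoidRepr

variable (R : GroupoidRepr α F)

/-- The operators `L(f)` with `T_η* U T_ξ = L(conj η · ξ)`, the integrated form of the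
representation. -/
noncomputable def coefficient : C_c(G1, ℂ) →ₗ[ℂ] (F →L[ℂ] F) :=
  (exists_coefficient α.tildeInt α.int R.φ.toStarRep R.U R.intertwines).choose

lemma annihilate_U_tmul (η ξ : C_c(G1, ℂ)) (x : F) :
    annihilate R.φ.toStarRep (α.int.cls η) (R.U (tmul R.φ.toStarRep (α.tildeInt.cls ξ) x))
      = R.coefficient (star η * ξ) x :=
  (exists_coefficient α.tildeInt α.int R.φ.toStarRep R.U R.intertwines).choose_spec η ξ x

lemma coefficient_convolution (f₁ f₂ : C_c(G1, ℂ)) (x : F) :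
    R.coefficient (convolution α f₁ f₂) x = R.coefficient f₁ (R.coefficient f₂ x) :=
  (cocycle_iff α R.φ.toStarRep R.U R.intertwines R.coefficient R.annihilate_U_tmul).1
    R.cocycle f₁ f₂ x

lemma inner_coefficient_coefficient (f₁ f₂ : C_c(G1, ℂ)) (x y : F) :
    F.inner (R.coefficient f₁ y) (R.coefficient f₂ x)
      = F.inner y (R.coefficient (convolution α (involution 𝒢 f₁) f₂) x) :=
  inner_coefficient α R.φ.toStarRep R.U R.intertwines R.coefficient R.annihilate_U_tmul
    R.cocycle f₁ f₂ x y

/-- Integrated forms are contractive for the `I`-norm: factor `f = conj f₁ · f₂` with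
`|f₁|² = |f₂|² = |f|`. -/
lemma norm_coefficient_le (f : C_c(G1, ℂ)) : ‖R.coefficient f‖ ≤ INorm α f := by
  obtain ⟨f₁, f₂, hf, h₁, h₂⟩ := exists_factorization f
  have e : R.coefficient f = sandwich α.tildeInt α.int R.φ.toStarRep R.U f₁ f₂ := by
    ext x
    rw [sandwich_apply, annihilate_U_tmul, hf]
  have n₁ : ‖α.int.cls f₁‖ ^ 2 ≤ INorm α f := by
    rw [α.int.norm_cls_sq]
    exact (α.toFiberMeasures.norm_toC₀_le_iSup h₁).trans (le_max_left _ _)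
  have n₂ : ‖α.tildeInt.cls f₂‖ ^ 2 ≤ INorm α f := by
    rw [α.tildeInt.norm_cls_sq]
    exact (α.tilde.norm_toC₀_le_iSup h₂).trans (le_max_right _ _)
  rw [e]
  refine (norm_sandwich_le _ _ _ _ _ _).trans ?_
  nlinarith [sq_nonneg (‖α.int.cls f₁‖ - ‖α.tildeInt.cls f₂‖)]

/-- `φ(a) L(f) = L((a ∘ r) f)`. -/
lemma φ_coefficient (a : C₀(G0, ℂ)) (f : C_c(G1, ℂ)) (x : F) :
    R.φ a (R.coefficient f x) = R.coefficient (((a : C(G0, ℂ)).comp 𝒢.r) • f) x := by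
  obtain ⟨e, he⟩ := exists_star_unit f
  have h := R.annihilate_U_tmul e f x
  rw [he] at h
  rw [← h, rep_annihilate, IntegrationMap.act_cls, annihilate_U_tmul]
  congr 2
  nth_rewrite 2 [← he]
  ext g
  simp
  ring

variable [LocallyCompactSpace G0]

/-- The integrated form is nondegenerate: `U` is surjective, so the vectors `L(f) x` span the ranges
of all annihilation operators, and these contain the vectors `φ(α(f)) x`. -/
lemma dense_coefficient :
    Dense (Submodule.span ℂ {y : F | ∃ f x, R.coefficient f x = y} : Set F) := by
  set S := Submodule.span ℂ {y : F | ∃ f x, R.coefficient f x = y} with hS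
  have hcl : IsClosed (S.topologicalClosure : Set F) := S.isClosed_topologicalClosure
  have h1 : ∀ η t, annihilate R.φ.toStarRep (α.int.cls η) t ∈ S.topologicalClosure := by
    intro η t
    obtain ⟨t, rfl⟩ := R.U.surjective t
    let T : tensor α.tildeInt.L2 R.φ.toStarRep →L[ℂ] F :=
      (annihilate R.φ.toStarRep (α.int.cls η)).comp R.U.toCLM
    have hd := dense_tmul_of_dense R.φ.toStarRep (fun ξ => α.tildeInt.cls ξ) (id : F → F)
      α.tildeInt.dense_cls (by simp)
    have hle : Submodule.span ℂ (Set.range fun p : C_c(G1, ℂ) × F =>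
        tmul R.φ.toStarRep (α.tildeInt.cls p.1) (id p.2))
        ≤ S.topologicalClosure.comap (T : _ →ₗ[ℂ] F) := by
      rw [Submodule.span_le]
      rintro _ ⟨p, rfl⟩
      exact S.le_topologicalClosure (Submodule.subset_span ⟨star η * p.1, p.2,
        (R.annihilate_U_tmul η p.1 p.2).symm⟩)
    have : t ∈ closure (Submodule.span ℂ (Set.range fun p : C_c(G1, ℂ) × F =>
        tmul R.φ.toStarRep (α.tildeInt.cls p.1) (id p.2)) : Set _) := hd t
    exact closure_minimal hle (hcl.preimage T.continuous) this
  have h2 : ∀ (b : C_c(G0, ℂ)) x, R.φ (toC₀ b) x ∈ S.topologicalClosure := by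
    intro b x
    obtain ⟨f, rfl⟩ := α.exists_int_eq b
    obtain ⟨e, he⟩ := exists_star_unit f
    have h := h1 e (tmul R.φ.toStarRep (α.int.cls f) x)
    rwa [annihilate_tmul, α.int.inner_cls, he] at h
  have h3 : ∀ a x, R.φ a x ∈ S.topologicalClosure := by
    intro a x
    rw [← SetLike.mem_coe, ← hcl.closure_eq, Metric.mem_closure_iff]
    intro ε hε
    obtain ⟨b, hb⟩ := exists_norm_sub_toC₀_le a (ε := ε / (‖x‖ + 1)) (by positivity)
    refine ⟨_, h2 b x, ?_⟩
    rw [dist_eq_norm, ← _root_.sub_apply, ← map_sub]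
    refine (norm_rep_le R.φ.toStarRep _ x).trans_lt ?_
    calc ‖a - toC₀ b‖ * ‖x‖ ≤ ε / (‖x‖ + 1) * ‖x‖ := by gcongr
      _ < ε / (‖x‖ + 1) * (‖x‖ + 1) := by gcongr; linarith
      _ = ε := by field_simp
  have h4 : Submodule.span ℂ {y : F | ∃ a x, R.φ a x = y} ≤ S.topologicalClosure := by
    rw [Submodule.span_le]
    rintro _ ⟨a, x, rfl⟩
    exact h3 a x
  have h5 : Dense (S.topologicalClosure : Set F) := R.φ.nondegenerate.mono h4
  rwa [Submodule.topologicalClosure_coe, dense_closure] at h5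

lemma dense_range_coefficient :
    Dense (Submodule.span ℂ (Set.range fun p : C_c(G1, ℂ) × F => R.coefficient p.1 p.2) :
      Set F) := by
  convert R.dense_coefficient using 4
  ext y
  simp

lemma coefficient_adjoint (f : C_c(G1, ℂ)) (x y : F) :
    F.inner (R.coefficient (involution 𝒢 f) x) y = F.inner x (R.coefficient f y) := by
  rw [← F.star_inner y, ← F.star_inner (R.coefficient f y)]
  congr 1
  -- test on the total set of vectors `L(f') z`
  have h : F.innerCLM (R.coefficient f y) = (F.innerCLM y).comp (R.coefficient (involution 𝒢 f)) :=
    ContinuousLinearMap.ext_on R.dense_coefficient (by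
      rintro _ ⟨f', z, rfl⟩
      exact (R.inner_coefficient_coefficient f f' z y).trans
        (congrArg (F.inner y) (R.coefficient_convolution _ _ _)))
  exact (congrArg (fun T => T x) h).symm

end GroupoidRepr

/-- Representations of `C*(G, α)` are determined on compactly supported functions. -/
lemma Rep.ext_conv {π ρ : Rep (GroupoidCStar α) F}
    (h : ∀ f : C_c(G1, ℂ), π ((maxSeminorm α).toComplHom (Conv.of α f))
      = ρ ((maxSeminorm α).toComplHom (Conv.of α f))) : π = ρ := by
  refine Rep.ext_apply fun a x => ?_
  refine (maxSeminorm α).denseRange_toComplHom.induction_on (p := fun a => π a x = ρ a x) a ?_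
    fun f => ?_
  · exact isClosed_eq (π.toStarRep.continuous.clm_apply continuous_const)
      (ρ.toStarRep.continuous.clm_apply continuous_const)
  · exact congrArg (fun T => T x) (h ((Conv.of α).symm f))

variable [LocallyCompactSpace G0]

lemma GroupoidRepr.exists_integrate (R : GroupoidRepr α F) : ∃ π : Rep (GroupoidCStar α) F,
    ∀ f, π ((maxSeminorm α).toComplHom (Conv.of α f)) = R.coefficient f := by
  obtain ⟨π, hπ⟩ := exists_starRep_of_INorm_le α
    { toFun := fun f => R.coefficient ((Conv.of α).symm f)
      map_smul' := fun c f => R.coefficient.map_smul c _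
      map_zero' := R.coefficient.map_zero
      map_add' := fun f g => R.coefficient.map_add _ _
      map_mul' := fun f g => ContinuousLinearMap.ext fun x => R.coefficient_convolution _ _ x }
    (fun f x y => R.coefficient_adjoint _ x y) R.norm_coefficient_le
  refine ⟨⟨π, R.dense_coefficient.mono (Submodule.span_mono ?_)⟩, fun f => hπ (Conv.of α f)⟩
  rintro _ ⟨f, x, rfl⟩
  exact ⟨_, x, congrArg (fun T => T x) (hπ (Conv.of α f))⟩

/-- The integrated form of a representation of `(G, α)`, a representation of `C*(G, α)`. -/
noncomputable def GroupoidRepr.integrate (R : GroupoidRepr α F) : Rep (GroupoidCStar α) F :=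
  R.exists_integrate.choose

lemma GroupoidRepr.integrate_toComplHom (R : GroupoidRepr α F) (f : C_c(G1, ℂ)) :
    R.integrate ((maxSeminorm α).toComplHom (Conv.of α f)) = R.coefficient f :=
  R.exists_integrate.choose_spec f

/-! ### Naturality of the integrated form -/

lemma GroupoidRepr.intertwines_integrate_iff {F₁ F₂ : HilbertModule D} (V : Isometry F₁ F₂)
    (R₁ : GroupoidRepr α F₁) (R₂ : GroupoidRepr α F₂) :
    Rep.Intertwines V R₁.integrate R₂.integrate ↔
      ∀ f x, V (R₁.coefficient f x) = R₂.coefficient f (V x) := by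
  constructor
  · intro h f x
    have := h ((maxSeminorm α).toComplHom (Conv.of α f)) x
    rwa [R₁.integrate_toComplHom, R₂.integrate_toComplHom] at this
  · intro h b x
    refine (maxSeminorm α).denseRange_toComplHom.induction_on
      (p := fun b => V (R₁.integrate b x) = R₂.integrate b (V x)) b ?_ fun f => ?_
    · exact isClosed_eq
        (V.continuous.comp (R₁.integrate.toStarRep.continuous.clm_apply continuous_const))
        (R₂.integrate.toStarRep.continuous.clm_apply continuous_const)
    · have := h ((Conv.of α).symm f) x
      rwa [← R₁.integrate_toComplHom, ← R₂.integrate_toComplHom] at this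

/-- An isometry intertwines two representations of `(G, α)` if and only if it intertwines their
integrated forms. -/
theorem GroupoidRepr.intertwines_iff {F₁ F₂ : HilbertModule D} (V : Isometry F₁ F₂)
    (R₁ : GroupoidRepr α F₁) (R₂ : GroupoidRepr α F₂) :
    Rep.Intertwines V R₁.integrate R₂.integrate ↔ GroupoidRepr.Intertwines V R₁ R₂ := by
  rw [intertwines_integrate_iff]
  constructor
  · intro h
    have hφ : ∀ (a : C₀(G0, ℂ)) x, V (R₁.φ a x) = R₂.φ a (V x) := by
      intro a
      refine eq_of_generators (S := V.toLI.toContinuousLinearMap.comp (R₁.φ a))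
        (T := (R₂.φ a).comp V.toLI.toContinuousLinearMap) _ R₁.dense_range_coefficient
        fun p => ?_
      change V (R₁.φ a (R₁.coefficient p.1 p.2)) = R₂.φ a (V (R₁.coefficient p.1 p.2))
      rw [R₁.φ_coefficient, h, h, R₂.φ_coefficient]
    refine ⟨hφ, fun x => ?_⟩
    refine eq_of_generators
      (S := (V.lTensor α.int.L2 R₁.φ.toStarRep R₂.φ.toStarRep hφ).toLI.toContinuousLinearMap.comp
        R₁.U.toCLM)
      (T := R₂.U.toCLM.comp
        (V.lTensor α.tildeInt.L2 R₁.φ.toStarRep R₂.φ.toStarRep hφ).toLI.toContinuousLinearMap)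
      _ (dense_tmul_of_dense R₁.φ.toStarRep (fun ξ => α.tildeInt.cls ξ) (id : F₁ → F₁)
        α.tildeInt.dense_cls (by simp)) (fun p => ?_) x
    refine ext_annihilate R₂.φ.toStarRep _ α.int.dense_cls fun η => ?_
    change annihilate _ (α.int.cls η) (V.lTensor α.int.L2 R₁.φ.toStarRep R₂.φ.toStarRep hφ
        (R₁.U (tmul R₁.φ.toStarRep (α.tildeInt.cls p.1) p.2)))
      = annihilate _ (α.int.cls η) (R₂.U (V.lTensor α.tildeInt.L2 R₁.φ.toStarRep R₂.φ.toStarRep hφ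
        (tmul R₁.φ.toStarRep (α.tildeInt.cls p.1) p.2)))
    rw [← Isometry.map_annihilate, R₁.annihilate_U_tmul, Isometry.lTensor_tmul,
      R₂.annihilate_U_tmul, h]
  · rintro ⟨hφ, hU⟩ f x
    obtain ⟨e, he⟩ := exists_star_unit f
    have h₁ := R₁.annihilate_U_tmul e f x
    have h₂ := R₂.annihilate_U_tmul e f (V x)
    rw [he] at h₁ h₂
    rw [← h₁, ← h₂, Isometry.map_annihilate R₁.φ.toStarRep R₂.φ.toStarRep V hφ, hU,
      Isometry.lTensor_tmul]

/-- The identity isometry. -/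
def Isometry.refl (F : HilbertModule D) : Isometry F F := ⟨LinearMap.id, fun _ _ => rfl⟩

lemma GroupoidRepr.eq_of_intertwines_refl {R₁ R₂ : GroupoidRepr α F}
    (h : GroupoidRepr.Intertwines (Isometry.refl F) R₁ R₂) : R₁ = R₂ := by
  obtain ⟨hφ, hU⟩ := h
  obtain ⟨φ₁, U₁, i₁, c₁⟩ := R₁
  obtain ⟨φ₂, U₂, i₂, c₂⟩ := R₂
  obtain rfl : φ₁ = φ₂ := Rep.ext_apply hφ
  have hid : ∀ (M : HilbertModule C₀(G0, ℂ)) (t : tensor M φ₁.toStarRep),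
      (Isometry.refl F).lTensor M φ₁.toStarRep φ₁.toStarRep hφ t = t := by
    intro M t
    refine eq_of_generators (T := ContinuousLinearMap.id ℂ (tensor M φ₁.toStarRep))
      (S := ((Isometry.refl F).lTensor M φ₁.toStarRep φ₁.toStarRep hφ).toLI.toContinuousLinearMap)
      _ (dense_tmul φ₁.toStarRep) (fun p => ?_) t
    exact Isometry.lTensor_tmul M φ₁.toStarRep φ₁.toStarRep _ hφ p.1 p.2
  have hU' : ∀ t, U₁ t = U₂ t := fun t => by
    have := hU t
    simp only [hid] at this
    exact this
  obtain ⟨⟨U₁, _⟩, _⟩ := U₁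
  obtain ⟨⟨U₂, _⟩, _⟩ := U₂
  obtain rfl : U₁ = U₂ := LinearMap.ext hU'
  rfl

lemma GroupoidRepr.integrate_injective :
    Function.Injective (GroupoidRepr.integrate : GroupoidRepr α F → _) := fun R₁ R₂ h =>
  eq_of_intertwines_refl ((intertwines_iff _ R₁ R₂).1 fun b x => by rw [h]; rfl)

/-- The integrated form is compatible with induction. -/
theorem GroupoidRepr.integrate_induce {D' : Type u} [NonUnitalCStarAlgebra D']
    {E : HilbertModule D'} (R : GroupoidRepr α F) (ψ : Rep D E) :
    (R.induce ψ).integrate = R.integrate.tensor ψ.toStarRep := by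
  refine Rep.ext_conv fun f => ?_
  rw [integrate_toComplHom]
  refine ContinuousLinearMap.ext_on (dense_tmul ψ.toStarRep) ?_
  rintro _ ⟨⟨x, z⟩, rfl⟩
  have h1 : R.integrate.tensor ψ.toStarRep ((maxSeminorm α).toComplHom (Conv.of α f))
      (tmul ψ.toStarRep x z) = tmul ψ.toStarRep (R.coefficient f x) z := by
    rw [← R.integrate_toComplHom]
    exact StarRep.tensor_tmul R.integrate.toStarRep ψ.toStarRep _ x z
  obtain ⟨e, he⟩ := exists_star_unit f
  have h2 := (R.induce ψ).annihilate_U_tmul e f (tmul ψ.toStarRep x z)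
  have h3 := R.annihilate_U_tmul e f x
  rw [he] at h2 h3
  have h4 : tmul (R.φ.toStarRep.tensor ψ.toStarRep) (α.tildeInt.cls f) (tmul ψ.toStarRep x z)
      = tensorAssoc α.tildeInt.L2 R.φ.toStarRep ψ.toStarRep
        (tmul ψ.toStarRep (tmul R.φ.toStarRep (α.tildeInt.cls f) x) z) :=
    (tensorAssoc_tmul _ _ _ _ _ _).symm
  refine Eq.trans ?_ h1.symm
  rw [← h2, ← h3, ← annihilate_tensorAssoc]
  refine congrArg (annihilate _ (α.int.cls e)) ?_
  refine (congrArg (R.induce ψ).U h4).trans ?_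
  refine (R.U.induce_assoc R.φ.toStarRep ψ.toStarRep _).trans ?_
  rw [Unitary.rTensor_tmul]

end Integrate

/-! ### Extending actions and families of vectors -/

section Extending

variable {D : Type u} [NonUnitalCStarAlgebra D] {F : HilbertModule D}

/-- The representation `W π W⁻¹`, for a unitary `W`. -/
noncomputable def StarRep.conj {A : Type u} [NonUnitalCStarAlgebra A] {E : HilbertModule D}
    (π : StarRep A E) (W : Unitary E F) : StarRep A F where
  toHom :=
    { toFun := fun a => W.toCLM.comp ((π a).comp W.symm.toCLM)
      map_smul' := fun c a => by
        ext x
        change W (π (c • a) (W.symm x)) = c • W (π a (W.symm x))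
        rw [map_smul, _root_.smul_apply, map_smul]
      map_zero' := by
        ext x
        change W (π 0 (W.symm x)) = 0
        rw [map_zero, _root_.zero_apply, map_zero]
      map_add' := fun a b => by
        ext x
        change W (π (a + b) (W.symm x)) = W (π a (W.symm x)) + W (π b (W.symm x))
        rw [map_add, _root_.add_apply, map_add]
      map_mul' := fun a b => by
        ext x
        change W (π (a * b) (W.symm x)) = W (π a (W.symm (W (π b (W.symm x)))))
        rw [map_mul, W.symm_apply_apply]
        rfl }
  adjoint a x y := by
    change F.inner (W (π (star a) (W.symm x))) y = F.inner x (W (π a (W.symm y)))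
    rw [← W.apply_symm_apply x, ← W.apply_symm_apply y, W.inner_map, W.inner_map,
      W.symm_apply_apply, W.symm_apply_apply]
    exact π.adjoint a _ _

/-- An action by adjointable maps on a pre-Hilbert module extends to every Hilbert module in which
the pre-Hilbert module has dense image. -/
lemma exists_starRep_of_dense {A : Type u} [NonUnitalCStarAlgebra A] {V : Type u}
    [AddCommGroup V] [Module ℂ V] (P : PreHilbertModule D V) (T : V →ₗ[ℂ] F)
    (hT : ∀ v w, P.inner v w = F.inner (T v) (T w)) (hd : DenseRange T)
    (ρ : A →ₙₐ[ℂ] Module.End ℂ V)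
    (h : ∀ a x y, P.inner (ρ (star a) x) y = P.inner x (ρ a y)) :
    ∃ φ : StarRep A F, ∀ a v, φ a (T v) = T (ρ a v) := by
  let W : Unitary P.completion F := Unitary.ofGenerators (fun v => P.toCompletion v) (fun v => T v)
    (fun v w => by rw [← hT]; exact (P.inner_toCompletion v w).symm)
    (P.dense_toCompletion.mono Submodule.subset_span) (hd.mono Submodule.subset_span)
  have hW : ∀ v, W (P.toCompletion v) = T v := fun v =>
    Unitary.ofGenerators_apply (fun v => P.toCompletion v) (fun v => T v) _ _ _ v
  refine ⟨(StarRep.ofPre P ρ h).conj W, fun a v => ?_⟩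
  change W (StarRep.ofPre P ρ h a (W.symm (T v))) = T (ρ a v)
  rw [← hW, W.symm_apply_apply, StarRep.ofPre_apply, hW]

/-- Let `M` be a continuous operator-valued sesquilinear form on `C_c(X)`, where continuity refers
to convergence under a common bound.  Vectors `B p x` with `⟨B p x, B q y⟩ = ⟨x, M(b_p, b_q) y⟩`,
for functions `b_p` whose linear span is dense, extend to vectors `Θ k x` for all `k ∈ C_c(X)`. -/
lemma exists_vectors_of_form {X ι : Type*} [TopologicalSpace X] {E : HilbertModule D}
    (M : C_c(X, ℂ) →ₗ⋆[ℂ] C_c(X, ℂ) →ₗ[ℂ] (F →L[ℂ] F))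
    (hM : ∀ η η', ∃ C : ℝ, 0 ≤ C ∧ ∀ ε ε' : ℝ, 0 ≤ ε → 0 ≤ ε' → ∀ d d',
      Dominates ((ε : ℂ) • η) d → Dominates ((ε' : ℂ) • η') d' → ‖M d d'‖ ≤ ε * ε' * C)
    (b : ι → C_c(X, ℂ)) (B : ι → F → E)
    (hB : ∀ p q x y, E.inner (B p x) (B q y) = F.inner x (M (b p) (b q) y))
    (hBd : Dense (Submodule.span ℂ (Set.range fun p : ι × F => B p.1 p.2) : Set E))
    (happ : ∀ k, ∃ η : C_c(X, ℂ), ∀ ε : ℝ, 0 < ε → ∃ (n : ℕ) (p : Fin n → ι),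
      Dominates ((ε : ℂ) • η) (k - ∑ i, b (p i))) :
    ∃ Θ : C_c(X, ℂ) → F → E, (∀ k k' x y, E.inner (Θ k x) (Θ k' y) = F.inner x (M k k' y)) ∧
      ∀ p x, Θ (b p) x = B p x := by
  have hdom : ∀ k : C_c(X, ℂ), ∃ η, Dominates (((1 : ℝ) : ℂ) • η) k := fun k => by
    obtain ⟨f₁, f₂, -, h, -⟩ := exists_factorization k
    refine ⟨star f₁ * f₁, fun x => ⟨‖k x‖, le_rfl, ?_⟩⟩
    rw [Complex.ofReal_one, one_smul, h]
  choose η hη using happ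
  have hε : ∀ n : ℕ, (0 : ℝ) < 1 / ((n : ℝ) + 1) := fun n => Nat.one_div_pos_of_nat
  choose N p hp using fun k (n : ℕ) => hη k _ (hε n)
  have hlim : Tendsto (fun n : ℕ => 1 / ((n : ℝ) + 1)) atTop (𝓝 0) :=
    tendsto_one_div_add_atTop_nhds_zero_nat
  -- the approximations `K k n` of `k` and the corresponding vectors
  set K : C_c(X, ℂ) → ℕ → C_c(X, ℂ) := fun k n => ∑ i, b (p k n i) with hK
  set e : C_c(X, ℂ) → F → ℕ → E := fun k x n => ∑ i, B (p k n i) x with he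
  have hee : ∀ k k' x y n m, E.inner (e k x n) (e k' y m) = F.inner x (M (K k n) (K k' m) y) := by
    intro k k' x y n m
    simp only [he, hK, HilbertModule.inner_sum_left, HilbertModule.inner_sum_right, hB, map_sum,
      LinearMap.sum_apply, _root_.sum_apply]
  have heB : ∀ k q x y n, E.inner (B q y) (e k x n) = F.inner y (M (b q) (K k n) x) := by
    intro k q x y n
    simp only [he, hK, HilbertModule.inner_sum_right, hB, map_sum, _root_.sum_apply]
  have hcauchy : ∀ k x, CauchySeq (e k x) := by
    intro k x
    obtain ⟨C, hC0, hC⟩ := hM (η k) (η k)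
    have hle : ∀ n m, ‖e k x n - e k x m‖
        ≤ (1 / ((n : ℝ) + 1) + 1 / ((m : ℝ) + 1)) * (√C * ‖x‖) := by
      intro n m
      have h1 : Dominates (((1 / ((m : ℝ) + 1) + 1 / ((n : ℝ) + 1) : ℝ) : ℂ) • η k)
          (K k n - K k m) := by
        have := (hp k m).sub (hp k n)
        rw [sub_sub_sub_cancel_left] at this
        convert this using 1
        ext q
        simp only [CompactlySupportedContinuousMap.add_apply,
          CompactlySupportedContinuousMap.smul_apply, Complex.ofReal_add, add_smul]
      have h2 := hC _ _ (add_pos (hε m) (hε n)).le (add_pos (hε m) (hε n)).le _ _ h1 h1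
      have h3 : E.inner (e k x n - e k x m) (e k x n - e k x m)
          = F.inner x (M (K k n - K k m) (K k n - K k m) x) := by
        simp only [HilbertModule.inner_sub_left, HilbertModule.inner_sub_right, hee, map_sub,
          LinearMap.sub_apply, _root_.sub_apply]
      refine le_of_sq_le_sq ?_ (by have := hε n; have := hε m; positivity)
      rw [E.norm_sq, h3]
      calc ‖F.inner x (M (K k n - K k m) (K k n - K k m) x)‖
          ≤ ‖x‖ * (‖M (K k n - K k m) (K k n - K k m)‖ * ‖x‖) :=
            (F.norm_inner_le _ _).trans (by gcongr; exact ContinuousLinearMap.le_opNorm _ _)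
        _ ≤ ‖x‖ * ((1 / ((m : ℝ) + 1) + 1 / ((n : ℝ) + 1))
              * (1 / ((m : ℝ) + 1) + 1 / ((n : ℝ) + 1)) * C * ‖x‖) := by gcongr
        _ = _ := by
          nth_rewrite 1 [← Real.sq_sqrt hC0]
          ring
    refine Metric.cauchySeq_iff'.2 fun ε hε' => ?_
    have ht : Tendsto (fun n : ℕ => (1 / ((n : ℝ) + 1) + 1 / ((n : ℝ) + 1)) * (√C * ‖x‖)) atTop
        (𝓝 0) := by
      have := (hlim.add hlim).mul_const (√C * ‖x‖)
      simpa using this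
    obtain ⟨n₀, hn₀⟩ := (ht.eventually (gt_mem_nhds hε')).exists
    refine ⟨n₀, fun n hn => ?_⟩
    rw [dist_eq_norm]
    refine (hle n n₀).trans_lt (lt_of_le_of_lt ?_ hn₀)
    gcongr
  choose Θ hΘ using fun k x => cauchySeq_tendsto_of_complete (hcauchy k x)
  -- the form is continuous in either variable along the approximations
  have hM₁ : ∀ k k', Tendsto (fun n => M (K k n) k') atTop (𝓝 (M k k')) := by
    intro k k'
    obtain ⟨η', hη'⟩ := hdom k'
    obtain ⟨C, hC0, hC⟩ := hM (η k) η'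
    rw [tendsto_iff_norm_sub_tendsto_zero]
    refine squeeze_zero (fun n => norm_nonneg _) (fun n => ?_)
      (g := fun n : ℕ => 1 / ((n : ℝ) + 1) * 1 * C) (by simpa using (hlim.mul_const 1).mul_const C)
    rw [norm_sub_rev, ← LinearMap.sub_apply, ← map_sub]
    exact hC _ _ (hε n).le zero_le_one _ _ (hp k n) hη'
  have hM₂ : ∀ k k', Tendsto (fun n => M k' (K k n)) atTop (𝓝 (M k' k)) := by
    intro k k'
    obtain ⟨η', hη'⟩ := hdom k'
    obtain ⟨C, hC0, hC⟩ := hM η' (η k)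
    rw [tendsto_iff_norm_sub_tendsto_zero]
    refine squeeze_zero (fun n => norm_nonneg _) (fun n => ?_)
      (g := fun n : ℕ => 1 * (1 / ((n : ℝ) + 1)) * C) (by simpa using (hlim.const_mul 1).mul_const C)
    rw [norm_sub_rev, ← map_sub]
    exact hC _ _ zero_le_one (hε n).le _ _ hη' (hp k n)
  have hinner : ∀ {S : ℕ → F →L[ℂ] F} {S' : F →L[ℂ] F} (x y : F), Tendsto S atTop (𝓝 S') →
      Tendsto (fun n => F.inner x (S n y)) atTop (𝓝 (F.inner x (S' y))) := by
    intro S S' x y h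
    have hc : Continuous fun T : F →L[ℂ] F => F.inner x (T y) :=
      F.continuous_inner_comp continuous_const (by fun_prop)
    exact (hc.tendsto S').comp h
  have hBΘ : ∀ k q x y, E.inner (B q y) (Θ k x) = F.inner y (M (b q) k x) := by
    intro k q x y
    have h1 : Tendsto (fun n => E.inner (B q y) (e k x n)) atTop (𝓝 (E.inner (B q y) (Θ k x))) :=
      ((E.continuous_inner_comp continuous_const continuous_id).tendsto _).comp (hΘ k x)
    simp only [heB] at h1
    exact tendsto_nhds_unique h1 (hinner y x (hM₂ k (b q)))
  refine ⟨Θ, fun k k' x y => ?_, fun q x => ?_⟩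
  · have h1 : Tendsto (fun n => E.inner (e k x n) (Θ k' y)) atTop
        (𝓝 (E.inner (Θ k x) (Θ k' y))) :=
      ((E.continuous_inner_comp continuous_id continuous_const).tendsto _).comp (hΘ k x)
    have h2 : ∀ n, E.inner (e k x n) (Θ k' y) = F.inner x (M (K k n) k' y) := by
      intro n
      simp only [he, hK, HilbertModule.inner_sum_left, hBΘ, map_sum, LinearMap.sum_apply,
        _root_.sum_apply, HilbertModule.inner_sum_right]
    simp only [h2] at h1
    exact tendsto_nhds_unique h1 (hinner x y (hM₁ k k'))
  · refine HilbertModule.ext_inner_of_dense _ hBd fun q' => ?_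
    rw [hBΘ, hB]

end Extending

/-! ### A form on functions of composable pairs -/

section Form

variable {G0 G1 : Type u} [TopologicalSpace G0] [TopologicalSpace G1]
  [T2Space G0] [T2Space G1] [LocallyCompactSpace G1]
  [MeasurableSpace G1] [BorelSpace G1] {𝒢 : TopGroupoid G0 G1} (α : HaarSystem 𝒢)

instance : LocallyCompactSpace 𝒢.Pairs :=
  (isClosedEmbedding_fiberProduct 𝒢.s 𝒢.r).locallyCompactSpace

lemma TopGroupoid.continuous_comp' (𝒢 : TopGroupoid G0 G1) {T : Type*} [TopologicalSpace T]
    {f g : T → G1} (hf : Continuous f) (hg : Continuous g) (h : ∀ t, 𝒢.s (f t) = 𝒢.r (g t)) :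
    Continuous fun t => 𝒢.comp (f t) (g t) (h t) :=
  𝒢.continuous_comp.comp ((hf.prodMk hg).subtype_mk h)

/-- The homeomorphism `((h, m), g) ↦ ((g, h), (g, h m))` on the space of composable triples
`(g, h, m)`. -/
def TopGroupoid.tripleHomeo (𝒢 : TopGroupoid G0 G1) :
    FiberProduct (𝒢.r.comp 𝒢.d₂) 𝒢.s ≃ₜ FiberProduct 𝒢.d₂ 𝒢.d₂ where
  toFun q := ⟨(⟨(q.1.2, q.1.1.1.1), q.2.symm⟩,
    ⟨(q.1.2, 𝒢.comp q.1.1.1.1 q.1.1.1.2 q.1.1.2), by rw [𝒢.r_comp]; exact q.2.symm⟩), rfl⟩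
  invFun q := ⟨(⟨(q.1.1.1.2, 𝒢.comp (𝒢.inv q.1.1.1.2) q.1.2.1.2 (by
      rw [𝒢.s_inv, ← q.1.1.2, ← q.1.2.2]
      exact congrArg 𝒢.s q.2)), by rw [𝒢.r_comp, 𝒢.r_inv]⟩, q.1.1.1.1), q.1.1.2.symm⟩
  left_inv q := by
    refine Subtype.ext (Prod.ext (Subtype.ext (Prod.ext rfl ?_)) rfl)
    exact 𝒢.inv_comp_cancel _ _ _
  right_inv q := by
    refine Subtype.ext (Prod.ext rfl (Subtype.ext (Prod.ext q.2 ?_)))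
    exact 𝒢.comp_inv_cancel _ _ _
  continuous_toFun := by
    refine Continuous.subtype_mk (Continuous.prodMk (by fun_prop) ?_) _
    refine Continuous.subtype_mk (Continuous.prodMk (by fun_prop) ?_) _
    exact 𝒢.continuous_comp' (by fun_prop) (by fun_prop) _
  continuous_invFun := by
    refine Continuous.subtype_mk (Continuous.prodMk ?_ (by fun_prop)) _
    refine Continuous.subtype_mk (Continuous.prodMk (by fun_prop) ?_) _
    exact 𝒢.continuous_comp' (by fun_prop) (by fun_prop) _

/-- Integration over `g` and then over `h` of a function of composable triples `(g, h, m)`, written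
in the coordinates `((g, h), (g, h m))`. -/
noncomputable def tripleInt : C_c(FiberProduct 𝒢.d₂ 𝒢.d₂, ℂ) →ₗ[ℂ] C_c(G1, ℂ) :=
  α.lam₀.toLin ∘ₗ (α.tilde.pull (𝒢.r.comp 𝒢.d₂)).toLin ∘ₗ compHomeo 𝒢.tripleHomeo

/-- The `C_c(G¹)`-valued form `⟨k, k'⟩(m) = ∫∫ conj k(g, h) k'(g, h m)` on `C_c(G²)`. -/
noncomputable def convForm : C_c(𝒢.Pairs, ℂ) →ₗ⋆[ℂ] C_c(𝒢.Pairs, ℂ) →ₗ[ℂ] C_c(G1, ℂ) :=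
  LinearMap.mk₂'ₛₗ (starRingEnd ℂ) (RingHom.id ℂ)
    (fun k k' => tripleInt α (fiberBox 𝒢.d₂ 𝒢.d₂ (star k) k'))
    (fun k l k' => by
      rw [← map_add]
      congr 1
      ext q
      simp only [fiberBox_apply, CompactlySupportedContinuousMap.add_apply, star_add, add_mul])
    (fun c k k' => by
      rw [← map_smul]
      congr 1
      ext q
      simp only [fiberBox_apply, CompactlySupportedContinuousMap.smul_apply, star_smul, smul_eq_mul,
        mul_assoc]
      rfl)
    (fun k k' l' => by
      rw [← map_add]
      congr 1
      ext q
      simp only [fiberBox_apply, CompactlySupportedContinuousMap.add_apply, mul_add])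
    (fun c k k' => by
      rw [← map_smul]
      congr 1
      ext q
      simp only [fiberBox_apply, CompactlySupportedContinuousMap.smul_apply, smul_eq_mul,
        RingHom.id_apply]
      ring)

lemma Dominates.convForm {η k η' k' : C_c(𝒢.Pairs, ℂ)} (h : Dominates η k)
    (h' : Dominates η' k') : Dominates (convForm α η η') (convForm α k k') := by
  have h1 : Dominates (fiberBox 𝒢.d₂ 𝒢.d₂ (Star.star η) η')
      (fiberBox 𝒢.d₂ 𝒢.d₂ (Star.star k) k') := by
    intro q
    obtain ⟨t, ht, hx⟩ := h.star q.1.1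
    obtain ⟨t', ht', hx'⟩ := h' q.1.2
    refine ⟨t * t', ?_, by rw [fiberBox_apply, hx, hx']; push_cast; rfl⟩
    rw [fiberBox_apply, norm_mul]
    have := (norm_nonneg _).trans ht
    gcongr
  have h2 : Dominates (compHomeo 𝒢.tripleHomeo (fiberBox 𝒢.d₂ 𝒢.d₂ (Star.star η) η'))
      (compHomeo 𝒢.tripleHomeo (fiberBox 𝒢.d₂ 𝒢.d₂ (Star.star k) k')) :=
    h1.comp (e := 𝒢.tripleHomeo) (fun _ => rfl) (fun _ => rfl)
  exact (h2.integrate (α.tilde.pull (𝒢.r.comp 𝒢.d₂))).integrate α.lam₀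

/-- The value at `m` of the form, in terms of a function on `G²` that agrees with
`conj k(g, h) k'(g, h m)` where this makes sense. -/
lemma convForm_apply (k k' Z : C_c(𝒢.Pairs, ℂ)) (m : G1)
    (hZ : ∀ (q : 𝒢.Pairs) (e : 𝒢.s q.1.2 = 𝒢.r m), Z q = star (k q)
      * k' ⟨(q.1.1, 𝒢.comp q.1.2 m e), q.2.trans (𝒢.r_comp _ _ _).symm⟩) :
    convForm α k k' m = α.tildeInt (α.lam₀ Z) (𝒢.r m) := by
  refine α.lam₀_apply' _ m rfl (fun h => α.lam₀ Z h) fun h hh => ?_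
  refine Eq.trans ?_ (α.lam₀_apply' Z h rfl (fun g => extendZero (fun q =>
    compHomeo 𝒢.tripleHomeo (fiberBox 𝒢.d₂ 𝒢.d₂ (star k) k') q) (⟨(h, m), hh⟩ : 𝒢.Pairs) g)
    fun g hg => ?_).symm
  · rfl
  · have e : (𝒢.r.comp 𝒢.d₂) (⟨(h, m), hh⟩ : 𝒢.Pairs) = 𝒢.s g := hg.symm
    rw [hZ _ hh, extendZero, dif_pos e]
    rfl

lemma exists_convForm_apply (k k' : C_c(𝒢.Pairs, ℂ)) (m : G1) :
    ∃ Z : C_c(𝒢.Pairs, ℂ), ∀ (q : 𝒢.Pairs) (e : 𝒢.s q.1.2 = 𝒢.r m), Z q = star (k q)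
      * k' ⟨(q.1.1, 𝒢.comp q.1.2 m e), q.2.trans (𝒢.r_comp _ _ _).symm⟩ := by
  have hcl : IsClosed {q : 𝒢.Pairs | 𝒢.s q.1.2 = 𝒢.r m} :=
    isClosed_eq (by fun_prop) continuous_const
  have he := hcl.isClosedEmbedding_subtypeVal
  have hc : Continuous fun q : {q : 𝒢.Pairs | 𝒢.s q.1.2 = 𝒢.r m} =>
      k' ⟨(q.1.1.1, 𝒢.comp q.1.1.2 m q.2), q.1.2.trans (𝒢.r_comp _ _ _).symm⟩ := by
    refine k'.continuous.comp (Continuous.subtype_mk (Continuous.prodMk (by fun_prop) ?_) _)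
    exact 𝒢.continuous_comp' (by fun_prop) (by fun_prop) _
  obtain ⟨Z, hZ⟩ := exists_extension he ((⟨_, hc⟩ : C(_, ℂ)) • restrict he (star k))
  exact ⟨Z, fun q e => (hZ ⟨q, e⟩).trans (mul_comm _ _)⟩

/-- `⟨ξ(g) f(h), k'⟩ = f* * λ₀(conj ξ(g) k')`. -/
lemma convForm_boxTimes (ξ f : C_c(G1, ℂ)) (k' : C_c(𝒢.Pairs, ℂ)) :
    convForm α (boxTimes 𝒢 ξ f) k' = convolution α (involution 𝒢 f)
      (α.lam₀ (((star ξ).toContinuousMap.comp 𝒢.d₂) • k')) := by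
  set w := α.lam₀ (((star ξ).toContinuousMap.comp 𝒢.d₂) • k') with hw
  ext m
  obtain ⟨Z, hZ⟩ := exists_convForm_apply (boxTimes 𝒢 ξ f) k' m
  rw [convForm_apply α _ _ Z m hZ, ← α.lam₀_of_comp f w (boxComp 𝒢 (star f) w)
    (fun q => boxComp_apply _ _ q)]
  refine (α.lam₀_apply' _ m rfl (fun h => α.lam₀ Z h) fun h hh => ?_).symm
  rw [boxComp_apply]
  change star (f h) * w (𝒢.comp h m hh) = _
  classical
  set K : G1 → ℂ := fun g => if e : 𝒢.s g = 𝒢.r h then star (ξ g) *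
    k' ⟨(g, 𝒢.comp h m hh), e.trans (𝒢.r_comp _ _ _).symm⟩ else 0 with hK
  rw [α.lam₀_apply' Z h rfl (fun g => star (f h) * K g) (fun g hg => ?_), hw,
    α.lam₀_apply' _ (𝒢.comp h m hh) (y := 𝒢.r h) (𝒢.r_comp _ _ _).symm K (fun g hg => ?_),
    integral_const_mul]
  · simp only [hK]
    rw [dif_pos (hg.trans (𝒢.r_comp _ _ _))]
    rfl
  · simp only [hK]
    rw [hZ _ hh, dif_pos hg, boxTimes_apply, star_mul', ← mul_assoc, mul_comm (star (f h))]
    rfl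

/-- `⟨ξ(g) f(g h), k'⟩ = f* * λ₁(conj ξ(g) k')`. -/
lemma convForm_boxComp (ξ f : C_c(G1, ℂ)) (k' : C_c(𝒢.Pairs, ℂ)) :
    convForm α (boxComp 𝒢 ξ f) k' = convolution α (involution 𝒢 f)
      (α.lam₁ (((star ξ).toContinuousMap.comp 𝒢.d₂) • k')) := by
  set w := α.lam₁ (((star ξ).toContinuousMap.comp 𝒢.d₂) • k') with hw
  ext m
  obtain ⟨Z, hZ⟩ := exists_convForm_apply (boxComp 𝒢 ξ f) k' m
  -- the substitution `h ↦ g⁻¹ h` is the identity `α̃ ∘ λ₀ = α̃ ∘ λ₁`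
  rw [convForm_apply α _ _ Z m hZ, ← α.lam₀_of_comp f w (boxComp 𝒢 (star f) w)
    (fun q => boxComp_apply _ _ q), ← α.tildeInt_lam₁]
  refine (α.lam₀_apply' _ m rfl (fun k => α.lam₁ Z k) fun k hk => ?_).symm
  rw [boxComp_apply]
  change star (f k) * w (𝒢.comp k m hk) = _
  classical
  set K : G1 → ℂ := fun g => if e : 𝒢.r g = 𝒢.r k then star (ξ g) *
    k' ⟨(g, 𝒢.comp (𝒢.inv g) (𝒢.comp k m hk) (by rw [𝒢.s_inv, 𝒢.r_comp, e])),
      ((𝒢.r_comp _ _ _).trans (𝒢.r_inv g)).symm⟩ else 0 with hK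
  rw [α.lam₁_apply' Z k rfl (fun g => star (f k) * K g) (fun g hg => ?_), hw,
    α.lam₁_apply' _ (𝒢.comp k m hk) (y := 𝒢.r k) (𝒢.r_comp _ _ _).symm K (fun g hg => ?_),
    integral_const_mul]
  · simp only [hK]
    rw [dif_pos (hg.trans (𝒢.r_comp _ _ _))]
    rfl
  · simp only [hK]
    rw [hZ _ ((𝒢.s_comp _ _ _).trans hk), dif_pos hg, boxComp_apply, star_mul', ← mul_assoc,
      mul_comm (star (f k))]
    refine congrArg₂ (· * ·) (congrArg (star (ξ g) * ·) (congrArg (fun z => star (f z)) ?_))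
      (congrArg k' (Subtype.ext (Prod.ext rfl ?_)))
    · exact 𝒢.comp_inv_cancel g k ((𝒢.s_inv g).trans hg)
    · exact 𝒢.assoc _ _ _ _ _

end Form

/-! ### Every representation of the convolution algebra is an integrated form -/

section Disintegrate

variable {G0 G1 : Type u} [TopologicalSpace G0] [TopologicalSpace G1]
  [T2Space G0] [T2Space G1] [LocallyCompactSpace G1]
  [MeasurableSpace G1] [BorelSpace G1] {𝒢 : TopGroupoid G0 G1}
  {D : Type u} [NonUnitalCStarAlgebra D]

/-- A nondegenerate *-representation of the convolution algebra on a Hilbert module that is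
contractive for the `I`-norm. -/
structure ConvRep (α : HaarSystem 𝒢) (F : HilbertModule D) where
  /-- the operators -/
  toLin : C_c(G1, ℂ) →ₗ[ℂ] (F →L[ℂ] F)
  map_convolution : ∀ f g x, toLin (convolution α f g) x = toLin f (toLin g x)
  adjoint : ∀ f x y, F.inner (toLin (involution 𝒢 f) x) y = F.inner x (toLin f y)
  norm_le : ∀ f, ‖toLin f‖ ≤ INorm α f
  dense : Dense (Submodule.span ℂ (Set.range fun p : C_c(G1, ℂ) × F => toLin p.1 p.2) : Set F)

variable {α : HaarSystem 𝒢} {F : HilbertModule D}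

/-- The restriction of a representation of `C*(G, α)` to the convolution algebra. -/
noncomputable def Rep.toConvRep (π : Rep (GroupoidCStar α) F) : ConvRep α F where
  toLin :=
    { toFun := fun f => π ((maxSeminorm α).toComplHom (Conv.of α f))
      map_add' := fun f g => by rw [map_add, map_add, map_add]
      map_smul' := fun c f => by rw [map_smul, map_smul, map_smul]; rfl }
  map_convolution f g x := by
    have h : Conv.of α (convolution α f g) = Conv.of α f * Conv.of α g := rfl
    change π ((maxSeminorm α).toComplHom (Conv.of α (convolution α f g))) x = _
    rw [h, map_mul, map_mul]
    rfl
  adjoint f x y := by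
    have h : Conv.of α (involution 𝒢 f) = star (Conv.of α f) := rfl
    change F.inner (π ((maxSeminorm α).toComplHom (Conv.of α (involution 𝒢 f))) x) y = _
    rw [h, map_star]
    exact π.adjoint _ x y
  norm_le f := by
    refine (π.toStarRep.norm_le _).trans ?_
    rw [CStarSeminorm.norm_toComplHom]
    exact maxSeminorm_le_INorm α f
  dense := by
    set S := Submodule.span ℂ (Set.range fun p : C_c(G1, ℂ) × F =>
      π ((maxSeminorm α).toComplHom (Conv.of α p.1)) p.2) with hS
    have h1 : Submodule.span ℂ {y : F | ∃ b x, π b x = y} ≤ S.topologicalClosure := by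
      rw [Submodule.span_le]
      rintro _ ⟨b, x, rfl⟩
      refine (maxSeminorm α).denseRange_toComplHom.induction_on
        (p := fun b => π b x ∈ S.topologicalClosure) b
        (S.isClosed_topologicalClosure.preimage
          (π.toStarRep.continuous.clm_apply continuous_const)) fun g => ?_
      exact S.le_topologicalClosure (Submodule.subset_span ⟨((Conv.of α).symm g, x), rfl⟩)
    have h2 : Dense (S.topologicalClosure : Set F) := π.nondegenerate.mono h1
    rwa [Submodule.topologicalClosure_coe, dense_closure] at h2

lemma INorm_le_of_dominates {η f : C_c(G1, ℂ)} (h : Dominates η f) :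
    INorm α f ≤ max ‖toC₀ (α.int η)‖ ‖toC₀ (α.tildeInt η)‖ :=
  max_le_max (α.toFiberMeasures.iSup_integral_norm_le h) (α.tilde.iSup_integral_norm_le h)

namespace ConvRep

variable (L : ConvRep α F)

lemma inner_apply (f g : C_c(G1, ℂ)) (x y : F) :
    F.inner (L.toLin f x) (L.toLin g y)
      = F.inner x (L.toLin (convolution α (involution 𝒢 f) g) y) := by
  have h : ∀ z, F.inner (L.toLin f x) z = F.inner x (L.toLin (involution 𝒢 f) z) := fun z => by
    rw [← F.star_inner, ← L.adjoint, F.star_inner]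
  rw [h, L.map_convolution]

/-- The operators `L(f) x ↦ L((a ∘ r) f) x` for `a ∈ C₀(G⁰)` are well defined and bounded because
`C₀(G⁰)` acts by adjointable maps on the pre-Hilbert module `C_c(G¹) ⊗ F` with the inner product
`⟨f ⊗ x, g ⊗ y⟩ = ⟨L(f) x, L(g) y⟩`. -/
lemma exists_φ [LocallyCompactSpace G0] : ∃ φ : Rep C₀(G0, ℂ) F, ∀ a f x,
    φ a (L.toLin f x) = L.toLin (((a : C(G0, ℂ)).comp 𝒢.r) • f) x := by
  let T : C_c(G1, ℂ) ⊗[ℂ] F →ₗ[ℂ] F := TensorProduct.lift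
    (LinearMap.mk₂ ℂ (fun f x => L.toLin f x) (fun f g x => by rw [map_add, _root_.add_apply])
      (fun c f x => by rw [map_smul, _root_.smul_apply]) (fun f x y => by rw [map_add])
      (fun c f x => by rw [map_smul]))
  have hT : ∀ f x, T (f ⊗ₜ x) = L.toLin f x := fun f x => rfl
  have hact : ∀ d t, T ((F.actL d).lTensor _ t) = F.actL d (T t) := by
    intro d t
    induction t with
    | zero => simp
    | add a b ha hb => simp only [map_add, ha, hb]
    | tmul f x =>
      rw [LinearMap.lTensor_tmul, hT, hT]
      refine F.ext_inner fun z => ?_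
      change F.inner z (L.toLin f (F.act x d)) = F.inner z (F.act (L.toLin f x) d)
      rw [← L.adjoint, F.inner_act_right, F.inner_act_right, L.adjoint]
  let P : PreHilbertModule D (C_c(G1, ℂ) ⊗[ℂ] F) :=
    { inner := fun t t' => F.inner (T t) (T t')
      act := fun t d => (F.actL d).lTensor _ t
      inner_add_right := fun x y z => by rw [map_add, F.inner_add_right]
      inner_smul_right := fun c x y => by rw [map_smul, F.inner_smul_right]
      star_inner := fun x y => F.star_inner _ _
      inner_self_pos := fun x => F.pre.inner_self_pos _
      inner_act_right := fun x y d => by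
        rw [hact]
        exact F.inner_act_right _ _ _ }
  let m : C₀(G0, ℂ) → Module.End ℂ C_c(G1, ℂ) := fun a =>
    { toFun := fun f => ((a : C(G0, ℂ)).comp 𝒢.r) • f
      map_add' := fun f g => by ext; simp [mul_add]
      map_smul' := fun c f => by ext; simp; ring }
  have hm : ∀ a f g, m a f g = a (𝒢.r g) * f g := fun a f g => rfl
  let ρ : C₀(G0, ℂ) →ₙₐ[ℂ] Module.End ℂ (C_c(G1, ℂ) ⊗[ℂ] F) :=
    { toFun := fun a => (m a).rTensor F
      map_smul' := fun c a => TensorProduct.ext' fun f x => by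
        have : m (c • a) f = c • m a f := by ext g; simp [hm]; ring
        rw [LinearMap.rTensor_tmul, this]
        exact (TensorProduct.smul_tmul' c _ _).symm
      map_zero' := TensorProduct.ext' fun f x => by
        have : m 0 f = 0 := by ext g; simp [hm]
        rw [LinearMap.rTensor_tmul, this, TensorProduct.zero_tmul]
        rfl
      map_add' := fun a b => TensorProduct.ext' fun f x => by
        have : m (a + b) f = m a f + m b f := by ext g; simp [hm]; ring
        rw [LinearMap.rTensor_tmul, this, TensorProduct.add_tmul]
        rfl
      map_mul' := fun a b => TensorProduct.ext' fun f x => by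
        have : m (a * b) f = m a (m b f) := by ext g; simp [hm]; ring
        rw [LinearMap.rTensor_tmul, this]
        rfl }
  have hadj : ∀ a t t', P.inner (ρ (star a) t) t' = P.inner t (ρ a t') := by
    intro a t t'
    change F.inner (T ((m (star a)).rTensor F t)) (T t') = F.inner (T t) (T ((m a).rTensor F t'))
    induction t with
    | zero =>
      simp only [map_zero]
      exact (F.pre.inner_zero_left _).trans (F.pre.inner_zero_left _).symm
    | add t₁ t₂ h₁ h₂ => simp only [map_add, F.inner_add_left, h₁, h₂]
    | tmul f x =>
      induction t' with
      | zero =>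
        simp only [map_zero]
        exact (F.pre.inner_zero_right _).trans (F.pre.inner_zero_right _).symm
      | add t₁ t₂ h₁ h₂ => simp only [map_add, F.inner_add_right, h₁, h₂]
      | tmul f' x' =>
        rw [LinearMap.rTensor_tmul, LinearMap.rTensor_tmul, hT, hT, hT, hT, L.inner_apply,
          L.inner_apply, ← α.lam₀_of_comp (m (star a) f) f' (boxComp 𝒢 (star (m (star a) f)) f')
            (fun q => boxComp_apply _ _ q), ← α.lam₀_of_comp f (m a f')
            (boxComp 𝒢 (star (m (star a) f)) f') (fun q => ?_)]
        rw [boxComp_apply, hm]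
        change star (m (star a) f (𝒢.d₂ q)) * _ = _
        rw [hm, show 𝒢.r (𝒢.d₁ q) = 𝒢.r (𝒢.d₂ q) from 𝒢.r_comp _ _ _]
        simp
        ring
  have hdT : DenseRange T := by
    refine L.dense.mono ?_
    have : Submodule.span ℂ (Set.range fun p : C_c(G1, ℂ) × F => L.toLin p.1 p.2)
        ≤ LinearMap.range T := by
      rw [Submodule.span_le]
      rintro _ ⟨p, rfl⟩
      exact ⟨p.1 ⊗ₜ p.2, rfl⟩
    exact this
  obtain ⟨φ, hφ⟩ := exists_starRep_of_dense P T (fun _ _ => rfl) hdT ρ hadj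
  have hφ' : ∀ a f x, φ a (L.toLin f x) = L.toLin (((a : C(G0, ℂ)).comp 𝒢.r) • f) x :=
    fun a f x => hφ a (f ⊗ₜ x)
  refine ⟨⟨φ, L.dense.mono (Submodule.span_mono ?_)⟩, hφ'⟩
  rintro _ ⟨⟨f, x⟩, rfl⟩
  obtain ⟨η, hη⟩ := exists_unit_comp 𝒢.r f
  refine ⟨toC₀ η, L.toLin f x, (hφ' _ _ _).trans ?_⟩
  exact congrArg (fun f => L.toLin f x) hη

/-- The operator-valued form `⟨k, k'⟩ = L(∫∫ conj k(g, h) k'(g, h m))` on `C_c(G²)`. -/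
noncomputable def form : C_c(𝒢.Pairs, ℂ) →ₗ⋆[ℂ] C_c(𝒢.Pairs, ℂ) →ₗ[ℂ] (F →L[ℂ] F) :=
  LinearMap.mk₂'ₛₗ (starRingEnd ℂ) (RingHom.id ℂ) (fun k k' => L.toLin (convForm α k k'))
    (fun k l k' => by rw [map_add, LinearMap.add_apply, map_add])
    (fun c k k' => by rw [LinearMap.map_smulₛₗ, LinearMap.smul_apply, map_smul])
    (fun k k' l' => by rw [map_add, map_add])
    (fun c k k' => by rw [map_smul, map_smul]; rfl)

lemma form_apply (k k' : C_c(𝒢.Pairs, ℂ)) : L.form k k' = L.toLin (convForm α k k') := rfl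

/-- The form is continuous for convergence under a common bound. -/
lemma norm_form_le (η η' : C_c(𝒢.Pairs, ℂ)) : ∃ C : ℝ, 0 ≤ C ∧ ∀ ε ε' : ℝ, 0 ≤ ε → 0 ≤ ε' →
    ∀ d d', Dominates ((ε : ℂ) • η) d → Dominates ((ε' : ℂ) • η') d' →
      ‖L.form d d'‖ ≤ ε * ε' * C := by
  refine ⟨max ‖toC₀ (α.int (convForm α η η'))‖ ‖toC₀ (α.tildeInt (convForm α η η'))‖, by positivity,
    fun ε ε' hε hε' d d' h h' => ?_⟩
  have e : convForm α ((ε : ℂ) • η) ((ε' : ℂ) • η')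
      = ((ε * ε' : ℝ) : ℂ) • convForm α η η' := by
    rw [map_smul (convForm α ((ε : ℂ) • η)), LinearMap.map_smulₛₗ, LinearMap.smul_apply, smul_smul,
      Complex.conj_ofReal, mul_comm]
    push_cast
    rfl
  refine (L.norm_le _).trans ((INorm_le_of_dominates (h.convForm α h')).trans_eq ?_)
  rw [e, map_smul, map_smul, map_smul, map_smul, norm_smul, norm_smul, Complex.norm_real,
    Real.norm_of_nonneg (by positivity), mul_max_of_nonneg _ _ (by positivity)]

end ConvRep

/-- Sums of functions `ξ(g) f(h)` approximate every function in `C_c(G²)`. -/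
lemma boxTimes_approx (k : C_c(𝒢.Pairs, ℂ)) : ∃ η : C_c(𝒢.Pairs, ℂ), ∀ ε : ℝ, 0 < ε →
    ∃ (n : ℕ) (p : Fin n → C_c(G1, ℂ) × C_c(G1, ℂ)),
      Dominates ((ε : ℂ) • η) (k - ∑ i, boxTimes 𝒢 (p i).1 (p i).2) := by
  obtain ⟨a, c, -, h⟩ := exists_box_approx 𝒢.s 𝒢.r k
  refine ⟨fiberBox 𝒢.s 𝒢.r a c, fun ε hε => ?_⟩
  obtain ⟨n, u, v, h'⟩ := h ε hε
  exact ⟨n, fun i => (u i, v i), h'⟩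

/-- Sums of functions `ξ(g) f(g h)` approximate every function in `C_c(G²)`. -/
lemma boxComp_approx (k : C_c(𝒢.Pairs, ℂ)) : ∃ η : C_c(𝒢.Pairs, ℂ), ∀ ε : ℝ, 0 < ε →
    ∃ (n : ℕ) (p : Fin n → C_c(G1, ℂ) × C_c(G1, ℂ)),
      Dominates ((ε : ℂ) • η) (k - ∑ i, boxComp 𝒢 (p i).1 (p i).2) := by
  obtain ⟨a, c, -, h⟩ := exists_box_approx 𝒢.r 𝒢.r (compHomeo 𝒢.homeo₁.symm k)
  refine ⟨compHomeo 𝒢.homeo₁ (fiberBox 𝒢.r 𝒢.r a c), fun ε hε => ?_⟩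
  obtain ⟨n, u, v, h'⟩ := h ε hε
  refine ⟨n, fun i => (v i, u i), h'.comp (e := 𝒢.homeo₁) (fun q => rfl) fun q => ?_⟩
  have : k - ∑ i, boxComp 𝒢 (v i) (u i) = compHomeo 𝒢.homeo₁
      (compHomeo 𝒢.homeo₁.symm k - ∑ i, fiberBox 𝒢.r 𝒢.r (u i) (v i)) := by
    rw [map_sub, map_sum]
    congr 1
    ext q
    simp
  exact DFunLike.congr_fun this q

namespace ConvRep

variable (L : ConvRep α F) (φ : Rep C₀(G0, ℂ) F)
  (hφ : ∀ a f x, φ a (L.toLin f x) = L.toLin (((a : C(G0, ℂ)).comp 𝒢.r) • f) x)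

include hφ

lemma inner_boxTimes (p q : C_c(G1, ℂ) × C_c(G1, ℂ)) (x y : F) :
    (tensor α.tildeInt.L2 φ.toStarRep).inner
        (tmul φ.toStarRep (α.tildeInt.cls p.1) (L.toLin p.2 x))
        (tmul φ.toStarRep (α.tildeInt.cls q.1) (L.toLin q.2 y))
      = F.inner x (L.form (boxTimes 𝒢 p.1 p.2) (boxTimes 𝒢 q.1 q.2) y) := by
  rw [inner_tmul, α.tildeInt.inner_cls, hφ, L.inner_apply, form_apply, convForm_boxTimes,
    α.lam₀_of_mul (star p.1 * q.1) q.2]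
  · rfl
  · intro z
    exact (mul_assoc _ _ _).symm

lemma inner_boxComp (p q : C_c(G1, ℂ) × C_c(G1, ℂ)) (x y : F) :
    (tensor α.int.L2 φ.toStarRep).inner
        (tmul φ.toStarRep (α.int.cls p.1) (L.toLin p.2 x))
        (tmul φ.toStarRep (α.int.cls q.1) (L.toLin q.2 y))
      = F.inner x (L.form (boxComp 𝒢 p.1 p.2) (boxComp 𝒢 q.1 q.2) y) := by
  rw [inner_tmul, α.int.inner_cls, hφ, L.inner_apply, form_apply, convForm_boxComp,
    α.lam₁_of_mul (star p.1 * q.1) q.2]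
  · rfl
  · intro z
    refine (congrArg (star (p.1 (𝒢.d₂ z)) * ·) (boxComp_apply _ _ z)).trans ?_
    exact (mul_assoc _ _ _).symm

lemma dense_tmul_apply {g : C(G1, G0)} (J : IntegrationMap g) :
    Dense (Submodule.span ℂ (Set.range fun p : (C_c(G1, ℂ) × C_c(G1, ℂ)) × F =>
      tmul φ.toStarRep (J.cls p.1.1) (L.toLin p.1.2 p.2)) : Set (tensor J.L2 φ.toStarRep)) := by
  refine (dense_tmul_of_dense φ.toStarRep (fun ξ => J.cls ξ)
    (fun p : C_c(G1, ℂ) × F => L.toLin p.1 p.2) J.dense_cls L.dense).mono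
    (Submodule.span_mono ?_)
  rintro _ ⟨⟨ξ, f, x⟩, rfl⟩
  exact ⟨((ξ, f), x), rfl⟩

/-- The unitary with matrix coefficients `L(f)`: both `L²(G¹, s, α̃) ⊗ F` and `L²(G¹, r, α) ⊗ F`
are generated by vectors `Θ k x` for `k ∈ C_c(G²)` with the same inner products. -/
lemma exists_U : ∃ U : Unitary (tensor α.tildeInt.L2 φ.toStarRep) (tensor α.int.L2 φ.toStarRep),
    ∀ η ξ x, annihilate φ.toStarRep (α.int.cls η) (U (tmul φ.toStarRep (α.tildeInt.cls ξ) x))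
      = L.toLin (star η * ξ) x := by
  have hds := L.dense_tmul_apply φ hφ α.tildeInt
  have hdr := L.dense_tmul_apply φ hφ α.int
  obtain ⟨Θs, hs, hs'⟩ := exists_vectors_of_form L.form L.norm_form_le
    (fun p : C_c(G1, ℂ) × C_c(G1, ℂ) => boxTimes 𝒢 p.1 p.2) _ (L.inner_boxTimes φ hφ) hds
    boxTimes_approx
  obtain ⟨Θr, hr, hr'⟩ := exists_vectors_of_form L.form L.norm_form_le
    (fun p : C_c(G1, ℂ) × C_c(G1, ℂ) => boxComp 𝒢 p.1 p.2) _ (L.inner_boxComp φ hφ) hdr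
    boxComp_approx
  have hds' : Dense (Submodule.span ℂ (Set.range fun p : C_c(𝒢.Pairs, ℂ) × F => Θs p.1 p.2) :
      Set (tensor α.tildeInt.L2 φ.toStarRep)) := by
    refine hds.mono (Submodule.span_mono ?_)
    rintro _ ⟨⟨p, x⟩, rfl⟩
    exact ⟨(_, x), hs' p x⟩
  have hdr' : Dense (Submodule.span ℂ (Set.range fun p : C_c(𝒢.Pairs, ℂ) × F => Θr p.1 p.2) :
      Set (tensor α.int.L2 φ.toStarRep)) := by
    refine hdr.mono (Submodule.span_mono ?_)
    rintro _ ⟨⟨p, x⟩, rfl⟩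
    exact ⟨(_, x), hr' p x⟩
  let U := Unitary.ofGenerators (fun p : C_c(𝒢.Pairs, ℂ) × F => Θs p.1 p.2)
    (fun p : C_c(𝒢.Pairs, ℂ) × F => Θr p.1 p.2) (fun p q => by rw [hr, hs]) hds' hdr'
  have hU : ∀ k x, U (Θs k x) = Θr k x := fun k x =>
    Unitary.ofGenerators_apply (fun p : C_c(𝒢.Pairs, ℂ) × F => Θs p.1 p.2)
      (fun p : C_c(𝒢.Pairs, ℂ) × F => Θr p.1 p.2) _ _ _ (k, x)
  refine ⟨U, fun η ξ x => ?_⟩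
  refine eq_of_generators (S := (annihilate φ.toStarRep (α.int.cls η)).comp
    (U.toCLM.comp (create φ.toStarRep (α.tildeInt.cls ξ)))) (T := L.toLin (star η * ξ)) _ L.dense
    (fun p => ?_) x
  obtain ⟨f, x⟩ := p
  change annihilate φ.toStarRep (α.int.cls η)
      (U (tmul φ.toStarRep (α.tildeInt.cls ξ) (L.toLin f x))) = L.toLin (star η * ξ) (L.toLin f x)
  -- pair with the vectors `L(f') y` and use that `U` maps `Θs k x` to `Θr k x`
  refine HilbertModule.ext_inner_of_dense _ L.dense fun p' => ?_
  obtain ⟨f', y⟩ := p'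
  have h1 : tmul φ.toStarRep (α.tildeInt.cls ξ) (L.toLin f x) = Θs (boxTimes 𝒢 ξ f) x :=
    (hs' (ξ, f) x).symm
  have h2 : tmul φ.toStarRep (α.int.cls η) (L.toLin f' y) = Θr (boxComp 𝒢 η f') y :=
    (hr' (η, f') y).symm
  rw [inner_annihilate, h1, hU, h2, hr, form_apply, convForm_boxComp, ← L.map_convolution,
    L.inner_apply]
  have h3 : (((star η).toContinuousMap.comp 𝒢.d₂) • boxTimes 𝒢 ξ f)
      = boxTimes 𝒢 (star η * ξ) f := by
    ext q
    exact (mul_assoc _ _ _).symm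
  rw [h3, convolution]
  rfl

end ConvRep

/-- Every nondegenerate *-representation of the convolution algebra that is contractive for the
`I`-norm consists of the matrix coefficients of a representation of `(G, α)`. -/
theorem ConvRep.exists_groupoidRepr [LocallyCompactSpace G0] (L : ConvRep α F) :
    ∃ R : GroupoidRepr α F, ∀ f, R.coefficient f = L.toLin f := by
  obtain ⟨φ, hφ⟩ := L.exists_φ
  obtain ⟨U, hL⟩ := L.exists_U φ hφ
  have hU : ∀ (a : C₀(G1, ℂ)) x, U (α.tildeInt.mulRep.tensor φ.toStarRep a x)
      = α.int.mulRep.tensor φ.toStarRep a (U x) := by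
    intro a
    refine eq_of_generators (S := U.toCLM.comp (α.tildeInt.mulRep.tensor φ.toStarRep a))
      (T := (α.int.mulRep.tensor φ.toStarRep a).comp U.toCLM) _
      (dense_tmul_of_dense φ.toStarRep (fun ξ => α.tildeInt.cls ξ) (id : F → F)
        α.tildeInt.dense_cls (by simp)) fun p => ?_
    refine ext_annihilate φ.toStarRep _ α.int.dense_cls fun η => ?_
    change annihilate φ.toStarRep (α.int.cls η) (U (α.tildeInt.mulRep.tensor φ.toStarRep a
        (tmul φ.toStarRep (α.tildeInt.cls p.1) p.2)))
      = annihilate φ.toStarRep (α.int.cls η) (α.int.mulRep.tensor φ.toStarRep a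
        (U (tmul φ.toStarRep (α.tildeInt.cls p.1) p.2)))
    have h := annihilate_rep φ.toStarRep α.int.mulRep (star a) (α.int.cls η)
      (U (tmul φ.toStarRep (α.tildeInt.cls p.1) p.2))
    rw [star_star] at h
    rw [← h, StarRep.tensor_tmul, IntegrationMap.mulRep_cls, IntegrationMap.mulRep_cls, hL, hL]
    congr 2
    ext g
    simp
    ring
  refine ⟨⟨φ, U, hU, (cocycle_iff α φ.toStarRep U hU L.toLin hL).2 L.map_convolution⟩, fun f => ?_⟩
  ext x
  obtain ⟨e, he⟩ := exists_star_unit f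
  have h := GroupoidRepr.annihilate_U_tmul ⟨φ, U, hU,
    (cocycle_iff α φ.toStarRep U hU L.toLin hL).2 L.map_convolution⟩ e f x
  rw [he] at h
  rw [← h]
  refine (hL e f x).trans ?_
  rw [he]

lemma GroupoidRepr.integrate_surjective [LocallyCompactSpace G0] :
    Function.Surjective (GroupoidRepr.integrate : GroupoidRepr α F → _) := fun π => by
  obtain ⟨R, hR⟩ := π.toConvRep.exists_groupoidRepr
  exact ⟨R, Rep.ext_conv fun f => (R.integrate_toComplHom f).trans (hR f)⟩

end Disintegrate

/-! ### C*-algebras with the same representations -/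

section Uniqueness

variable (A : Type u) [NonUnitalCStarAlgebra A] {B : Type u} [NonUnitalCStarAlgebra B]

/-- A C*-algebra as a Hilbert module over itself. -/
@[reducible] noncomputable def HilbertModule.self : HilbertModule A where
  carrier := A
  pre :=
    { inner := fun x y => star x * y
      act := fun x y => x * y
      inner_add_right := fun x y z => mul_add _ _ _
      inner_smul_right := fun c x y => mul_smul_comm _ _ _
      star_inner := fun x y => by rw [star_mul, star_star]
      inner_self_pos := fun x => ⟨x, rfl⟩
      inner_act_right := fun x y d => (mul_assoc _ _ _).symm }
  norm_eq x := by
    change ‖x‖ = √‖star x * x‖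
    rw [CStarRing.norm_star_mul_self, Real.sqrt_mul_self (norm_nonneg x)]

/-- The representation of a C*-algebra on itself by left multiplication. -/
noncomputable def leftMul : Rep A (HilbertModule.self A) where
  toHom :=
    { toFun := fun a => ContinuousLinearMap.mul ℂ A a
      map_smul' := fun c a => map_smul _ c a
      map_zero' := map_zero _
      map_add' := fun a b => map_add _ a b
      map_mul' := fun a b => ContinuousLinearMap.ext fun x => mul_assoc a b x }
  adjoint a x y := by
    change star (star a * x) * y = star x * (a * y)
    rw [star_mul, star_star, mul_assoc]
  nondegenerate := by
    have h : Submodule.span ℂ {y : A | ∃ a x : A, a * x = y} = ⊤ := by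
      rw [eq_top_iff, ← span_star_mul_self]
      refine Submodule.span_mono ?_
      rintro _ ⟨b, rfl⟩
      exact ⟨star b, b, rfl⟩
    intro x
    refine subset_closure ?_
    have : x ∈ Submodule.span ℂ {y : A | ∃ a x : A, a * x = y} := h ▸ Submodule.mem_top
    exact this

variable {A}

lemma leftMul_apply (a x : A) : leftMul A a x = a * x := rfl

/-- The unitary `A ⊗_π F ≅ F`, `a ⊗ x ↦ π(a) x`, for a nondegenerate representation `π`. -/
noncomputable def actionUnitary {D : Type u} [NonUnitalCStarAlgebra D] {F : HilbertModule D}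
    (π : Rep A F) : Unitary (tensor (HilbertModule.self A) π.toStarRep) F :=
  Unitary.ofGenerators (fun p : A × F => tmul (E := HilbertModule.self A) π.toStarRep p.1 p.2)
    (fun p => π p.1 p.2)
    (fun p q => by
      rw [inner_tmul]
      change F.inner (π.toStarRep p.1 p.2) _ = F.inner p.2 (π (star p.1 * q.1) q.2)
      rw [StarRep.inner_apply_left, map_mul]
      rfl)
    (dense_tmul (E := HilbertModule.self A) π.toStarRep) (by
      convert π.nondegenerate using 4
      ext y
      simp)

lemma actionUnitary_tmul {D : Type u} [NonUnitalCStarAlgebra D] {F : HilbertModule D}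
    (π : Rep A F) (a : A) (x : F) :
    actionUnitary π (tmul (E := HilbertModule.self A) π.toStarRep a x) = π a x :=
  Unitary.ofGenerators_apply
    (fun p : A × F => tmul (E := HilbertModule.self A) π.toStarRep p.1 p.2)
    (fun p => π p.1 p.2) _ _ _ (a, x)

/-- Under `A ⊗_π F ≅ F`, the representation induced from left multiplication becomes `π`. -/
lemma actionUnitary_intertwines {D : Type u} [NonUnitalCStarAlgebra D] {F : HilbertModule D}
    (π : Rep A F) :
    Rep.Intertwines (actionUnitary π).toIsometry ((leftMul A).tensor π.toStarRep) π := by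
  intro a
  refine eq_of_generators
    (S := (actionUnitary π).toCLM.comp ((leftMul A).tensor π.toStarRep a))
    (T := (π a).comp (actionUnitary π).toCLM) _
    (dense_tmul (E := HilbertModule.self A) π.toStarRep) fun p => ?_
  change actionUnitary π ((leftMul A).toStarRep.tensor π.toStarRep a (tmul _ p.1 p.2))
    = π a (actionUnitary π (tmul _ p.1 p.2))
  rw [StarRep.tensor_tmul]
  refine (actionUnitary_tmul π _ _).trans ?_
  rw [actionUnitary_tmul]
  change π (a * p.1) p.2 = _
  rw [map_mul]
  rfl

/-- Bijections between the representations of two C*-algebras on all Hilbert modules. -/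
abbrev RepEquiv (A B : Type u) [NonUnitalCStarAlgebra A] [NonUnitalCStarAlgebra B] :
    Type (u + 1) :=
  ∀ (D : Type u) [NonUnitalCStarAlgebra D] (F : HilbertModule D), Rep A F ≃ Rep B F

/-- Bijections between representations that are natural for isometries and compatible with
induction. -/
structure RepEquiv.Natural (τ : RepEquiv A B) : Prop where
  intertwines : ∀ (D : Type u) [NonUnitalCStarAlgebra D] (F₁ F₂ : HilbertModule D)
    (V : Isometry F₁ F₂) (π₁ : Rep A F₁) (π₂ : Rep A F₂),
    Rep.Intertwines V π₁ π₂ ↔ Rep.Intertwines V (τ D F₁ π₁) (τ D F₂ π₂)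
  tensor : ∀ (D D' : Type u) [NonUnitalCStarAlgebra D] [NonUnitalCStarAlgebra D']
    (F : HilbertModule D) (E : HilbertModule D') (ψ : Rep D E) (π : Rep A F),
    τ D' (tensor F ψ.toStarRep) (π.tensor ψ.toStarRep) = (τ D F π).tensor ψ.toStarRep

/-- The inverse bijections. -/
abbrev RepEquiv.symm (τ : RepEquiv A B) : RepEquiv B A := fun D _ F => (τ D F).symm

namespace RepEquiv

variable {τ : RepEquiv A B}

lemma Natural.symm (h : τ.Natural) : τ.symm.Natural where
  intertwines D _ F₁ F₂ V π₁ π₂ := by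
    rw [h.intertwines, Equiv.apply_symm_apply, Equiv.apply_symm_apply]
  tensor D D' _ _ F E ψ π := by
    rw [Equiv.symm_apply_eq, h.tensor, Equiv.apply_symm_apply]

/-- A representation `π` of `A` and the corresponding representation of `B` are related through
the representation of `B` that corresponds to left multiplication on `A`. -/
lemma Natural.apply_leftMul (h : τ.Natural) {D : Type u} [NonUnitalCStarAlgebra D]
    {F : HilbertModule D} (π : Rep A F) (b : B) (a : A) (x : F) :
    π (τ A (HilbertModule.self A) (leftMul A) b a) x = τ D F π b (π a x) := by
  have h1 := (h.intertwines _ _ _ _ _ _).1 (actionUnitary_intertwines π)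
  rw [h.tensor] at h1
  have h2 := h1 b (tmul (E := HilbertModule.self A) π.toStarRep a x)
  change actionUnitary π ((τ A (HilbertModule.self A) (leftMul A)).toStarRep.tensor π.toStarRep b
    (tmul (E := HilbertModule.self A) π.toStarRep a x)) = τ D F π b (actionUnitary π
      (tmul (E := HilbertModule.self A) π.toStarRep a x)) at h2
  rw [StarRep.tensor_tmul, actionUnitary_tmul] at h2
  exact h2.trans (congrArg _ (actionUnitary_tmul π a x))

/-- The representation of `B` that corresponds to left multiplication on `A` has values in the left
multiplications: multiplying it by elements of `A` on the left gives such values, and their span is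
dense because `A` acts nondegenerately on `B`. -/
lemma Natural.exists_leftMul_eq (h : τ.Natural) (b : B) :
    ∃ a : A, leftMul A a = τ A (HilbertModule.self A) (leftMul A) b := by
  set ρ := τ A (HilbertModule.self A) (leftMul A) with hρ
  set σ := (τ B (HilbertModule.self B)).symm (leftMul B) with hσ
  have hlin : ∀ (b : B) (a x : A), ρ b (a * x) = (show A from ρ b a) * x := by
    intro b a x
    refine (HilbertModule.self A).ext_inner fun z => ?_
    have h1 := ρ.toStarRep.inner_apply b z (a * x)
    have h2 := ρ.toStarRep.inner_apply b z a
    refine h1.trans ?_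
    change star (show A from ρ (star b) z) * (a * x) = star (show A from z) * ((show A from ρ b a) * x)
    rw [← mul_assoc, ← mul_assoc]
    exact congrArg (· * x) h2.symm
  have hmem : ∀ (a : A) (b : B), ∃ c : A, leftMul A c = ρ (σ a b) := by
    intro a b
    refine ⟨star (show A from ρ (star b) (star a)), ?_⟩
    ext x
    have h1 : ρ (σ a b) x = leftMul A a (ρ b x) := by
      have := h.symm.apply_leftMul ρ a b x
      rwa [show τ.symm A (HilbertModule.self A) ρ = leftMul A from Equiv.symm_apply_apply _ _]
        at this
    rw [h1]
    refine (HilbertModule.self A).ext_inner fun z => ?_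
    change star (show A from z) * (star (show A from ρ (star b) (star a)) * (show A from x))
      = star (show A from z) * (a * (show A from ρ b x))
    have h2 := ρ.toStarRep.inner_apply b (star a * (show A from z) : A) x
    change star (star a * (show A from z)) * (show A from ρ b x)
      = star (show A from ρ (star b) (star a * (show A from z))) * (show A from x) at h2
    rw [hlin, star_mul, star_mul, star_star, mul_assoc, mul_assoc] at h2
    exact h2.symm
  have hcl : IsClosed (Set.range (ContinuousLinearMap.mul ℂ A)) :=
    (ContinuousLinearMap.isometry_mul ℂ A).isClosedEmbedding.isClosed_range
  let S : Submodule ℂ B := (LinearMap.range (ContinuousLinearMap.mul ℂ A : A →ₗ[ℂ] A →L[ℂ] A)).comap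
    (ρ.toHom : B →ₗ[ℂ] (HilbertModule.self A →L[ℂ] HilbertModule.self A))
  have hS : IsClosed (S : Set B) := hcl.preimage ρ.toStarRep.continuous
  have hle : Submodule.span ℂ {y : B | ∃ a x, σ a x = y} ≤ S := by
    rw [Submodule.span_le]
    rintro _ ⟨a, x, rfl⟩
    exact hmem a x
  exact closure_minimal hle hS (σ.nondegenerate b)

lemma leftMul_injective : Function.Injective (fun a : A => leftMul A a) :=
  (ContinuousLinearMap.isometry_mul ℂ A).injective

/-- The maps `B → A` and `A → B` obtained from the representations that correspond to left
multiplication are inverse to each other. -/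
lemma Natural.comp_eq (h : τ.Natural) {e : B → A} {f : A → B}
    (he : ∀ b, leftMul A (e b) = τ A (HilbertModule.self A) (leftMul A) b)
    (hf : ∀ a, leftMul B (f a) = τ.symm B (HilbertModule.self B) (leftMul B) a) (a : A) :
    e (f a) = a := by
  set ρ := τ A (HilbertModule.self A) (leftMul A) with hρ
  have h1 : ∀ (b : B) (x : A), leftMul A a (ρ b x) = leftMul A (e (f a)) (ρ b x) := by
    intro b x
    have := h.symm.apply_leftMul ρ a b x
    rw [← hf, show τ.symm A (HilbertModule.self A) ρ = leftMul A from Equiv.symm_apply_apply _ _]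
      at this
    rw [← this, he, leftMul_apply, map_mul]
    rfl
  refine leftMul_injective (ContinuousLinearMap.ext_on ρ.nondegenerate ?_).symm
  rintro _ ⟨b, x, rfl⟩
  exact h1 b x

/-- Two C*-algebras with the same representations are isomorphic, by a unique isomorphism that
induces the bijections on representations. -/
theorem Natural.existsUnique (h : τ.Natural) : ∃! e : B ≃⋆ₐ[ℂ] A,
    ∀ (D : Type u) [NonUnitalCStarAlgebra D] (F : HilbertModule D) (π : Rep A F),
      π.comp e = τ D F π := by
  choose e he using h.exists_leftMul_eq
  choose f hf using h.symm.exists_leftMul_eq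
  set ρ := τ A (HilbertModule.self A) (leftMul A) with hρ
  let e' : B ≃⋆ₐ[ℂ] A :=
    { toFun := e
      invFun := f
      left_inv := h.symm.comp_eq hf he
      right_inv := h.comp_eq he hf
      map_mul' := fun b c => leftMul_injective (by
        change leftMul A _ = leftMul A _
        rw [he, map_mul, map_mul, he, he])
      map_add' := fun b c => leftMul_injective (by
        change leftMul A _ = leftMul A _
        rw [he, map_add, map_add, he, he])
      map_star' := fun b => leftMul_injective (by
        change leftMul A _ = leftMul A _
        rw [he]
        ext x
        refine (HilbertModule.self A).ext_inner fun z => ?_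
        rw [(leftMul A).toStarRep.inner_apply, ρ.toStarRep.inner_apply, star_star, star_star]
        exact congrArg (fun T => (HilbertModule.self A).inner (T z) x) (he b).symm)
      map_smul' := fun c b => leftMul_injective (by
        change leftMul A _ = leftMul A _
        rw [he, map_smul, map_smul, he]) }
  refine ⟨e', fun D _ F π => Rep.ext_apply fun b x => ?_, fun e₁ he₁ => ?_⟩
  · refine congrArg (fun T => T x) (ContinuousLinearMap.ext_on π.nondegenerate ?_ :
      π (e b) = τ D F π b)
    rintro _ ⟨a, y, rfl⟩
    rw [← h.apply_leftMul π b a y, ← he, leftMul_apply, map_mul]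
    rfl
  · refine StarAlgEquiv.ext fun b => leftMul_injective ?_
    change leftMul A (e₁ b) = leftMul A (e b)
    have h1 : (leftMul A).comp e₁ = ρ := he₁ A (HilbertModule.self A) (leftMul A)
    rw [he, ← h1]
    rfl

end RepEquiv

end Uniqueness

end GroupoidRep

theorem mainTheorem1
    {G0 G1 : Type u} [TopologicalSpace G0] [T2Space G0] [LocallyCompactSpace G0]
    [TopologicalSpace G1] [T2Space G1] [LocallyCompactSpace G1]
    [MeasurableSpace G1] [BorelSpace G1]
    (𝒢 : TopGroupoid G0 G1) (α : HaarSystem 𝒢) :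
    ∃ Φ : RepBijections α (GroupoidCStar α),
      Φ.NaturalForIsometries ∧ Φ.CompatibleWithInduction ∧
      ∀ (B : Type u) [NonUnitalCStarAlgebra B] (Ψ : RepBijections α B),
        Ψ.NaturalForIsometries → Ψ.CompatibleWithInduction →
        ∃! e : B ≃⋆ₐ[ℂ] GroupoidCStar α,
          ∀ (D : Type u) [NonUnitalCStarAlgebra D] (F : HilbertModule D)
            (π : Rep (GroupoidCStar α) F), Ψ D F (π.comp e) = Φ D F π := by
  let Φ : RepBijections α (GroupoidCStar α) := fun D _ F =>
    (Equiv.ofBijective (GroupoidRepr.integrate : GroupoidRepr α F → _)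
      ⟨GroupoidRepr.integrate_injective, GroupoidRepr.integrate_surjective⟩).symm
  have hΦ : ∀ (D : Type u) [NonUnitalCStarAlgebra D] (F : HilbertModule D) π,
      (Φ D F π).integrate = π := fun D _ F π => Equiv.apply_symm_apply (Φ D F).symm π
  have hnat : Φ.NaturalForIsometries := fun D _ F₁ F₂ V π₁ π₂ => by
    rw [← GroupoidRepr.intertwines_iff, hΦ, hΦ]
  have hind : Φ.CompatibleWithInduction := fun D D' _ _ F E ψ π =>
    GroupoidRepr.integrate_injective (by rw [hΦ, GroupoidRepr.integrate_induce, hΦ])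
  refine ⟨Φ, hnat, hind, fun B _ Ψ hΨ hΨ' => ?_⟩
  let τ : RepEquiv (GroupoidCStar α) B := fun D _ F => (Φ D F).trans (Ψ D F).symm
  have hτ : ∀ (D : Type u) [NonUnitalCStarAlgebra D] (F : HilbertModule D) π,
      Ψ D F (τ D F π) = Φ D F π := fun D _ F π => Equiv.apply_symm_apply _ _
  have h : τ.Natural :=
    { intertwines := fun D _ F₁ F₂ V π₁ π₂ => by rw [hnat, hΨ, hτ, hτ]
      tensor := fun D D' _ _ F E ψ π =>
        (Ψ D' _).injective (by rw [hτ, hind, hΨ', hτ]) }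
  have hiff : ∀ e : B ≃⋆ₐ[ℂ] GroupoidCStar α,
      (∀ (D : Type u) [NonUnitalCStarAlgebra D] (F : HilbertModule D)
        (π : Rep (GroupoidCStar α) F), Ψ D F (π.comp e) = Φ D F π) ↔
      ∀ (D : Type u) [NonUnitalCStarAlgebra D] (F : HilbertModule D)
        (π : Rep (GroupoidCStar α) F), π.comp e = τ D F π := fun e =>
    ⟨fun he D _ F π => (Ψ D F).injective ((he D F π).trans (hτ D F π).symm),
      fun he D _ F π => by rw [he, hτ]⟩
  simp only [hiff]
  exact h.existsUnique
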